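/- **Setting.** Let $d\ge 1$, $\alpha,\beta,M>0$ and $C_1<C_2$ be fixed. Fix an integer $S>\max(\alpha,\beta)$ and a compactly supported orthonormal wavelet basis of $L^2([0,1])$ of Cohen–Daubechies–Vial type and regularity $S$: from some coarsest level $J_0\ge 1$ on there are, for each level $l$, $2^l$ scaling functions $\varphi_{lm}$ and $2^l$ wavelets $\psi_{lm}$ on $[0,1]$, obtained by dyadic dilation (with factor $2^{l/2}$) from finitely many continuous compactly supported functions (one interior function, translated by integers, and finitely many edge functions at each end point); the scaling functions of level $l$ together with the wavelets of level $l$ are orthonormal and lie in the span of the scaling functions of level $l+1$, and the span of the scaling functions of each level contains all polynomials of degree at most $S-1$. On $[0,1]^d$ put $\Phi_{lm}(x)=\prod_i\varphi_{lm_i}(x_i)$ and, for $\iota\in\{0,1\}^d\setminus\{0\}$, $\Psi^{\iota}_{lm}(x)=\prod_i\psi^{\iota_i}_{lm_i}(x_i)$ with $\psi^0=\varphi$, $\psi^1=\psi$. For $k=2^{ld}$, $l\ge J_0$, let $K_{V_k}(x,y)=\sum_m\Phi_{lm}(x)\Phi_{lm}(y)$. For $s>0$ let $$\|h\|_{s}=2^{J_0(s+d/2)}\max_m|\langle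 h,\Phi_{J_0m}\rangle|+\sup_{l\ge J_0,\,m,\,\iota}2^{l(s+d/2)}|\langle h,\Psi^{\iota}_{lm}\rangle| ,$$ with $\langle g,h\rangle=\int_{[0,1]^d}gh$, and let $H(s,M)$ be the set of continuous $h$ on $[0,1]^d$ with $\|h\|_s\le M$. Let $\mathcal P_{(\alpha,\beta)}$ be the set of all laws $\mathbb P$ of $(X,A,Y)\in\mathbb R^d\times\mathbb R\times\mathbb R$ such that $X$ is uniform on $[0,1]^d$, $A,Y\in[C_1,C_2]$ almost surely, and $p(x)=\mathbb E_{\mathbb P}[A\mid X=x]$ and $b(x)=\mathbb E_{\mathbb P}[Y\mid X=x]$ satisfy $p\in H(\alpha,M)$, $b\in H(\beta,M)$. Assume that some constant $c\in(C_1,C_2)$ has $\|c\|_\alpha<M$ and $\|c\|_\beta<M$ (this holds automatically if $C_1\le 0\le C_2$). Let $\psi(\mathbb P)=\mathbb E_{\mathbb P}[\mathrm{Cov}_{\mathbb P}(A,Y\mid X)]$. From one i.i.d. sample $(X_i,A_i,Y_i)_{i\le n}$ from $\mathbb P$ (no sample splitting) form $$\hat p_{k}(x)=\frac1n\sum_{i=1}^nA_iK_{V_k}(X_i,x),\qquad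 \hat b_{k}(x)=\frac1n\sum_{i=1}^nY_iK_{V_k}(X_i,x),$$ $$\hat\psi^{\mathrm{INT}}_{k_1,k_2}=\frac1n\sum_iA_iY_i-\int_{[0,1]^d}\hat p_{k_1}(x)\hat b_{k_2}(x)\,dx,\qquad \hat\psi^{\mathrm{MC}}_{k_1,k_2}=\frac1n\sum_iA_iY_i-\frac1n\sum_i\hat p_{k_1}(X_i)\hat b_{k_2}(X_i),$$ $$\hat\psi^{\mathrm{IF}}_{k_1,k_2}=\frac1n\sum_i(A_i-\hat p_{k_1}(X_i))(Y_i-\hat b_{k_2}(X_i)).$$ Let $k_1=k_1(n)$ and $k_2=k_2(n)$ be arbitrary sequences of resolutions of the form $2^{ld}$, $l\ge J_0$, and put $k_{\min}=k_1\wedge k_2$, $k_{\max}=k_1\vee k_2$. Here $a_n\lesssim b_n$ means that $a_n\le Cb_n$ for some constant $C>0$ and all sufficiently large $n$; $a_n\asymp b_n$ means $a_n\lesssim b_n$ and $b_n\lesssim a_n$; and $a_n\ll b_n$ means $a_n/b_n\to0$. **Theorem.** With all suprema over $\mathbb P\in\mathcal P_{(\alpha,\beta)}$: 1. $\displaystyle\sup_{\mathbb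 P}\bigl|\mathbb E_{\mathbb P}(\hat\psi^{\mathrm{INT}}_{k_1,k_2}-\psi(\mathbb P))\bigr|\asymp k_{\min}^{-(\alpha+\beta)/d}\vee\frac{k_{\min}}n$ and $\displaystyle\sup_{\mathbb P}\mathrm{Var}_{\mathbb P}(\hat\psi^{\mathrm{INT}}_{k_1,k_2})\lesssim\frac1n+\frac{k_{\min}^2}{n^2}$. 2. If $k_1,k_2\ll n$, then $\displaystyle\sup_{\mathbb P}\bigl|\mathbb E_{\mathbb P}(\hat\psi^{\mathrm{MC}}_{k_1,k_2}-\psi(\mathbb P))\bigr|\asymp k_{\min}^{-(\alpha+\beta)/d}\vee\frac{k_{\max}}n$; and for any $k_1,k_2$, $$\sup_{\mathbb P}\mathrm{Var}_{\mathbb P}(\hat\psi^{\mathrm{MC}}_{k_1,k_2})\lesssim\frac1n+\frac{k_{\min}^2}{n^2}+\frac{k_{\max}}{n^2}+\frac{k_{\min}k_{\max}}{n^3}+\frac{k_{\max}^2}{n^3}+\frac{k_{\min}^2k_{\max}}{n^4}+\frac{k_{\min}^2k_{\max}^2}{n^5}.$$ 3. If $k_1,k_2\ll n$, then $\displaystyle\sup_{\mathbb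 P}\bigl|\mathbb E_{\mathbb P}(\hat\psi^{\mathrm{IF}}_{k_1,k_2}-\psi(\mathbb P))\bigr|\asymp k_{\max}^{-(\alpha+\beta)/d}\vee\frac{k_{\max}}n$; and for any $k_1,k_2$, $$\sup_{\mathbb P}\mathrm{Var}_{\mathbb P}(\hat\psi^{\mathrm{IF}}_{k_1,k_2})\lesssim\frac1n+\frac{k_{\min}^2}{n^2}+\frac{k_{\max}}{n^2}+\frac{k_{\max}^2}{n^3}+\frac{k_{\min}^2k_{\max}}{n^4}+\frac{k_{\min}^2k_{\max}^2}{n^5}.$$ -/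

import Mathlib

open MeasureTheory Filter Topology Set
open scoped ENNReal NNReal

noncomputable section

/-! ### Boundary-corrected wavelets on the unit interval -/

/-- The `2 ^ j` functions at level `j` generated on `[0, 1]` by an interior function `f`, by `N`
left edge functions `fL k` and by `N` right edge functions `fR k` (the right edge functions are
written in the reflected variable `1 - x`):
`2 ^ (j / 2) * fL m (2 ^ j x)` for `m < N`, `2 ^ (j / 2) * f (2 ^ j x - m)` for `N ≤ m < 2 ^ j - N`,
and `2 ^ (j / 2) * fR (2 ^ j - 1 - m) (2 ^ j (1 - x))` for `2 ^ j - N ≤ m < 2 ^ j`. -/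
def dilates (N : ℕ) (f : ℝ → ℝ) (fL fR : ℕ → ℝ → ℝ) (j : ℕ) (m : Fin (2 ^ j)) (x : ℝ) : ℝ :=
  (2 : ℝ) ^ ((j : ℝ) / 2) *
    (if (m : ℕ) < N then fL m (2 ^ j * x)
     else if (m : ℕ) < 2 ^ j - N then f (2 ^ j * x - (m : ℕ))
     else fR (2 ^ j - 1 - m) (2 ^ j * (1 - x)))

/-- A compactly supported orthonormal wavelet basis of `L²([0, 1])` of Cohen–Daubechies–Vial type
and regularity `S`: a scaling function `φ` and a wavelet `ψ`, together with `N` edge functions of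
each kind at each end point, all continuous and compactly supported, whose dilates and translates
form an orthonormal multiresolution analysis from level `J₀` on that contains the polynomials of
degree at most `S - 1`. Since there are `2 ^ j` scaling functions and `2 ^ j` wavelets at level `j`,
the fields say that `V (j + 1)` is the orthogonal sum of `V j` and the span of the wavelets of
level `j`. No smoothness beyond continuity is asked for. -/
structure CDVBasis (S : ℕ) where
  /-- number of edge functions at each end point -/
  N : ℕ
  /-- coarsest level -/
  J₀ : ℕ
  /-- interior scaling function -/
  φ : ℝ → ℝ
  /-- interior wavelet -/
  ψ : ℝ → ℝ
  /-- left edge scaling functions -/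
  φL : ℕ → ℝ → ℝ
  /-- right edge scaling functions -/
  φR : ℕ → ℝ → ℝ
  /-- left edge wavelets -/
  ψL : ℕ → ℝ → ℝ
  /-- right edge wavelets -/
  ψR : ℕ → ℝ → ℝ
  one_le_J₀ : 1 ≤ J₀
  two_mul_N_le : 2 * N ≤ 2 ^ J₀
  continuous_φ : Continuous φ
  continuous_ψ : Continuous ψ
  compact_φ : HasCompactSupport φ
  compact_ψ : HasCompactSupport ψ
  continuous_edge : ∀ k < N, ContinuousOn (φL k) (Ici 0) ∧ ContinuousOn (φR k) (Ici 0) ∧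
    ContinuousOn (ψL k) (Ici 0) ∧ ContinuousOn (ψR k) (Ici 0)
  compact_edge : ∃ R : ℝ, ∀ k < N, ∀ x > R, φL k x = 0 ∧ φR k x = 0 ∧ ψL k x = 0 ∧ ψR k x = 0
  /-- the scaling functions of one level are orthonormal in `L²([0, 1])` -/
  orthonormal_φ : ∀ j, J₀ ≤ j → ∀ m m' : Fin (2 ^ j),
    ∫ x in Icc (0 : ℝ) 1, dilates N φ φL φR j m x * dilates N φ φL φR j m' x =
      if m = m' then 1 else 0
  /-- the wavelets of one level are orthonormal in `L²([0, 1])` -/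
  orthonormal_ψ : ∀ j, J₀ ≤ j → ∀ m m' : Fin (2 ^ j),
    ∫ x in Icc (0 : ℝ) 1, dilates N ψ ψL ψR j m x * dilates N ψ ψL ψR j m' x =
      if m = m' then 1 else 0
  /-- the wavelets are orthogonal to the scaling functions of the same level -/
  orthogonal : ∀ j, J₀ ≤ j → ∀ m m' : Fin (2 ^ j),
    ∫ x in Icc (0 : ℝ) 1, dilates N φ φL φR j m x * dilates N ψ ψL ψR j m' x = 0
  /-- the scaling functions of level `j` lie in the span of those of level `j + 1` -/
  refine_φ : ∀ j, J₀ ≤ j → ∀ m : Fin (2 ^ j), ∃ c : Fin (2 ^ (j + 1)) → ℝ,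
    ∀ x ∈ Icc (0 : ℝ) 1, dilates N φ φL φR j m x = ∑ r, c r * dilates N φ φL φR (j + 1) r x
  /-- the wavelets of level `j` lie in the span of the scaling functions of level `j + 1` -/
  refine_ψ : ∀ j, J₀ ≤ j → ∀ m : Fin (2 ^ j), ∃ c : Fin (2 ^ (j + 1)) → ℝ,
    ∀ x ∈ Icc (0 : ℝ) 1, dilates N ψ ψL ψR j m x = ∑ r, c r * dilates N φ φL φR (j + 1) r x
  /-- polynomials of degree less than `S` are combinations of scaling functions -/
  polynomial : ∀ j, J₀ ≤ j → ∀ q : Polynomial ℝ, q.degree < (S : WithBot ℕ) →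
    ∃ c : Fin (2 ^ j) → ℝ, ∀ x ∈ Icc (0 : ℝ) 1,
      q.eval x = ∑ m, c m * dilates N φ φL φR j m x

namespace CDVBasis

variable {S : ℕ} (W : CDVBasis S)

/-- One-dimensional scaling function `φ_{j m}` on `[0, 1]`. -/
def scaling (j : ℕ) (m : Fin (2 ^ j)) (x : ℝ) : ℝ := dilates W.N W.φ W.φL W.φR j m x

/-- One-dimensional wavelet `ψ_{j m}` on `[0, 1]`. -/
def wavelet (j : ℕ) (m : Fin (2 ^ j)) (x : ℝ) : ℝ := dilates W.N W.ψ W.ψL W.ψR j m x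

/-! ### Tensor products on the unit cube -/

/-- `Φ_{l m}(x) = ∏ i, φ_{l m_i}(x_i)`; the span of these functions is `V_k`, `k = 2 ^ (l d)`. -/
def Phi {d : ℕ} (l : ℕ) (m : Fin d → Fin (2 ^ l)) (x : Fin d → ℝ) : ℝ :=
  ∏ i, W.scaling l (m i) (x i)

/-- `Ψ^ι_{l m}(x) = ∏ i, ψ^{ι_i}_{l m_i}(x_i)`, where `ψ⁰ = φ` and `ψ¹ = ψ`. -/
def Psi {d : ℕ} (ι : Fin d → Fin 2) (l : ℕ) (m : Fin d → Fin (2 ^ l)) (x : Fin d → ℝ) : ℝ :=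
  ∏ i, if ι i = 0 then W.scaling l (m i) (x i) else W.wavelet l (m i) (x i)

/-- The kernel of the orthogonal projection of `L²([0, 1]^d)` onto `V_k`, `k = 2 ^ (l d)`. -/
def kernel {d : ℕ} (l : ℕ) (x y : Fin d → ℝ) : ℝ :=
  ∑ m : Fin d → Fin (2 ^ l), W.Phi l m x * W.Phi l m y

/-- The wavelet norm of smoothness `s` of a function on `[0, 1]^d`:
`2^{J₀(s+d/2)} ‖⟨h, Φ_{J₀ ·}⟩‖_∞ + sup_{l ≥ J₀, m, ι ≠ 0} 2^{l(s+d/2)} |⟨h, Ψ^ι_{l m}⟩|`. -/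
def holderNorm {d : ℕ} (s : ℝ) (h : (Fin d → ℝ) → ℝ) : ℝ≥0∞ :=
  ENNReal.ofReal ((2 : ℝ) ^ ((W.J₀ : ℝ) * (s + (d : ℝ) / 2))) *
      (⨆ m : Fin d → Fin (2 ^ W.J₀), ‖∫ x in Icc (0 : Fin d → ℝ) 1, h x * W.Phi W.J₀ m x‖ₑ) +
    ⨆ (l : ℕ) (_ : W.J₀ ≤ l) (m : Fin d → Fin (2 ^ l)) (ι : Fin d → Fin 2) (_ : ι ≠ 0),
      ENNReal.ofReal ((2 : ℝ) ^ ((l : ℝ) * (s + (d : ℝ) / 2))) *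
        ‖∫ x in Icc (0 : Fin d → ℝ) 1, h x * W.Psi ι l m x‖ₑ

/-- The Hölder ball `H(s, M)`: the (uniformly) continuous functions on `[0, 1]^d` whose wavelet
norm of smoothness `s` is at most `M`. -/
def holderBall (d : ℕ) (s M : ℝ) : Set ((Fin d → ℝ) → ℝ) :=
  {h | ContinuousOn h (Icc 0 1) ∧ W.holderNorm s h ≤ ENNReal.ofReal M}

end CDVBasis

/-! ### The statistical model -/

/-- One observation `O = (X, A, Y)`. -/
abbrev Obs (d : ℕ) : Type := (Fin d → ℝ) × ℝ × ℝ

namespace Obs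

variable {d : ℕ}

/-- The covariates. -/
def X (o : Obs d) : Fin d → ℝ := o.1

/-- The treatment. -/
def A (o : Obs d) : ℝ := o.2.1

/-- The outcome. -/
def Y (o : Obs d) : ℝ := o.2.2

/-- The `σ`-algebra generated by the covariates. -/
abbrev sigmaX (d : ℕ) : MeasurableSpace (Obs d) :=
  MeasurableSpace.comap (Obs.X (d := d)) inferInstance

end Obs

/-- The conditional covariance `Cov_P(A, Y | X)`. -/
def condCovAY {d : ℕ} (P : Measure (Obs d)) : Obs d → ℝ :=
  P[fun o => (o.A - (P[Obs.A|Obs.sigmaX d]) o) * (o.Y - (P[Obs.Y|Obs.sigmaX d]) o)|Obs.sigmaX d]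

/-- The functional `ψ(P) = E_P[Cov_P(A, Y | X)]`. -/
def psi {d : ℕ} (P : Measure (Obs d)) : ℝ := ∫ o, condCovAY P o ∂P

/-- The model: `X` is uniform on `[0, 1]^d`, `A` and `Y` lie in `[C₁, C₂]` almost surely, and the
regression functions `p(x) = E[A | X = x]` and `b(x) = E[Y | X = x]` lie in `H(α, M)` and
`H(β, M)`. -/
def CDVBasis.model {S : ℕ} (W : CDVBasis S) (d : ℕ) (α β M C₁ C₂ : ℝ) : Set (Measure (Obs d)) :=
  {P | IsProbabilityMeasure P ∧
    P.map Obs.X = (volume : Measure (Fin d → ℝ)).restrict (Icc 0 1) ∧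
    (∀ᵐ o ∂P, o.A ∈ Icc C₁ C₂ ∧ o.Y ∈ Icc C₁ C₂) ∧
    (∃ p ∈ W.holderBall d α M, P[Obs.A|Obs.sigmaX d] =ᵐ[P] fun o => p o.X) ∧
    (∃ b ∈ W.holderBall d β M, P[Obs.Y|Obs.sigmaX d] =ᵐ[P] fun o => b o.X)}

/-! ### The estimators computed from one sample of size `n` -/

namespace CDVBasis

variable {S : ℕ} (W : CDVBasis S) {d n : ℕ}

/-- Wavelet projection estimator of `p` at level `l`. -/
def pHat (l : ℕ) (D : Fin n → Obs d) (x : Fin d → ℝ) : ℝ :=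
  (1 / (n : ℝ)) * ∑ i, (D i).A * W.kernel l (D i).X x

/-- Wavelet projection estimator of `b` at level `l`. -/
def bHat (l : ℕ) (D : Fin n → Obs d) (x : Fin d → ℝ) : ℝ :=
  (1 / (n : ℝ)) * ∑ i, (D i).Y * W.kernel l (D i).X x

/-- Integral-based plug-in estimator without sample splitting. -/
def psiINT (l₁ l₂ : ℕ) (D : Fin n → Obs d) : ℝ :=
  (1 / (n : ℝ)) * ∑ i, (D i).A * (D i).Y -
    ∫ x in Icc (0 : Fin d → ℝ) 1, W.pHat l₁ D x * W.bHat l₂ D x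

/-- Monte Carlo-based plug-in estimator without sample splitting. -/
def psiMC (l₁ l₂ : ℕ) (D : Fin n → Obs d) : ℝ :=
  (1 / (n : ℝ)) * ∑ i, (D i).A * (D i).Y -
    (1 / (n : ℝ)) * ∑ i, W.pHat l₁ D (D i).X * W.bHat l₂ D (D i).X

/-- First-order bias-corrected estimator without sample splitting. -/
def psiIF (l₁ l₂ : ℕ) (D : Fin n → Obs d) : ℝ :=
  (1 / (n : ℝ)) * ∑ i, ((D i).A - W.pHat l₁ D (D i).X) * ((D i).Y - W.bHat l₂ D (D i).X)

end CDVBasis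

/-- `sup_{P ∈ Q} |E_P(T - ψ(P))|` for an estimator `T` computed from `n` i.i.d. observations. -/
def supBias {d n : ℕ} (Q : Set (Measure (Obs d))) (T : (Fin n → Obs d) → ℝ) : ℝ≥0∞ :=
  ⨆ P ∈ Q, ENNReal.ofReal |∫ D, (T D - psi P) ∂(Measure.pi fun _ : Fin n => P)|

/-- `sup_{P ∈ Q} Var_P(T)` for an estimator `T` computed from `n` i.i.d. observations. -/
def supVar {d n : ℕ} (Q : Set (Measure (Obs d))) (T : (Fin n → Obs d) → ℝ) : ℝ≥0∞ :=
  ⨆ P ∈ Q, ProbabilityTheory.evariance T (Measure.pi fun _ : Fin n => P)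

/-! ### Asymptotic comparison of sequences -/

/-- `a_n ≲ b_n`, for `a` with values in `[0, ∞]` and a real sequence `b`. -/
def AsympLE (a : ℕ → ℝ≥0∞) (b : ℕ → ℝ) : Prop :=
  ∃ C : ℝ, 0 < C ∧ ∃ n₀ : ℕ, ∀ n ≥ n₀, a n ≤ ENNReal.ofReal (C * b n)

/-- `a_n ≳ b_n`, for `a` with values in `[0, ∞]` and a real sequence `b`. -/
def AsympGE (a : ℕ → ℝ≥0∞) (b : ℕ → ℝ) : Prop :=
  ∃ C : ℝ, 0 < C ∧ ∃ n₀ : ℕ, ∀ n ≥ n₀, ENNReal.ofReal (C * b n) ≤ a n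

/-- `a_n ≍ b_n`. -/
def AsympEQ (a : ℕ → ℝ≥0∞) (b : ℕ → ℝ) : Prop := AsympLE a b ∧ AsympGE a b

/-- `a_n ≪ b_n`. -/
def MuchLess (a b : ℕ → ℝ) : Prop := Tendsto (fun n => a n / b n) atTop (𝓝 0)

/-- The resolution `k = 2 ^ (l d)` that belongs to the level `l`. -/
def resolution (d l : ℕ) : ℝ := (2 : ℝ) ^ (l * d)

/-- `k_min = k₁ ∧ k₂`. -/
def kMin (d l₁ l₂ : ℕ) : ℝ := min (resolution d l₁) (resolution d l₂)

/-- `k_max = k₁ ∨ k₂`. -/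
def kMax (d l₁ l₂ : ℕ) : ℝ := max (resolution d l₁) (resolution d l₂)

end

/-!
The estimators are V-statistics: almost surely each of them is a signed sum of
`(1/n) ∑ AᵢYᵢ`, of double sums `(1/n²) ∑ AᵢYⱼ K(Xᵢ, Xⱼ)` and of a triple sum
`(1/n³) ∑ Aⱼ K₁(Xⱼ, Xᵢ) Yₗ K₂(Xₗ, Xᵢ)`. Three facts on the projection kernels, which follow from the
localization of the basis functions and from the multiresolution structure, carry the proof:
`|K_l| ≲ 2^{ld}` and `∫ |K_l(x, y)| dy ≲ 1` (`exists_kernel_bound`), the projection property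
`∫ K_l(x, z) K_{l'}(y, z) dz = K_{min l l'}(x, y)` (`integral_kernel_mul_kernel`), and
`∫ K_l(x, x) dx = 2^{ld}` (`integral_kernel_self`).

*Variance.* By the Efron–Stein inequality (`efronStein`) the variance is at most the sum over the
sample points of the mean squared effect of changing that point. The terms of a V-statistic that
contain a given point are summed with the help of the two kernel bounds
(`evariance_vStat₁_le`, `evariance_vStat₂_le`, `evariance_vStat₃_le`).

*Bias.* Splitting the sums according to which indices coincide gives exact formulas for the bias
(`bias_psiINT`, `bias_psiMC`, `bias_psiIF`). The terms with distinct indices produce the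
approximation error `∫ p b - ⟨Π_l p, Π_l b⟩` at level `l = min l₁ l₂`, respectively
`l = max l₁ l₂` for the bias-corrected estimator, because
`Q_{l₁} + Q_{l₂} - Q_{min} = Q_{max}` for `Q_l = ⟨Π_l p, Π_l b⟩`; by Parseval and the decay of the
wavelet coefficients it is at most of order `2^{-l(α+β)}` (`abs_integral_sub_projInner_le`). The
remaining terms are of order `k_min / n` or `k_max / n`.

*Lower bounds.* Regression functions `c + bump` with all wavelets of one level make the
approximation error of the exact order (`integral_const_add_bump_mul`). With constant regression
functions there is no approximation error, and changing the conditional covariance changes the bias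
by a multiple of `k_min / n` for the integral-based and of `k_max / n` for the bias-corrected
estimator (`le_supBias_psiINT`, `le_supBias_psiIF`). For the Monte Carlo estimator it suffices that
the constant is not zero, since then all terms with coinciding indices have the same sign
(`le_supBias_psiMC`).
-/

/-! ### Product measures and the Efron–Stein inequality -/

section ProductMeasure

variable {Ω : Type*} [MeasurableSpace Ω] {P : Measure Ω} [IsProbabilityMeasure P] {n : ℕ}

/-- Resampling one coordinate of an i.i.d. sample does not change its law. -/
theorem measurePreserving_update (t : Fin n) :
    MeasurePreserving (fun q : (Fin n → Ω) × Ω => Function.update q.1 t q.2)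
      ((Measure.pi fun _ : Fin n => P).prod P) (Measure.pi fun _ : Fin n => P) := by
  have hm : Measurable (fun q : (Fin n → Ω) × Ω => Function.update q.1 t q.2) := by
    refine measurable_pi_lambda _ fun j => ?_
    by_cases h : j = t
    · subst h; simpa using measurable_snd
    · simp only [Function.update_of_ne h]
      exact (measurable_pi_apply j).comp measurable_fst
  refine ⟨hm, ?_⟩
  symm
  refine Measure.pi_eq fun s hs => ?_
  rw [Measure.map_apply hm (MeasurableSet.univ_pi hs)]
  have : (fun q : (Fin n → Ω) × Ω => Function.update q.1 t q.2) ⁻¹' (Set.pi univ s) =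
      (Set.pi univ (Function.update s t univ)) ×ˢ (s t) := by
    ext q
    simp only [mem_preimage, Set.mem_pi, mem_univ, true_imp_iff, mem_prod]
    constructor
    · intro h
      refine ⟨fun j => ?_, by simpa using h t⟩
      by_cases hj : j = t
      · subst hj; simp
      · simpa [Function.update_of_ne hj] using h j
    · rintro ⟨h1, h2⟩ j
      by_cases hj : j = t
      · subst hj; simpa using h2
      · simpa [Function.update_of_ne hj] using h1 j
  rw [this, Measure.prod_prod, Measure.pi_pi, ← Finset.prod_erase_mul _ _ (Finset.mem_univ t),
    ← Finset.prod_erase_mul (Finset.univ) (fun i => P (s i)) (Finset.mem_univ t)]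
  simp only [Function.update_self, measure_univ, mul_one]
  congr 1
  refine Finset.prod_congr rfl fun j hj => ?_
  rw [Function.update_of_ne (Finset.ne_of_mem_erase hj)]

theorem lintegral_pi_update (t : Fin n) {F : (Fin n → Ω) → ℝ≥0∞} (hF : Measurable F) :
    ∫⁻ D, F D ∂(Measure.pi fun _ : Fin n => P) =
      ∫⁻ D, ∫⁻ y, F (Function.update D t y) ∂P ∂(Measure.pi fun _ : Fin n => P) := by
  have h := measurePreserving_update (P := P) t
  rw [← h.lintegral_comp hF]
  exact lintegral_prod _ (hF.comp h.measurable).aemeasurable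

theorem integral_pi_update (t : Fin n) {F : (Fin n → Ω) → ℝ}
    (hF : Integrable F (Measure.pi fun _ : Fin n => P)) :
    ∫ D, F D ∂(Measure.pi fun _ : Fin n => P) =
      ∫ D, ∫ y, F (Function.update D t y) ∂P ∂(Measure.pi fun _ : Fin n => P) := by
  have h := measurePreserving_update (P := P) t
  have h1 := h.map_eq
  rw [← integral_prod (fun q : (Fin n → Ω) × Ω => F (Function.update q.1 t q.2))
    (h.integrable_comp_of_integrable hF)]
  conv_lhs => rw [← h1]
  rw [integral_map h.measurable.aemeasurable (by rw [h1]; exact hF.aestronglyMeasurable)]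

theorem integral_pi_eval (i : Fin n) {f : Ω → ℝ} (hf : AEStronglyMeasurable f P) :
    ∫ D, f (D i) ∂(Measure.pi fun _ : Fin n => P) = ∫ x, f x ∂P := by
  have h := measurePreserving_eval (fun _ : Fin n => P) i
  conv_rhs => rw [← h.map_eq]
  rw [integral_map h.measurable.aemeasurable (by rw [h.map_eq]; exact hf)]

theorem integrable_of_measurable_of_bound {α : Type*} [MeasurableSpace α] {μ : Measure α}
    [IsFiniteMeasure μ] {f : α → ℝ} (hf : Measurable f) {B : ℝ} (hB : ∀ x, |f x| ≤ B) :
    Integrable f μ :=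
  Integrable.of_bound hf.aestronglyMeasurable B (Eventually.of_forall hB)

theorem abs_integral_le_of_bound {f : Ω → ℝ} {B : ℝ} (hB : ∀ x, |f x| ≤ B) :
    |∫ x, f x ∂P| ≤ B := by
  refine (norm_integral_le_of_norm_le_const (μ := P) (f := f)
    (Eventually.of_forall fun z => hB z)).trans ?_
  simp

theorem integral_pi_two {i j : Fin n} (hij : i ≠ j) {f : Ω → Ω → ℝ}
    (hf : Measurable (Function.uncurry f)) {B : ℝ} (hB : ∀ x y, |f x y| ≤ B) :
    ∫ D, f (D i) (D j) ∂(Measure.pi fun _ : Fin n => P) = ∫ x, ∫ y, f x y ∂P ∂P := by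
  have hm : Measurable fun D : Fin n → Ω => f (D i) (D j) :=
    hf.comp (f := fun D : Fin n → Ω => (D i, D j))
      ((measurable_pi_apply i).prodMk (measurable_pi_apply j))
  rw [integral_pi_update j (integrable_of_measurable_of_bound hm fun D => hB _ _)]
  simp only [Function.update_self, Function.update_of_ne hij]
  exact integral_pi_eval i (f := fun x => ∫ y, f x y ∂P)
    (hf.stronglyMeasurable.integral_prod_right).aestronglyMeasurable

theorem integral_pi_three {i j l : Fin n} (hij : i ≠ j) (hil : i ≠ l) (hjl : j ≠ l)
    {f : Ω → Ω → Ω → ℝ} (hf : Measurable fun q : (Ω × Ω) × Ω => f q.1.1 q.1.2 q.2) {B : ℝ}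
    (hB : ∀ x y z, |f x y z| ≤ B) :
    ∫ D, f (D i) (D j) (D l) ∂(Measure.pi fun _ : Fin n => P) =
      ∫ x, ∫ y, ∫ z, f x y z ∂P ∂P ∂P := by
  have hm : Measurable fun D : Fin n → Ω => f (D i) (D j) (D l) :=
    hf.comp (f := fun D : Fin n → Ω => ((D i, D j), D l))
      (((measurable_pi_apply i).prodMk (measurable_pi_apply j)).prodMk (measurable_pi_apply l))
  rw [integral_pi_update l (integrable_of_measurable_of_bound hm fun D => hB _ _ _)]
  simp only [Function.update_self, Function.update_of_ne hil, Function.update_of_ne hjl]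
  refine integral_pi_two hij (f := fun x y => ∫ z, f x y z ∂P) (B := B) ?_ fun x y => ?_
  · exact (hf.stronglyMeasurable.integral_prod_right (ν := P)).measurable
  · exact abs_integral_le_of_bound fun z => hB x y z

theorem integral_sub_const_sq {f : Ω → ℝ} (hf : Measurable f) {B : ℝ} (hB : ∀ x, |f x| ≤ B)
    (c : ℝ) : ∫ x, (f x - c) ^ 2 ∂P = ∫ x, f x ^ 2 ∂P - 2 * c * ∫ x, f x ∂P + c ^ 2 := by
  have i1 : Integrable (fun x => 2 * c * f x) P :=
    (integrable_of_measurable_of_bound hf hB).const_mul _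
  have i2 : Integrable (fun x => f x ^ 2) P :=
    integrable_of_measurable_of_bound (hf.pow_const 2) (B := B ^ 2) fun x => by
      rw [abs_pow]; exact pow_le_pow_left₀ (abs_nonneg _) (hB x) 2
  have i3 : Integrable (fun x => f x ^ 2 - 2 * c * f x) P := i2.sub i1
  have e : ∀ x, (f x - c) ^ 2 = f x ^ 2 - 2 * c * f x + c ^ 2 := fun x => by ring
  simp_rw [e]
  rw [integral_add i3 (integrable_const _), integral_sub i2 i1, integral_const_mul]
  simp

theorem sq_integral_le {f : Ω → ℝ} (hf : Measurable f) {B : ℝ} (hB : ∀ x, |f x| ≤ B) :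
    (∫ x, f x ∂P) ^ 2 ≤ ∫ x, f x ^ 2 ∂P := by
  have h := integral_sub_const_sq (P := P) hf hB (∫ x, f x ∂P)
  have h2 : 0 ≤ ∫ x, (f x - ∫ z, f z ∂P) ^ 2 ∂P := integral_nonneg fun y => sq_nonneg _
  nlinarith

/-- The Efron–Stein inequality for bounded functions of independent variables: the variance is at
most the sum of the mean square distances to functions `g s` that do not depend on the `s`-th
variable. The proof integrates out one variable at a time. -/
theorem efronStein {n : ℕ} {f : (Fin n → Ω) → ℝ} {g : Fin n → (Fin n → Ω) → ℝ} (hf : Measurable f)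
    (hg : ∀ s, Measurable (g s)) {B : ℝ} (hfB : ∀ D, |f D| ≤ B) (hgB : ∀ s D, |g s D| ≤ B)
    (hgs : ∀ s D y, g s (Function.update D s y) = g s D) :
    ∫ D, f D ^ 2 ∂(Measure.pi fun _ : Fin n => P) -
        (∫ D, f D ∂(Measure.pi fun _ : Fin n => P)) ^ 2 ≤
      ∑ s, ∫ D, (f D - g s D) ^ 2 ∂(Measure.pi fun _ : Fin n => P) := by
  induction n with
  | zero =>
    have : ∀ D, f D = f Fin.elim0 := fun D => congrArg f (Subsingleton.elim _ _)
    simp_rw [this]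
    simp
  | succ n ih =>
    set ν := Measure.pi fun _ : Fin n => P with hν
    -- the sample splits into its first observation and the rest
    have hmp := (measurePreserving_piFinSuccAbove (fun _ : Fin (n + 1) => P) 0).symm
    have key : ∀ F : (Fin (n + 1) → Ω) → ℝ, Measurable F → ∀ C, (∀ D, |F D| ≤ C) →
        ∫ D, F D ∂(Measure.pi fun _ : Fin (n + 1) => P) =
          ∫ D', ∫ y, F (Fin.cons y D') ∂P ∂ν := by
      intro F hF C hC
      rw [← hmp.integral_comp']
      rw [integral_prod_symm]
      · simp only [MeasurableEquiv.piFinSuccAbove_symm_apply, Fin.insertNthEquiv_zero]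
        rfl
      · exact integrable_of_measurable_of_bound (hF.comp (MeasurableEquiv.measurable _))
          (fun D => hC _)
    have hcons : Measurable fun q : (Fin n → Ω) × Ω => (Fin.cons q.2 q.1 : Fin (n + 1) → Ω) := by
      refine measurable_pi_lambda _ fun j => ?_
      refine Fin.cases ?_ (fun j => ?_) j
      · simpa using measurable_snd
      · simp only [Fin.cons_succ]
        exact (measurable_pi_apply j).comp measurable_fst
    have hint : ∀ F : (Fin (n + 1) → Ω) → ℝ, Measurable F →
        Measurable fun D' : Fin n → Ω => ∫ y, F (Fin.cons y D') ∂P := fun F hF =>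
      (StronglyMeasurable.integral_prod_right (ν := P) (f := fun D' y => F (Fin.cons y D'))
        (hF.comp hcons).stronglyMeasurable).measurable
    have hc1 : ∀ D' : Fin n → Ω, Measurable fun y : Ω => (Fin.cons y D' : Fin (n + 1) → Ω) :=
      fun D' => hcons.comp measurable_prodMk_left
    have hsq : ∀ x y : ℝ, |x| ≤ y → |x ^ 2| ≤ y ^ 2 := fun x y h => by
      rw [abs_pow]; exact pow_le_pow_left₀ (abs_nonneg _) h 2
    have hd : ∀ s D, |f D - g s D| ≤ 2 * B := fun s D =>
      (abs_sub _ _).trans (by linarith [hfB D, hgB s D])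
    set h : (Fin n → Ω) → ℝ := fun D' => ∫ y, f (Fin.cons y D') ∂P with hh
    have hhB : ∀ D', |h D'| ≤ B := fun D' => abs_integral_le_of_bound fun y => hfB _
    have hg'B : ∀ s D', |∫ y, g (Fin.succ s) (Fin.cons y D') ∂P| ≤ B := fun s D' =>
      abs_integral_le_of_bound fun y => hgB _ _
    have ih' := ih (f := h) (g := fun s D' => ∫ y, g (Fin.succ s) (Fin.cons y D') ∂P)
      (hint f hf) (fun s => hint _ (hg _)) hhB hg'B (fun s D' y => by
        refine integral_congr_ae (Eventually.of_forall fun z => ?_)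
        simp only
        rw [Fin.cons_update, hgs])
    rw [key _ (hf.pow_const 2) (B ^ 2) fun D => hsq _ _ (hfB D), key f hf B hfB, Fin.sum_univ_succ]
    have first_le : ∫ D', ∫ y, f (Fin.cons y D') ^ 2 ∂P ∂ν - ∫ D', h D' ^ 2 ∂ν ≤
        ∫ D, (f D - g 0 D) ^ 2 ∂(Measure.pi fun _ : Fin (n + 1) => P) := by
      have hfg : Measurable fun D => f D - g 0 D := hf.sub (hg 0)
      rw [key _ (hfg.pow_const 2) ((2 * B) ^ 2) fun D => hsq _ _ (hd 0 D), ← integral_sub]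
      · refine integral_mono_of_nonneg ?_ ?_ (Eventually.of_forall fun D' => ?_)
        · refine Eventually.of_forall fun D' => ?_
          exact sub_nonneg.2 (sq_integral_le (P := P) (hf.comp (hc1 D')) (fun y => hfB _))
        · exact integrable_of_measurable_of_bound (hint _ (hfg.pow_const 2))
            fun D' => abs_integral_le_of_bound fun y => hsq _ _ (hd 0 _)
        · have e : ∀ y y' : Ω, g 0 (Fin.cons y D') = g 0 (Fin.cons y' D') := fun y y' => by
            rw [← hgs 0 (Fin.cons y D') y', Fin.update_cons_zero]
          have : Nonempty Ω := nonempty_of_isProbabilityMeasure P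
          set γ := g 0 (Fin.cons (Classical.arbitrary Ω) D') with hγ
          have h1 := integral_sub_const_sq (P := P) (hf.comp (hc1 D')) (fun y => hfB _) γ
          have h2 : ∫ y, (f (Fin.cons y D') - g 0 (Fin.cons y D')) ^ 2 ∂P =
              ∫ y, ((f ∘ fun y => Fin.cons y D') y - γ) ^ 2 ∂P := by
            refine integral_congr_ae (Eventually.of_forall fun y => ?_)
            simp only [Function.comp]
            rw [e y (Classical.arbitrary Ω)]
          simp only
          rw [h2, h1]
          simp only [Function.comp, hh]
          nlinarith [sq_nonneg (γ - ∫ y, f (Fin.cons y D') ∂P)]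
      · exact integrable_of_measurable_of_bound (hint _ (hf.pow_const 2))
            fun D' => abs_integral_le_of_bound fun y => hsq _ _ (hfB _)
      · exact integrable_of_measurable_of_bound ((hint _ hf).pow_const 2)
            fun D' => hsq _ _ (hhB D')
    have rest_le : ∀ s : Fin n, ∫ D', (h D' - ∫ y, g (Fin.succ s) (Fin.cons y D') ∂P) ^ 2 ∂ν ≤
        ∫ D, (f D - g s.succ D) ^ 2 ∂(Measure.pi fun _ : Fin (n + 1) => P) := by
      intro s
      have hfg : Measurable fun D => f D - g s.succ D := hf.sub (hg s.succ)
      rw [key _ (hfg.pow_const 2) ((2 * B) ^ 2) fun D => hsq _ _ (hd _ D)]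
      refine integral_mono_of_nonneg (Eventually.of_forall fun D' => sq_nonneg _) ?_
        (Eventually.of_forall fun D' => ?_)
      · exact integrable_of_measurable_of_bound (hint _ (hfg.pow_const 2))
            fun D' => abs_integral_le_of_bound fun y => hsq _ _ (hd _ _)
      · -- Jensen's inequality, as nonnegativity of the variance
        have i1 : Integrable (fun y => f (Fin.cons y D')) P :=
          integrable_of_measurable_of_bound (hf.comp (hc1 D')) fun y => hfB _
        have i2 : Integrable (fun y => g s.succ (Fin.cons y D')) P :=
          integrable_of_measurable_of_bound ((hg _).comp (hc1 D')) fun y => hgB _ _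
        have e : h D' - ∫ y, g (Fin.succ s) (Fin.cons y D') ∂P =
            ∫ y, (f (Fin.cons y D') - g s.succ (Fin.cons y D')) ∂P := by
          rw [integral_sub i1 i2]
        simp only
        rw [e]
        exact sq_integral_le (P := P) (hfg.comp (hc1 D')) (fun y => hd _ _)
    have := Finset.sum_le_sum fun s (_ : s ∈ Finset.univ) => rest_le s
    change _ - (∫ D', h D' ∂ν) ^ 2 ≤ _
    linarith

end ProductMeasure

/-! ### Second moments of sums of products of kernels -/

section VStatistics

theorem DependsOn.mul_kernel {Ω : Type*} {n : ℕ} {κ : Ω → Ω → ℝ≥0∞} {G : (Fin n → Ω) → ℝ≥0∞}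
    {F : Finset (Fin n)}
    (hGF : DependsOn G (F : Set (Fin n))) {i : Fin n} (hi : i ∈ F) (j : Fin n) :
    DependsOn (fun D => G D * κ (D i) (D j)) ((insert j F : Finset (Fin n)) : Set (Fin n)) := by
  intro D D' h
  simp only
  rw [hGF fun t ht => h t (by simp [Finset.mem_coe.1 ht]), h i (by simp [hi]), h j (by simp)]

variable {Ω : Type*} [MeasurableSpace Ω] {P : Measure Ω} [IsProbabilityMeasure P] {n : ℕ}

/-- The Efron–Stein inequality for the extended variance. -/
theorem evariance_le_sum_lintegral {f : (Fin n → Ω) → ℝ} {g : Fin n → (Fin n → Ω) → ℝ}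
    (hf : Measurable f) (hg : ∀ s, Measurable (g s)) {B : ℝ} (hfB : ∀ D, |f D| ≤ B)
    (hgB : ∀ s D, |g s D| ≤ B) (hgs : ∀ s D y, g s (Function.update D s y) = g s D) :
    ProbabilityTheory.evariance f (Measure.pi fun _ : Fin n => P) ≤
      ∑ s, ∫⁻ D, ‖f D - g s D‖ₑ ^ 2 ∂(Measure.pi fun _ : Fin n => P) := by
  have hL : MemLp f 2 (Measure.pi fun _ : Fin n => P) :=
    MemLp.of_bound hf.aestronglyMeasurable B (Eventually.of_forall hfB)
  rw [← hL.ofReal_variance_eq, ProbabilityTheory.variance_eq_sub hL]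
  refine (ENNReal.ofReal_le_ofReal (efronStein hf hg hfB hgB hgs)).trans ?_
  rw [ENNReal.ofReal_sum_of_nonneg fun s _ => integral_nonneg fun D => sq_nonneg _]
  refine Finset.sum_le_sum fun s _ => ?_
  rw [ofReal_integral_eq_lintegral_ofReal]
  · refine lintegral_mono fun D => le_of_eq ?_
    rw [← Real.enorm_of_nonneg (sq_nonneg _), enorm_pow]
  · refine integrable_of_measurable_of_bound ((hf.sub (hg s)).pow_const 2) (B := (B + B) ^ 2)
      fun D => ?_
    rw [abs_pow]
    exact pow_le_pow_left₀ (abs_nonneg _)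
      ((abs_sub _ _).trans (add_le_add (hfB D) (hgB s D))) 2
  · exact Eventually.of_forall fun D => sq_nonneg _

/-- Summing a kernel `κ` over its second argument costs the factor `card F * c + n * q`, where `F`
is a set of coordinates that determines everything else: a summand with `j ∈ F` is bounded by
`κ ≤ c`, a summand with `j ∉ F` by integrating out the `j`-th observation. -/
theorem sum_lintegral_mul_kernel_le {κ : Ω → Ω → ℝ≥0∞} (hκ : Measurable (Function.uncurry κ))
    {c q : ℝ≥0∞} (hc : ∀ x y, κ x y ≤ c) (hq : ∀ x, ∫⁻ y, κ x y ∂P ≤ q)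
    {G : (Fin n → Ω) → ℝ≥0∞} (hG : Measurable G) {F : Finset (Fin n)}
    (hGF : DependsOn G (F : Set (Fin n))) {i : Fin n} (hi : i ∈ F) :
    ∑ j, ∫⁻ D, G D * κ (D i) (D j) ∂(Measure.pi fun _ : Fin n => P) ≤
      (F.card * c + n * q) * ∫⁻ D, G D ∂(Measure.pi fun _ : Fin n => P) := by
  have hm : ∀ j, Measurable fun D : Fin n → Ω => G D * κ (D i) (D j) := fun j =>
    hG.mul (hκ.comp (f := fun D : Fin n → Ω => (D i, D j))
      ((measurable_pi_apply i).prodMk (measurable_pi_apply j)))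
  have key : ∀ j, ∫⁻ D, G D * κ (D i) (D j) ∂(Measure.pi fun _ : Fin n => P) ≤
      ((if j ∈ F then c else 0) + q) * ∫⁻ D, G D ∂(Measure.pi fun _ : Fin n => P) := by
    intro j
    by_cases hj : j ∈ F
    · rw [if_pos hj, add_mul]
      refine le_add_right ?_
      rw [← lintegral_const_mul _ hG]
      exact lintegral_mono fun D => by simp only; rw [mul_comm]; gcongr; exact hc _ _
    · rw [if_neg hj, zero_add, lintegral_pi_update j (hm j), ← lintegral_const_mul _ hG]
      refine lintegral_mono fun D => ?_
      have hij : i ≠ j := fun h => hj (h ▸ hi)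
      have e : ∀ y, G (Function.update D j y) = G D := fun y => hGF fun t ht =>
        Function.update_of_ne (fun h => hj (by rw [← h]; exact ht)) _ _
      simp only [Function.update_self, Function.update_of_ne hij, e]
      have hκi : Measurable fun y => κ (D i) y := hκ.comp measurable_prodMk_left
      rw [lintegral_const_mul _ hκi, mul_comm]
      gcongr
      exact hq _
  refine (Finset.sum_le_sum fun j _ => key j).trans ?_
  rw [← Finset.sum_mul, Finset.sum_add_distrib]
  gcongr
  · simp [Finset.sum_ite_mem]
  · simp

theorem measurable_kernel_eval {β : Type*} [MeasurableSpace β] {κ : Ω → Ω → β}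
    (hκ : Measurable (Function.uncurry κ)) (i j : Fin n) :
    Measurable fun D : Fin n → Ω => κ (D i) (D j) :=
  hκ.comp (f := fun D : Fin n → Ω => (D i, D j))
    ((measurable_pi_apply i).prodMk (measurable_pi_apply j))

/-- Second moment of the kernel sum over paths of length one from the observation `s`. -/
theorem lintegral_sum_kernel_sq_le {κ : Ω → Ω → ℝ≥0∞} (hκ : Measurable (Function.uncurry κ))
    {c q : ℝ≥0∞} (hc : ∀ x y, κ x y ≤ c) (hq : ∀ x, ∫⁻ y, κ x y ∂P ≤ q) (s : Fin n) :
    ∫⁻ D, (∑ j, κ (D s) (D j)) ^ 2 ∂(Measure.pi fun _ : Fin n => P) ≤ (4 * c + n * q) ^ 2 := by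
  have m : ∀ i j : Fin n, Measurable fun D : Fin n → Ω => κ (D i) (D j) :=
    measurable_kernel_eval hκ
  have mm : ∀ i j k l : Fin n, Measurable fun D : Fin n → Ω => κ (D i) (D j) * κ (D k) (D l) :=
    fun i j k l => (m i j).mul (m k l)
  have e : ∀ D : Fin n → Ω, (∑ j, κ (D s) (D j)) ^ 2 =
      ∑ j, ∑ j', κ (D s) (D j) * κ (D s) (D j') := fun D => by
    rw [sq, Finset.sum_mul_sum]
  simp_rw [e]
  rw [lintegral_finsetSum _ fun j _ => Finset.measurable_sum _ fun j' _ => mm s j s j']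
  have h1 : ∀ j, ∫⁻ D, ∑ j', κ (D s) (D j) * κ (D s) (D j') ∂(Measure.pi fun _ : Fin n => P) ≤
      (4 * c + n * q) * ∫⁻ D, 1 * κ (D s) (D j) ∂(Measure.pi fun _ : Fin n => P) := by
    intro j
    rw [lintegral_finsetSum _ fun j' _ => mm s j s j']
    have h0 : DependsOn (fun _ : Fin n → Ω => (1 : ℝ≥0∞)) (({s} : Finset (Fin n)) : Set (Fin n)) :=
      fun _ _ _ => rfl
    have hd := DependsOn.mul_kernel (κ := κ) h0 (Finset.mem_singleton_self s) j
    simp only [one_mul] at hd ⊢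
    refine (sum_lintegral_mul_kernel_le hκ hc hq (m s j) hd (i := s) (by simp)).trans ?_
    gcongr
    exact_mod_cast Finset.card_le_two.trans (by norm_num)
  refine (Finset.sum_le_sum fun j _ => h1 j).trans ?_
  rw [← Finset.mul_sum, sq]
  gcongr
  have := sum_lintegral_mul_kernel_le hκ hc hq (G := fun _ => 1) (F := {s}) measurable_const
    (fun _ _ _ => rfl) (Finset.mem_singleton_self s)
  refine this.trans ?_
  simp only [lintegral_const, measure_univ, mul_one, Finset.card_singleton]
  gcongr
  norm_num

/-- Second moment of the kernel sum over paths `s → j, τ j → l`. With `τ j = s` both factors start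
at the observation `s`, with `τ j = j` the path continues from `j`. -/
theorem lintegral_sum_sum_kernel_sq_le {κ₁ κ₂ : Ω → Ω → ℝ≥0∞}
    (hκ₁ : Measurable (Function.uncurry κ₁)) (hκ₂ : Measurable (Function.uncurry κ₂))
    {c₁ c₂ q : ℝ≥0∞} (hc₁ : ∀ x y, κ₁ x y ≤ c₁) (hc₂ : ∀ x y, κ₂ x y ≤ c₂)
    (hq₁ : ∀ x, ∫⁻ y, κ₁ x y ∂P ≤ q) (hq₂ : ∀ x, ∫⁻ y, κ₂ x y ∂P ≤ q) (s : Fin n)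
    {τ : Fin n → Fin n} (hτ : ∀ j, τ j = s ∨ τ j = j) :
    ∫⁻ D, (∑ j, ∑ l, κ₁ (D s) (D j) * κ₂ (D (τ j)) (D l)) ^ 2
      ∂(Measure.pi fun _ : Fin n => P) ≤ ((4 * c₁ + n * q) * (4 * c₂ + n * q)) ^ 2 := by
  have m₁ := fun i j : Fin n => measurable_kernel_eval hκ₁ i j
  have m₂ := fun i j : Fin n => measurable_kernel_eval hκ₂ i j
  set G₁ : Fin n → (Fin n → Ω) → ℝ≥0∞ := fun j D => 1 * κ₁ (D s) (D j) with hG₁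
  set G₂ : Fin n → Fin n → (Fin n → Ω) → ℝ≥0∞ := fun j l D => G₁ j D * κ₂ (D (τ j)) (D l) with hG₂
  set G₃ : Fin n → Fin n → Fin n → (Fin n → Ω) → ℝ≥0∞ :=
    fun j l j' D => G₂ j l D * κ₁ (D s) (D j') with hG₃
  set G₄ : Fin n → Fin n → Fin n → Fin n → (Fin n → Ω) → ℝ≥0∞ :=
    fun j l j' l' D => G₃ j l j' D * κ₂ (D (τ j')) (D l') with hG₄
  have M₁ : ∀ j, Measurable (G₁ j) := fun j => measurable_const.mul (m₁ _ _)
  have M₂ : ∀ j l, Measurable (G₂ j l) := fun j l => (M₁ j).mul (m₂ _ _)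
  have M₃ : ∀ j l j', Measurable (G₃ j l j') := fun j l j' => (M₂ j l).mul (m₁ _ _)
  have M₄ : ∀ j l j' l', Measurable (G₄ j l j' l') := fun j l j' l' => (M₃ j l j').mul (m₂ _ _)
  have hτm : ∀ j (F : Finset (Fin n)), s ∈ F → τ j ∈ insert j F := fun j F hs => by
    rcases hτ j with h | h <;> simp [h, hs]
  have d₁ : ∀ j, DependsOn (G₁ j) ((insert j {s} : Finset (Fin n)) : Set (Fin n)) := fun j =>
    DependsOn.mul_kernel (G := fun _ => 1) (fun _ _ _ => rfl) (Finset.mem_singleton_self s) j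
  have d₂ : ∀ j l, DependsOn (G₂ j l) ((insert l (insert j {s}) : Finset (Fin n)) : Set (Fin n)) :=
    fun j l => DependsOn.mul_kernel (d₁ j) (hτm j _ (by simp)) l
  have d₃ : ∀ j l j', DependsOn (G₃ j l j')
      ((insert j' (insert l (insert j {s})) : Finset (Fin n)) : Set (Fin n)) :=
    fun j l j' => DependsOn.mul_kernel (d₂ j l) (by simp) j'
  have e : ∀ D : Fin n → Ω, (∑ j, ∑ l, κ₁ (D s) (D j) * κ₂ (D (τ j)) (D l)) ^ 2 =
      ∑ j, ∑ l, ∑ j', ∑ l', G₄ j l j' l' D := fun D => by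
    rw [sq, Finset.sum_mul]
    refine Finset.sum_congr rfl fun j _ => ?_
    rw [Finset.sum_mul]
    refine Finset.sum_congr rfl fun l _ => ?_
    rw [Finset.mul_sum]
    refine Finset.sum_congr rfl fun j' _ => ?_
    rw [Finset.mul_sum]
    refine Finset.sum_congr rfl fun l' _ => ?_
    simp only [hG₄, hG₃, hG₂, hG₁, one_mul]
    ring
  simp_rw [e]
  set Q := Measure.pi fun _ : Fin n => P
  have s₄ : ∀ j l j', ∑ l', ∫⁻ D, G₄ j l j' l' D ∂Q ≤ (4 * c₂ + n * q) * ∫⁻ D, G₃ j l j' D ∂Q := by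
    intro j l j'
    refine (sum_lintegral_mul_kernel_le hκ₂ hc₂ hq₂ (M₃ j l j') (d₃ j l j') ?_).trans ?_
    · exact hτm j' _ (by simp)
    · gcongr
      exact_mod_cast Finset.card_le_four
  have s₃ : ∀ j l, ∑ j', ∫⁻ D, G₃ j l j' D ∂Q ≤ (4 * c₁ + n * q) * ∫⁻ D, G₂ j l D ∂Q := by
    intro j l
    refine (sum_lintegral_mul_kernel_le hκ₁ hc₁ hq₁ (M₂ j l) (d₂ j l) (by simp)).trans ?_
    gcongr
    exact_mod_cast Finset.card_le_three.trans (by norm_num)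
  have s₂ : ∀ j, ∑ l, ∫⁻ D, G₂ j l D ∂Q ≤ (4 * c₂ + n * q) * ∫⁻ D, G₁ j D ∂Q := by
    intro j
    refine (sum_lintegral_mul_kernel_le hκ₂ hc₂ hq₂ (M₁ j) (d₁ j) (hτm j _ (by simp))).trans ?_
    gcongr
    exact_mod_cast Finset.card_le_two.trans (by norm_num)
  have s₁ : ∑ j, ∫⁻ D, G₁ j D ∂Q ≤ 4 * c₁ + n * q := by
    refine (sum_lintegral_mul_kernel_le hκ₁ hc₁ hq₁ (G := fun _ => 1) (F := {s}) measurable_const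
      (fun _ _ _ => rfl) (Finset.mem_singleton_self s)).trans ?_
    simp only [lintegral_const, measure_univ, mul_one, Finset.card_singleton]
    gcongr
    norm_num
  calc ∫⁻ D, ∑ j, ∑ l, ∑ j', ∑ l', G₄ j l j' l' D ∂Q
      = ∑ j, ∑ l, ∑ j', ∑ l', ∫⁻ D, G₄ j l j' l' D ∂Q := by
        rw [lintegral_finsetSum _ fun j _ => Finset.measurable_sum _ fun l _ =>
          Finset.measurable_sum _ fun j' _ => Finset.measurable_sum _ fun l' _ => M₄ j l j' l']
        refine Finset.sum_congr rfl fun j _ => ?_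
        rw [lintegral_finsetSum _ fun l _ =>
          Finset.measurable_sum _ fun j' _ => Finset.measurable_sum _ fun l' _ => M₄ j l j' l']
        refine Finset.sum_congr rfl fun l _ => ?_
        rw [lintegral_finsetSum _ fun j' _ => Finset.measurable_sum _ fun l' _ => M₄ j l j' l']
        refine Finset.sum_congr rfl fun j' _ => ?_
        rw [lintegral_finsetSum _ fun l' _ => M₄ j l j' l']
    _ ≤ ∑ j, ∑ l, ∑ j', (4 * c₂ + n * q) * ∫⁻ D, G₃ j l j' D ∂Q := by
        gcongr with j _ l _ j' _; exact s₄ j l j'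
    _ ≤ ∑ j, ∑ l, (4 * c₂ + n * q) * ((4 * c₁ + n * q) * ∫⁻ D, G₂ j l D ∂Q) := by
        gcongr with j _ l _; rw [← Finset.mul_sum]; gcongr; exact s₃ j l
    _ ≤ ∑ j, (4 * c₂ + n * q) * ((4 * c₁ + n * q) * ((4 * c₂ + n * q) * ∫⁻ D, G₁ j D ∂Q)) := by
        gcongr with j _; rw [← Finset.mul_sum, ← Finset.mul_sum]; gcongr; exact s₂ j
    _ ≤ (4 * c₂ + n * q) * ((4 * c₁ + n * q) * ((4 * c₂ + n * q) * (4 * c₁ + n * q))) := by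
        rw [← Finset.mul_sum, ← Finset.mul_sum, ← Finset.mul_sum]; gcongr
    _ = _ := by ring

end VStatistics

/-! ### Variance and expectation of V-statistics -/

section VStatistics

variable {Ω : Type*}

/-- The empirical mean of the product `a b`. -/
noncomputable def vStat₁ {n : ℕ} (a b : Ω → ℝ) (D : Fin n → Ω) : ℝ :=
  1 / (n : ℝ) * ∑ i, a (D i) * b (D i)

/-- The V-statistic of order two with kernel `a(x) b(y) K(x, y)`. -/
noncomputable def vStat₂ {n : ℕ} (a b : Ω → ℝ) (K : Ω → Ω → ℝ) (D : Fin n → Ω) : ℝ :=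
  1 / (n : ℝ) ^ 2 * ∑ i, ∑ j, a (D i) * b (D j) * K (D i) (D j)

/-- The V-statistic of order three with kernel `a(y) K₁(y, x) b(z) K₂(z, x)`. -/
noncomputable def vStat₃ {n : ℕ} (a b : Ω → ℝ) (K₁ K₂ : Ω → Ω → ℝ) (D : Fin n → Ω) : ℝ :=
  1 / (n : ℝ) ^ 3 *
    ∑ i, ∑ j, ∑ l, a (D j) * K₁ (D j) (D i) * (b (D l) * K₂ (D l) (D i))

theorem ENNReal.sq_add_add_le (x y z : ℝ≥0∞) :
    (x + y + z) ^ 2 ≤ 3 * (x ^ 2 + y ^ 2 + z ^ 2) := by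
  rcases eq_or_ne x ⊤ with rfl | hx
  · simp
  rcases eq_or_ne y ⊤ with rfl | hy
  · simp
  rcases eq_or_ne z ⊤ with rfl | hz
  · simp
  lift x to ℝ≥0 using hx
  lift y to ℝ≥0 using hy
  lift z to ℝ≥0 using hz
  norm_cast
  rw [← NNReal.coe_le_coe]
  push_cast
  nlinarith [sq_nonneg ((x : ℝ) - y), sq_nonneg ((x : ℝ) - z), sq_nonneg ((y : ℝ) - z)]

variable [MeasurableSpace Ω] {P : Measure Ω} [IsProbabilityMeasure P] {n : ℕ}

theorem measurable_vStat₁ {a b : Ω → ℝ} (ha : Measurable a) (hb : Measurable b) :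
    Measurable (vStat₁ (n := n) a b) :=
  measurable_const.mul (Finset.measurable_sum _ fun i _ =>
    (ha.comp (measurable_pi_apply i)).mul (hb.comp (measurable_pi_apply i)))

theorem measurable_vStat₂ {a b : Ω → ℝ} {K : Ω → Ω → ℝ} (ha : Measurable a) (hb : Measurable b)
    (hK : Measurable (Function.uncurry K)) : Measurable (vStat₂ (n := n) a b K) :=
  measurable_const.mul (Finset.measurable_sum _ fun i _ => Finset.measurable_sum _ fun j _ =>
    ((ha.comp (measurable_pi_apply i)).mul (hb.comp (measurable_pi_apply j))).mul
      (measurable_kernel_eval hK i j))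

theorem measurable_vStat₃_summand {a b : Ω → ℝ} {K₁ K₂ : Ω → Ω → ℝ} (ha : Measurable a)
    (hb : Measurable b) (hK₁ : Measurable (Function.uncurry K₁))
    (hK₂ : Measurable (Function.uncurry K₂)) (i j l : Fin n) :
    Measurable fun D : Fin n → Ω =>
      a (D j) * K₁ (D j) (D i) * (b (D l) * K₂ (D l) (D i)) :=
  ((ha.comp (measurable_pi_apply j)).mul (measurable_kernel_eval hK₁ j i)).mul
    ((hb.comp (measurable_pi_apply l)).mul (measurable_kernel_eval hK₂ l i))

theorem measurable_vStat₃ {a b : Ω → ℝ} {K₁ K₂ : Ω → Ω → ℝ} (ha : Measurable a)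
    (hb : Measurable b) (hK₁ : Measurable (Function.uncurry K₁))
    (hK₂ : Measurable (Function.uncurry K₂)) : Measurable (vStat₃ (n := n) a b K₁ K₂) :=
  measurable_const.mul (Finset.measurable_sum _ fun i _ => Finset.measurable_sum _ fun j _ =>
    Finset.measurable_sum _ fun l _ => measurable_vStat₃_summand ha hb hK₁ hK₂ i j l)

/-- Efron–Stein with the sums over the indices different from `s` as comparison functions. -/
theorem evariance_vStat₁_le {a b : Ω → ℝ} (ha : Measurable a) (hb : Measurable b) {B : ℝ}
    (haB : ∀ x, |a x| ≤ B) (hbB : ∀ x, |b x| ≤ B) :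
    ProbabilityTheory.evariance (vStat₁ (n := n) a b) (Measure.pi fun _ : Fin n => P) ≤
      ENNReal.ofReal (n * (B ^ 2 / n) ^ 2) := by
  have hab : ∀ x, |a x * b x| ≤ B ^ 2 := fun x => by
    rw [abs_mul, sq]; exact mul_le_mul (haB x) (hbB x) (abs_nonneg _) ((abs_nonneg _).trans (haB x))
  have hm : ∀ i : Fin n, Measurable fun D : Fin n → Ω => a (D i) * b (D i) := fun i =>
    (ha.comp (measurable_pi_apply i)).mul (hb.comp (measurable_pi_apply i))
  set g : Fin n → (Fin n → Ω) → ℝ := fun s D =>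
    1 / (n : ℝ) * ∑ i, if i = s then 0 else a (D i) * b (D i) with hg
  have hn : (0 : ℝ) ≤ 1 / n := by positivity
  have h := evariance_le_sum_lintegral (P := P) (measurable_vStat₁ (n := n) ha hb) (g := g)
    (fun s => measurable_const.mul (Finset.measurable_sum _ fun i _ => by
      split_ifs
      · exact measurable_const
      · exact hm i)) (B := 1 / n * ∑ _ : Fin n, B ^ 2)
    (fun D => by
      rw [vStat₁, abs_mul, abs_of_nonneg hn]
      exact mul_le_mul_of_nonneg_left ((Finset.abs_sum_le_sum_abs _ _).trans
        (Finset.sum_le_sum fun i _ => hab _)) hn)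
    (fun s D => by
      rw [hg, abs_mul, abs_of_nonneg hn]
      refine mul_le_mul_of_nonneg_left ((Finset.abs_sum_le_sum_abs _ _).trans
        (Finset.sum_le_sum fun i _ => ?_)) hn
      split_ifs
      · simpa using sq_nonneg B
      · exact hab _)
    (fun s D y => by
      simp only [hg]
      congr 1
      refine Finset.sum_congr rfl fun i _ => ?_
      split_ifs with h
      · rfl
      · rw [Function.update_of_ne h])
  refine h.trans ?_
  have key : ∀ s, ∫⁻ D, ‖vStat₁ a b D - g s D‖ₑ ^ 2 ∂(Measure.pi fun _ : Fin n => P) ≤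
      ENNReal.ofReal ((B ^ 2 / n) ^ 2) := by
    intro s
    refine (lintegral_mono (g := fun _ => ENNReal.ofReal ((B ^ 2 / n) ^ 2)) fun D => ?_).trans
      (by simp)
    have e : vStat₁ a b D - g s D = 1 / n * (a (D s) * b (D s)) := by
      rw [vStat₁, hg, ← mul_sub, ← Finset.sum_sub_distrib]
      congr 1
      rw [Finset.sum_eq_single s]
      · simp
      · intro i _ hi; simp [hi]
      · simp
    rw [← enorm_pow, Real.enorm_eq_ofReal_abs, abs_pow]
    refine ENNReal.ofReal_le_ofReal (pow_le_pow_left₀ (abs_nonneg _) ?_ 2)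
    rw [e, abs_mul, abs_of_nonneg hn, div_eq_mul_one_div (B ^ 2), mul_comm (B ^ 2)]
    exact mul_le_mul_of_nonneg_left (hab _) hn
  refine (Finset.sum_le_sum fun s _ => key s).trans (le_of_eq ?_)
  rw [Finset.sum_const, Finset.card_univ, Fintype.card_fin, nsmul_eq_mul,
    ENNReal.ofReal_mul (p := (n : ℝ)) (by positivity), ENNReal.ofReal_natCast]

/-- Only the pairs that contain `s` depend on the observation `s`; by symmetry of `K` they are
bounded by twice the kernel sum over paths of length one from `s`. -/
theorem evariance_vStat₂_le {a b : Ω → ℝ} {K : Ω → Ω → ℝ} (ha : Measurable a) (hb : Measurable b)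
    (hK : Measurable (Function.uncurry K)) (hsymm : ∀ x y, K x y = K y x) {B c q : ℝ}
    (haB : ∀ x, |a x| ≤ B) (hbB : ∀ x, |b x| ≤ B) (hB : 0 ≤ B) (hc0 : 0 ≤ c) (hq0 : 0 ≤ q)
    (hc : ∀ x y, |K x y| ≤ c) (hq : ∀ x, ∫⁻ y, ‖K x y‖ₑ ∂P ≤ ENNReal.ofReal q) :
    ProbabilityTheory.evariance (vStat₂ (n := n) a b K) (Measure.pi fun _ : Fin n => P) ≤
      ENNReal.ofReal (n * ((2 * (B ^ 2 / n ^ 2)) * (4 * c + n * q)) ^ 2) := by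
  have hab : ∀ x y, |a x * b y| ≤ B ^ 2 := fun x y => by
    rw [abs_mul, sq]; exact mul_le_mul (haB x) (hbB y) (abs_nonneg _) hB
  have habK : ∀ x y, |a x * b y * K x y| ≤ B ^ 2 * c := fun x y => by
    rw [abs_mul]; exact mul_le_mul (hab x y) (hc x y) (abs_nonneg _) (sq_nonneg B)
  have hm : ∀ i j : Fin n, Measurable fun D : Fin n → Ω => a (D i) * b (D j) * K (D i) (D j) :=
    fun i j => ((ha.comp (measurable_pi_apply i)).mul (hb.comp (measurable_pi_apply j))).mul
      (measurable_kernel_eval hK i j)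
  set g : Fin n → (Fin n → Ω) → ℝ := fun s D => 1 / (n : ℝ) ^ 2 *
    ∑ i, ∑ j, if i = s ∨ j = s then 0 else a (D i) * b (D j) * K (D i) (D j) with hg
  have hn : (0 : ℝ) ≤ 1 / (n : ℝ) ^ 2 := by positivity
  have h := evariance_le_sum_lintegral (P := P) (measurable_vStat₂ (n := n) ha hb hK) (g := g)
    (fun s => measurable_const.mul (Finset.measurable_sum _ fun i _ =>
      Finset.measurable_sum _ fun j _ => by
        split_ifs
        · exact measurable_const
        · exact hm i j)) (B := 1 / (n : ℝ) ^ 2 * ∑ _ : Fin n, ∑ _ : Fin n, B ^ 2 * c)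
    (fun D => by
      rw [vStat₂, abs_mul, abs_of_nonneg hn]
      refine mul_le_mul_of_nonneg_left ((Finset.abs_sum_le_sum_abs _ _).trans
        (Finset.sum_le_sum fun i _ => (Finset.abs_sum_le_sum_abs _ _).trans
        (Finset.sum_le_sum fun j _ => habK _ _))) hn)
    (fun s D => by
      rw [hg, abs_mul, abs_of_nonneg hn]
      refine mul_le_mul_of_nonneg_left ((Finset.abs_sum_le_sum_abs _ _).trans
        (Finset.sum_le_sum fun i _ => (Finset.abs_sum_le_sum_abs _ _).trans
        (Finset.sum_le_sum fun j _ => ?_))) hn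
      split_ifs
      · simpa using mul_nonneg (sq_nonneg B) hc0
      · exact habK _ _)
    (fun s D y => by
      simp only [hg]
      congr 1
      refine Finset.sum_congr rfl fun i _ => Finset.sum_congr rfl fun j _ => ?_
      split_ifs with h
      · rfl
      · push Not at h
        rw [Function.update_of_ne h.1, Function.update_of_ne h.2])
  refine h.trans ?_
  set κ : Ω → Ω → ℝ≥0∞ := fun x y => ‖K x y‖ₑ with hκ
  have hκm : Measurable (Function.uncurry κ) := hK.enorm
  have hκc : ∀ x y, κ x y ≤ ENNReal.ofReal c := fun x y => by
    rw [hκ]; simp only; rw [Real.enorm_eq_ofReal_abs]; exact ENNReal.ofReal_le_ofReal (hc x y)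
  have key : ∀ s, ∫⁻ D, ‖vStat₂ a b K D - g s D‖ₑ ^ 2 ∂(Measure.pi fun _ : Fin n => P) ≤
      ENNReal.ofReal (((2 * (B ^ 2 / n ^ 2)) * (4 * c + n * q)) ^ 2) := by
    intro s
    have pt : ∀ D : Fin n → Ω, ‖vStat₂ a b K D - g s D‖ₑ ≤
        ENNReal.ofReal (2 * (B ^ 2 / n ^ 2)) * ∑ j, κ (D s) (D j) := by
      intro D
      have e : vStat₂ a b K D - g s D = 1 / (n : ℝ) ^ 2 * ∑ i, ∑ j,
          if i = s ∨ j = s then a (D i) * b (D j) * K (D i) (D j) else 0 := by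
        rw [vStat₂, hg, ← mul_sub, ← Finset.sum_sub_distrib]
        congr 1
        refine Finset.sum_congr rfl fun i _ => ?_
        rw [← Finset.sum_sub_distrib]
        refine Finset.sum_congr rfl fun j _ => ?_
        split_ifs <;> simp
      have hreal : |vStat₂ a b K D - g s D| ≤ 2 * (B ^ 2 / n ^ 2) * ∑ j, |K (D s) (D j)| := by
        rw [e, abs_mul, abs_of_nonneg hn]
        have : |∑ i, ∑ j, if i = s ∨ j = s then a (D i) * b (D j) * K (D i) (D j) else 0| ≤
            ∑ i, ∑ j, ((if i = s then B ^ 2 * |K (D i) (D j)| else 0) +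
              if j = s then B ^ 2 * |K (D i) (D j)| else 0) := by
          refine (Finset.abs_sum_le_sum_abs _ _).trans
            (Finset.sum_le_sum fun i _ => (Finset.abs_sum_le_sum_abs _ _).trans
            (Finset.sum_le_sum fun j _ => ?_))
          have h0 : 0 ≤ B ^ 2 * |K (D i) (D j)| := by positivity
          have h1 : |a (D i) * b (D j) * K (D i) (D j)| ≤ B ^ 2 * |K (D i) (D j)| := by
            rw [abs_mul]; exact mul_le_mul_of_nonneg_right (hab _ _) (abs_nonneg _)
          by_cases hi : i = s <;> by_cases hj : j = s <;> simp only [hi, hj, if_true, if_false,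
            or_true, true_or, or_self, abs_zero, add_zero, zero_add, le_refl] <;>
            simp only [hi, hj] at h0 h1 <;> linarith
        have e2 : ∑ i, ∑ j, ((if i = s then B ^ 2 * |K (D i) (D j)| else 0) +
              if j = s then B ^ 2 * |K (D i) (D j)| else 0) =
            2 * (B ^ 2 * ∑ j, |K (D s) (D j)|) := by
          simp_rw [Finset.sum_add_distrib]
          rw [Finset.sum_comm]
          simp only [Finset.sum_ite_eq', Finset.mem_univ, if_true]
          simp_rw [fun i => hsymm (D i) (D s)]
          rw [← Finset.mul_sum]; ring
        calc _ ≤ 1 / (n : ℝ) ^ 2 * (2 * (B ^ 2 * ∑ j, |K (D s) (D j)|)) :=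
              mul_le_mul_of_nonneg_left (this.trans e2.le) hn
          _ = _ := by ring
      rw [Real.enorm_eq_ofReal_abs]
      refine (ENNReal.ofReal_le_ofReal hreal).trans (le_of_eq ?_)
      rw [ENNReal.ofReal_mul (by positivity), ENNReal.ofReal_sum_of_nonneg fun _ _ => abs_nonneg _]
      simp only [hκ, Real.enorm_eq_ofReal_abs]
    calc ∫⁻ D, ‖vStat₂ a b K D - g s D‖ₑ ^ 2 ∂(Measure.pi fun _ : Fin n => P)
        ≤ ∫⁻ D, ENNReal.ofReal (2 * (B ^ 2 / n ^ 2)) ^ 2 * (∑ j, κ (D s) (D j)) ^ 2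
            ∂(Measure.pi fun _ : Fin n => P) :=
          lintegral_mono fun D => by rw [← mul_pow]; gcongr; exact pt D
      _ = ENNReal.ofReal (2 * (B ^ 2 / n ^ 2)) ^ 2 *
            ∫⁻ D, (∑ j, κ (D s) (D j)) ^ 2 ∂(Measure.pi fun _ : Fin n => P) :=
          lintegral_const_mul _ ((Finset.measurable_sum _ fun j _ =>
            measurable_kernel_eval hκm s j).pow_const 2)
      _ ≤ ENNReal.ofReal (2 * (B ^ 2 / n ^ 2)) ^ 2 *
            (4 * ENNReal.ofReal c + n * ENNReal.ofReal q) ^ 2 := by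
          gcongr; exact lintegral_sum_kernel_sq_le hκm hκc hq s
      _ = _ := by
          rw [← mul_pow, ENNReal.ofReal_pow (by positivity),
            ENNReal.ofReal_mul (p := 2 * (B ^ 2 / n ^ 2)) (by positivity),
            ENNReal.ofReal_add (by positivity) (by positivity), ENNReal.ofReal_mul (by positivity),
            ENNReal.ofReal_mul (p := (n : ℝ)) (by positivity), ENNReal.ofReal_natCast]
          simp
  refine (Finset.sum_le_sum fun s _ => key s).trans (le_of_eq ?_)
  rw [Finset.sum_const, Finset.card_univ, Fintype.card_fin, nsmul_eq_mul,
    ENNReal.ofReal_mul (p := (n : ℝ)) (by positivity), ENNReal.ofReal_natCast]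

/-- The triples that contain `s` are bounded by three kernel sums over paths of length two, in which
`s` is the middle or one of the two end points. -/
theorem evariance_vStat₃_le {a b : Ω → ℝ} {K₁ K₂ : Ω → Ω → ℝ} (ha : Measurable a)
    (hb : Measurable b) (hK₁ : Measurable (Function.uncurry K₁))
    (hK₂ : Measurable (Function.uncurry K₂)) (hs₁ : ∀ x y, K₁ x y = K₁ y x)
    (hs₂ : ∀ x y, K₂ x y = K₂ y x) {B c₁ c₂ q : ℝ}
    (haB : ∀ x, |a x| ≤ B) (hbB : ∀ x, |b x| ≤ B) (hB : 0 ≤ B) (hc₁0 : 0 ≤ c₁) (hc₂0 : 0 ≤ c₂)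
    (hq0 : 0 ≤ q) (hc₁ : ∀ x y, |K₁ x y| ≤ c₁) (hc₂ : ∀ x y, |K₂ x y| ≤ c₂)
    (hq₁ : ∀ x, ∫⁻ y, ‖K₁ x y‖ₑ ∂P ≤ ENNReal.ofReal q)
    (hq₂ : ∀ x, ∫⁻ y, ‖K₂ x y‖ₑ ∂P ≤ ENNReal.ofReal q) :
    ProbabilityTheory.evariance (vStat₃ (n := n) a b K₁ K₂) (Measure.pi fun _ : Fin n => P) ≤
      ENNReal.ofReal (n * (9 * ((B ^ 2 / n ^ 3) *
        ((4 * c₁ + n * q) * (4 * c₂ + n * q))) ^ 2)) := by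
  set Z : (Fin n → Ω) → Fin n → Fin n → Fin n → ℝ := fun D i j l =>
    a (D j) * K₁ (D j) (D i) * (b (D l) * K₂ (D l) (D i)) with hZ
  set k : (Fin n → Ω) → Fin n → Fin n → Fin n → ℝ := fun D i j l =>
    B ^ 2 * (|K₁ (D i) (D j)| * |K₂ (D i) (D l)|) with hk
  have hk0 : ∀ D i j l, 0 ≤ k D i j l := fun D i j l => by positivity
  have hZk : ∀ D i j l, |Z D i j l| ≤ k D i j l := fun D i j l => by
    simp only [hZ, hk, abs_mul]
    rw [hs₁ (D j), hs₂ (D l)]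
    calc |a (D j)| * |K₁ (D i) (D j)| * (|b (D l)| * |K₂ (D i) (D l)|)
        ≤ B * |K₁ (D i) (D j)| * (B * |K₂ (D i) (D l)|) := by
          gcongr
          · exact haB _
          · exact hbB _
      _ = _ := by ring
  have hkc : ∀ D i j l, k D i j l ≤ B ^ 2 * (c₁ * c₂) := fun D i j l => by
    simp only [hk]
    gcongr
    · exact hc₁ _ _
    · exact hc₂ _ _
  have hm : ∀ i j l : Fin n, Measurable fun D : Fin n → Ω => Z D i j l :=
    measurable_vStat₃_summand ha hb hK₁ hK₂
  set g : Fin n → (Fin n → Ω) → ℝ := fun s D => 1 / (n : ℝ) ^ 3 *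
    ∑ i, ∑ j, ∑ l, if i = s ∨ j = s ∨ l = s then 0 else Z D i j l with hg
  have hn : (0 : ℝ) ≤ 1 / (n : ℝ) ^ 3 := by positivity
  have h := evariance_le_sum_lintegral (P := P) (measurable_vStat₃ (n := n) ha hb hK₁ hK₂) (g := g)
    (fun s => measurable_const.mul (Finset.measurable_sum _ fun i _ =>
      Finset.measurable_sum _ fun j _ => Finset.measurable_sum _ fun l _ => by
        split_ifs
        · exact measurable_const
        · exact hm i j l))
    (B := 1 / (n : ℝ) ^ 3 * ∑ _ : Fin n, ∑ _ : Fin n, ∑ _ : Fin n, B ^ 2 * (c₁ * c₂))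
    (fun D => by
      rw [vStat₃, abs_mul, abs_of_nonneg hn]
      refine mul_le_mul_of_nonneg_left ((Finset.abs_sum_le_sum_abs _ _).trans
        (Finset.sum_le_sum fun i _ => (Finset.abs_sum_le_sum_abs _ _).trans
        (Finset.sum_le_sum fun j _ => (Finset.abs_sum_le_sum_abs _ _).trans
        (Finset.sum_le_sum fun l _ => (hZk D i j l).trans (hkc _ _ _ _))))) hn)
    (fun s D => by
      rw [hg, abs_mul, abs_of_nonneg hn]
      refine mul_le_mul_of_nonneg_left ((Finset.abs_sum_le_sum_abs _ _).trans
        (Finset.sum_le_sum fun i _ => (Finset.abs_sum_le_sum_abs _ _).trans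
        (Finset.sum_le_sum fun j _ => (Finset.abs_sum_le_sum_abs _ _).trans
        (Finset.sum_le_sum fun l _ => ?_)))) hn
      split_ifs
      · rw [abs_zero]; positivity
      · exact (hZk _ _ _ _).trans (hkc _ _ _ _))
    (fun s D y => by
      simp only [hg, hZ]
      congr 1
      refine Finset.sum_congr rfl fun i _ => Finset.sum_congr rfl fun j _ =>
        Finset.sum_congr rfl fun l _ => ?_
      split_ifs with h
      · rfl
      · push Not at h
        rw [Function.update_of_ne h.1, Function.update_of_ne h.2.1, Function.update_of_ne h.2.2])
  refine h.trans ?_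
  set κ₁ : Ω → Ω → ℝ≥0∞ := fun x y => ‖K₁ x y‖ₑ with hκ₁
  set κ₂ : Ω → Ω → ℝ≥0∞ := fun x y => ‖K₂ x y‖ₑ with hκ₂
  have hκ₁m : Measurable (Function.uncurry κ₁) := hK₁.enorm
  have hκ₂m : Measurable (Function.uncurry κ₂) := hK₂.enorm
  have hκ₁c : ∀ x y, κ₁ x y ≤ ENNReal.ofReal c₁ := fun x y => by
    simp only [hκ₁, Real.enorm_eq_ofReal_abs]; exact ENNReal.ofReal_le_ofReal (hc₁ x y)
  have hκ₂c : ∀ x y, κ₂ x y ≤ ENNReal.ofReal c₂ := fun x y => by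
    simp only [hκ₂, Real.enorm_eq_ofReal_abs]; exact ENNReal.ofReal_le_ofReal (hc₂ x y)
  set b₁ := 4 * ENNReal.ofReal c₁ + n * ENNReal.ofReal q with hb₁
  set b₂ := 4 * ENNReal.ofReal c₂ + n * ENNReal.ofReal q with hb₂
  have key : ∀ s, ∫⁻ D, ‖vStat₃ a b K₁ K₂ D - g s D‖ₑ ^ 2 ∂(Measure.pi fun _ : Fin n => P) ≤
      ENNReal.ofReal (9 * ((B ^ 2 / n ^ 3) * ((4 * c₁ + n * q) * (4 * c₂ + n * q))) ^ 2) := by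
    intro s
    -- the triples that contain `s`, sorted by the position of `s`
    set U : (Fin n → Ω) → ℝ≥0∞ := fun D => ∑ j, ∑ l, κ₁ (D s) (D j) * κ₂ (D s) (D l) with hU
    set V : (Fin n → Ω) → ℝ≥0∞ := fun D => ∑ i, ∑ l, κ₁ (D s) (D i) * κ₂ (D i) (D l) with hV
    set W : (Fin n → Ω) → ℝ≥0∞ := fun D => ∑ i, ∑ j, κ₂ (D s) (D i) * κ₁ (D i) (D j) with hW
    have pt : ∀ D : Fin n → Ω, ‖vStat₃ a b K₁ K₂ D - g s D‖ₑ ≤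
        ENNReal.ofReal (B ^ 2 / n ^ 3) * (U D + V D + W D) := by
      intro D
      have e : vStat₃ a b K₁ K₂ D - g s D = 1 / (n : ℝ) ^ 3 * ∑ i, ∑ j, ∑ l,
          if i = s ∨ j = s ∨ l = s then Z D i j l else 0 := by
        rw [vStat₃, hg, ← mul_sub, ← Finset.sum_sub_distrib]
        congr 1
        refine Finset.sum_congr rfl fun i _ => ?_
        rw [← Finset.sum_sub_distrib]
        refine Finset.sum_congr rfl fun j _ => ?_
        rw [← Finset.sum_sub_distrib]
        refine Finset.sum_congr rfl fun l _ => ?_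
        split_ifs <;> simp [hZ]
      have hreal : |vStat₃ a b K₁ K₂ D - g s D| ≤ 1 / (n : ℝ) ^ 3 *
          (∑ j, ∑ l, k D s j l + ∑ i, ∑ l, k D i s l + ∑ i, ∑ j, k D i j s) := by
        rw [e, abs_mul, abs_of_nonneg hn]
        refine mul_le_mul_of_nonneg_left ?_ hn
        have : |∑ i, ∑ j, ∑ l, if i = s ∨ j = s ∨ l = s then Z D i j l else 0| ≤
            ∑ i, ∑ j, ∑ l, ((if i = s then k D i j l else 0) + (if j = s then k D i j l else 0) +
              if l = s then k D i j l else 0) := by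
          refine (Finset.abs_sum_le_sum_abs _ _).trans
            (Finset.sum_le_sum fun i _ => (Finset.abs_sum_le_sum_abs _ _).trans
            (Finset.sum_le_sum fun j _ => (Finset.abs_sum_le_sum_abs _ _).trans
            (Finset.sum_le_sum fun l _ => ?_)))
          have h0 := hk0 D i j l
          have h1 := hZk D i j l
          have p1 : 0 ≤ if i = s then k D i j l else 0 := by split_ifs <;> simp [h0]
          have p2 : 0 ≤ if j = s then k D i j l else 0 := by split_ifs <;> simp [h0]
          have p3 : 0 ≤ if l = s then k D i j l else 0 := by split_ifs <;> simp [h0]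
          by_cases hi : i = s
          · rw [if_pos (Or.inl hi), if_pos hi]; linarith
          by_cases hj : j = s
          · rw [if_pos (Or.inr (Or.inl hj)), if_pos hj]; linarith
          by_cases hl : l = s
          · rw [if_pos (Or.inr (Or.inr hl)), if_pos hl]; linarith
          rw [if_neg (by tauto), abs_zero]; linarith
        refine this.trans (le_of_eq ?_)
        simp_rw [Finset.sum_add_distrib]
        congr 1
        · congr 1
          · rw [Finset.sum_eq_single s]
            · simp
            · intro i _ hi; simp [hi]
            · simp
          · refine Finset.sum_congr rfl fun i _ => ?_
            rw [Finset.sum_eq_single s]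
            · simp
            · intro j _ hj; simp [hj]
            · simp
        · simp
      rw [Real.enorm_eq_ofReal_abs]
      refine (ENNReal.ofReal_le_ofReal hreal).trans (le_of_eq ?_)
      have ee : 1 / (n : ℝ) ^ 3 *
          (∑ j, ∑ l, k D s j l + ∑ i, ∑ l, k D i s l + ∑ i, ∑ j, k D i j s) =
          (B ^ 2 / n ^ 3) * (∑ j, ∑ l, |K₁ (D s) (D j)| * |K₂ (D s) (D l)| +
            ∑ i, ∑ l, |K₁ (D s) (D i)| * |K₂ (D i) (D l)| +
            ∑ i, ∑ j, |K₂ (D s) (D i)| * |K₁ (D i) (D j)|) := by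
        simp only [hk, ← Finset.mul_sum]
        rw [show ∑ i, |K₁ (D i) (D s)| * ∑ l, |K₂ (D i) (D l)| =
          ∑ i, |K₁ (D s) (D i)| * ∑ l, |K₂ (D i) (D l)| from
            Finset.sum_congr rfl fun i _ => by rw [hs₁]]
        rw [show ∑ i, ∑ j, |K₁ (D i) (D j)| * |K₂ (D i) (D s)| =
          ∑ i, |K₂ (D s) (D i)| * ∑ j, |K₁ (D i) (D j)| from
            Finset.sum_congr rfl fun i _ => by rw [← Finset.sum_mul, mul_comm, hs₂]]
        ring
      have p : ∀ x y x' y' : Fin n, 0 ≤ |K₁ (D x) (D y)| * |K₂ (D x') (D y')| :=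
        fun _ _ _ _ => by positivity
      have p' : ∀ x y x' y' : Fin n, 0 ≤ |K₂ (D x) (D y)| * |K₁ (D x') (D y')| :=
        fun _ _ _ _ => by positivity
      have os : ∀ f : Fin n → Fin n → ℝ, (∀ i j, 0 ≤ f i j) →
          ENNReal.ofReal (∑ i, ∑ j, f i j) = ∑ i, ∑ j, ENNReal.ofReal (f i j) := by
        intro f hf
        rw [ENNReal.ofReal_sum_of_nonneg fun i _ => Finset.sum_nonneg fun j _ => hf i j]
        refine Finset.sum_congr rfl fun i _ => ?_
        rw [ENNReal.ofReal_sum_of_nonneg fun j _ => hf i j]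
      have pp : ∀ f : Fin n → Fin n → ℝ, (∀ i j, 0 ≤ f i j) → 0 ≤ ∑ i, ∑ j, f i j :=
        fun f hf => Finset.sum_nonneg fun i _ => Finset.sum_nonneg fun j _ => hf i j
      rw [ee, ENNReal.ofReal_mul (by positivity),
        ENNReal.ofReal_add (add_nonneg (pp _ fun _ _ => p _ _ _ _) (pp _ fun _ _ => p _ _ _ _))
          (pp _ fun _ _ => p' _ _ _ _),
        ENNReal.ofReal_add (pp _ fun _ _ => p _ _ _ _) (pp _ fun _ _ => p _ _ _ _),
        os _ fun _ _ => p _ _ _ _, os _ fun _ _ => p _ _ _ _, os _ fun _ _ => p' _ _ _ _]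
      simp only [hU, hV, hW, hκ₁, hκ₂, Real.enorm_eq_ofReal_abs,
        ENNReal.ofReal_mul (abs_nonneg _)]
    have mU : Measurable U := Finset.measurable_sum _ fun j _ => Finset.measurable_sum _ fun l _ =>
      (measurable_kernel_eval hκ₁m s j).mul (measurable_kernel_eval hκ₂m s l)
    have mV : Measurable V := Finset.measurable_sum _ fun j _ => Finset.measurable_sum _ fun l _ =>
      (measurable_kernel_eval hκ₁m s j).mul (measurable_kernel_eval hκ₂m j l)
    have mW : Measurable W := Finset.measurable_sum _ fun j _ => Finset.measurable_sum _ fun l _ =>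
      (measurable_kernel_eval hκ₂m s j).mul (measurable_kernel_eval hκ₁m j l)
    have mU2 : Measurable fun D => U D ^ 2 := mU.pow_const 2
    have mV2 : Measurable fun D => V D ^ 2 := mV.pow_const 2
    have mW2 : Measurable fun D => W D ^ 2 := mW.pow_const 2
    have mUV : Measurable fun D => U D ^ 2 + V D ^ 2 := mU2.add mV2
    have mUVW : Measurable fun D => U D ^ 2 + V D ^ 2 + W D ^ 2 := mUV.add mW2
    have IU := lintegral_sum_sum_kernel_sq_le (P := P) hκ₁m hκ₂m hκ₁c hκ₂c hq₁ hq₂ s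
      (τ := fun _ => s) (fun _ => Or.inl rfl)
    have IV := lintegral_sum_sum_kernel_sq_le (P := P) hκ₁m hκ₂m hκ₁c hκ₂c hq₁ hq₂ s
      (τ := fun j => j) (fun _ => Or.inr rfl)
    have IW := lintegral_sum_sum_kernel_sq_le (P := P) hκ₂m hκ₁m hκ₂c hκ₁c hq₂ hq₁ s
      (τ := fun j => j) (fun _ => Or.inr rfl)
    rw [mul_comm] at IW
    calc ∫⁻ D, ‖vStat₃ a b K₁ K₂ D - g s D‖ₑ ^ 2 ∂(Measure.pi fun _ : Fin n => P)
        ≤ ∫⁻ D, (ENNReal.ofReal (B ^ 2 / n ^ 3) ^ 2 * 3) * (U D ^ 2 + V D ^ 2 + W D ^ 2)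
            ∂(Measure.pi fun _ : Fin n => P) :=
          lintegral_mono fun D => by
            refine (pow_le_pow_left' (pt D) 2).trans ?_
            rw [mul_pow, mul_assoc]
            gcongr
            exact ENNReal.sq_add_add_le _ _ _
      _ = (ENNReal.ofReal (B ^ 2 / n ^ 3) ^ 2 * 3) *
            (∫⁻ D, U D ^ 2 ∂(Measure.pi fun _ : Fin n => P) +
              ∫⁻ D, V D ^ 2 ∂(Measure.pi fun _ : Fin n => P) +
              ∫⁻ D, W D ^ 2 ∂(Measure.pi fun _ : Fin n => P)) := by
          rw [lintegral_const_mul _ mUVW, lintegral_add_left mUV, lintegral_add_left mU2]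
      _ ≤ (ENNReal.ofReal (B ^ 2 / n ^ 3) ^ 2 * 3) *
            ((b₁ * b₂) ^ 2 + (b₁ * b₂) ^ 2 + (b₁ * b₂) ^ 2) := by
          gcongr
      _ = 9 * (ENNReal.ofReal (B ^ 2 / n ^ 3) * (b₁ * b₂)) ^ 2 := by ring
      _ = _ := by
          have e1 : ∀ c : ℝ, 0 ≤ c → 4 * ENNReal.ofReal c + n * ENNReal.ofReal q =
              ENNReal.ofReal (4 * c + n * q) := fun c hc => by
            rw [ENNReal.ofReal_add (by positivity) (by positivity),
              ENNReal.ofReal_mul (by positivity), ENNReal.ofReal_mul (by positivity),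
              ENNReal.ofReal_natCast]
            simp
          rw [hb₁, hb₂, e1 _ hc₁0, e1 _ hc₂0, ENNReal.ofReal_mul (by norm_num),
            ENNReal.ofReal_pow (by positivity), ENNReal.ofReal_mul (by positivity),
            ENNReal.ofReal_mul (by positivity)]
          simp
  refine (Finset.sum_le_sum fun s _ => key s).trans (le_of_eq ?_)
  rw [Finset.sum_const, Finset.card_univ, Fintype.card_fin, nsmul_eq_mul,
    ENNReal.ofReal_mul (p := (n : ℝ)) (by positivity), ENNReal.ofReal_natCast]

theorem integral_vStat₁ {a b : Ω → ℝ} (ha : Measurable a) (hb : Measurable b) {B : ℝ}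
    (haB : ∀ x, |a x| ≤ B) (hbB : ∀ x, |b x| ≤ B) (hn : 0 < n) :
    ∫ D, vStat₁ a b D ∂(Measure.pi fun _ : Fin n => P) = ∫ x, a x * b x ∂P := by
  have hm : Measurable fun x => a x * b x := ha.mul hb
  have hab : ∀ x, |a x * b x| ≤ B * B := fun x => by
    rw [abs_mul]; exact mul_le_mul (haB x) (hbB x) (abs_nonneg _) ((abs_nonneg _).trans (haB x))
  have hi : ∀ i : Fin n, Integrable (fun D : Fin n → Ω => a (D i) * b (D i))
      (Measure.pi fun _ : Fin n => P) := fun i =>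
    integrable_of_measurable_of_bound (hm.comp (measurable_pi_apply i)) fun D => hab _
  simp only [vStat₁]
  rw [integral_const_mul, integral_finsetSum _ fun i _ => hi i]
  simp_rw [fun i : Fin n => integral_pi_eval (P := P) i hm.aestronglyMeasurable]
  have : (n : ℝ) ≠ 0 := by positivity
  simp [this]

/-- The expectation of a V-statistic of order two, split into off-diagonal and diagonal terms. -/
theorem integral_vStat₂ {a b : Ω → ℝ} {K : Ω → Ω → ℝ} (ha : Measurable a) (hb : Measurable b)
    (hK : Measurable (Function.uncurry K)) {B c : ℝ}
    (haB : ∀ x, |a x| ≤ B) (hbB : ∀ x, |b x| ≤ B) (hB : 0 ≤ B)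
    (hc : ∀ x y, |K x y| ≤ c) (hn : 0 < n) :
    ∫ D, vStat₂ a b K D ∂(Measure.pi fun _ : Fin n => P) =
      (1 - 1 / n) * ∫ x, (∫ y, a x * b y * K x y ∂P) ∂P + 1 / n * ∫ x, a x * b x * K x x ∂P := by
  have hm : Measurable (Function.uncurry fun x y => a x * b y * K x y) :=
    ((ha.comp measurable_fst).mul (hb.comp measurable_snd)).mul hK
  have habK : ∀ x y, |a x * b y * K x y| ≤ B * B * c := fun x y => by
    rw [abs_mul, abs_mul]
    exact mul_le_mul (mul_le_mul (haB x) (hbB y) (abs_nonneg _) hB) (hc x y) (abs_nonneg _)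
      (mul_nonneg hB hB)
  have hi : ∀ i j : Fin n, Integrable (fun D : Fin n → Ω => a (D i) * b (D j) * K (D i) (D j))
      (Measure.pi fun _ : Fin n => P) := fun i j =>
    integrable_of_measurable_of_bound (measurable_kernel_eval hm i j) fun D => habK _ _
  simp only [vStat₂]
  rw [integral_const_mul, integral_finsetSum _ fun i _ => integrable_finsetSum _ fun j _ => hi i j]
  simp_rw [fun i : Fin n => integral_finsetSum Finset.univ fun j _ => hi i j]
  set e₀ := ∫ x, (∫ y, a x * b y * K x y ∂P) ∂P
  set e₁ := ∫ x, a x * b x * K x x ∂P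
  have key : ∀ i j : Fin n, ∫ D, a (D i) * b (D j) * K (D i) (D j)
      ∂(Measure.pi fun _ : Fin n => P) = e₀ + if i = j then e₁ - e₀ else 0 := by
    intro i j
    split_ifs with h
    · subst h
      rw [integral_pi_eval (P := P) (f := fun x => a x * b x * K x x) i
        (hm.comp (measurable_id.prodMk measurable_id)).aestronglyMeasurable]
      ring
    · rw [integral_pi_two (P := P) h hm habK, add_zero]
  simp_rw [key, Finset.sum_add_distrib]
  have : (n : ℝ) ≠ 0 := by positivity
  simp only [Finset.sum_const, Finset.card_univ, Fintype.card_fin, nsmul_eq_mul,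
    Finset.sum_ite_eq, Finset.mem_univ, if_true]
  field_simp
  ring

/-- The expectation of a V-statistic of order three, split according to which of the three indices
coincide. -/
theorem integral_vStat₃ {a b : Ω → ℝ} {K₁ K₂ : Ω → Ω → ℝ} (ha : Measurable a) (hb : Measurable b)
    (hK₁ : Measurable (Function.uncurry K₁)) (hK₂ : Measurable (Function.uncurry K₂))
    {B c₁ c₂ : ℝ} (haB : ∀ x, |a x| ≤ B) (hbB : ∀ x, |b x| ≤ B) (hB : 0 ≤ B) (hc₁0 : 0 ≤ c₁)
    (hc₁ : ∀ x y, |K₁ x y| ≤ c₁) (hc₂ : ∀ x y, |K₂ x y| ≤ c₂) (hn : 0 < n) :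
    ∫ D, vStat₃ a b K₁ K₂ D ∂(Measure.pi fun _ : Fin n => P) =
      1 / (n : ℝ) ^ 2 *
        ((n - 1) * (n - 2) * ∫ x, (∫ y, a y * K₁ y x ∂P) * (∫ z, b z * K₂ z x ∂P) ∂P +
        (n - 1) * (∫ x, a x * K₁ x x * (∫ z, b z * K₂ z x ∂P) ∂P +
          ∫ x, (∫ y, a y * K₁ y x ∂P) * (b x * K₂ x x) ∂P +
          ∫ y, a y * b y * (∫ x, K₁ y x * K₂ y x ∂P) ∂P) +
        ∫ x, a x * K₁ x x * (b x * K₂ x x) ∂P) := by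
  have hb₁ : ∀ y x, |a y * K₁ y x| ≤ B * c₁ := fun y x => by
    rw [abs_mul]; exact mul_le_mul (haB _) (hc₁ _ _) (abs_nonneg _) hB
  have hb₂ : ∀ y x, |b y * K₂ y x| ≤ B * c₂ := fun y x => by
    rw [abs_mul]; exact mul_le_mul (hbB _) (hc₂ _ _) (abs_nonneg _) hB
  have hZ : ∀ x y z, |a y * K₁ y x * (b z * K₂ z x)| ≤ B * c₁ * (B * c₂) := fun x y z => by
    rw [abs_mul]; exact mul_le_mul (hb₁ _ _) (hb₂ _ _) (abs_nonneg _) (mul_nonneg hB hc₁0)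
  -- measurability of the summand with its three arguments inserted in any way
  have hm : ∀ {α : Type _} [MeasurableSpace α] {u v w : α → Ω}, Measurable u → Measurable v →
      Measurable w → Measurable fun t => a (v t) * K₁ (v t) (u t) * (b (w t) * K₂ (w t) (u t)) := by
    intro α _ u v w hu hv hw
    exact ((ha.comp hv).mul (hK₁.comp (hv.prodMk hu))).mul
      ((hb.comp hw).mul (hK₂.comp (hw.prodMk hu)))
  have hi : ∀ i j l : Fin n,
      Integrable (fun D : Fin n → Ω => a (D j) * K₁ (D j) (D i) * (b (D l) * K₂ (D l) (D i)))
      (Measure.pi fun _ : Fin n => P) := fun i j l =>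
    integrable_of_measurable_of_bound
      (hm (measurable_pi_apply i) (measurable_pi_apply j) (measurable_pi_apply l))
      fun D => hZ _ _ _
  simp only [vStat₃]
  rw [integral_const_mul, integral_finsetSum _ fun i _ => integrable_finsetSum _ fun j _ =>
    integrable_finsetSum _ fun l _ => hi i j l]
  simp_rw [fun i : Fin n => integral_finsetSum Finset.univ fun j _ =>
    integrable_finsetSum Finset.univ fun l _ => hi i j l]
  simp_rw [fun i j : Fin n => integral_finsetSum Finset.univ fun l _ => hi i j l]
  set e₄ := ∫ x, (∫ y, a y * K₁ y x ∂P) * (∫ z, b z * K₂ z x ∂P) ∂P with he₄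
  set e₁ := ∫ x, a x * K₁ x x * (∫ z, b z * K₂ z x ∂P) ∂P with he₁
  set e₂ := ∫ x, (∫ y, a y * K₁ y x ∂P) * (b x * K₂ x x) ∂P with he₂
  set e₃ := ∫ y, a y * b y * (∫ x, K₁ y x * K₂ y x ∂P) ∂P with he₃
  set e₅ := ∫ x, a x * K₁ x x * (b x * K₂ x x) ∂P with he₅
  have key : ∀ i j l : Fin n, ∫ D, a (D j) * K₁ (D j) (D i) * (b (D l) * K₂ (D l) (D i))
      ∂(Measure.pi fun _ : Fin n => P) =
        if i = j then (e₁ + if i = l then e₅ - e₁ else 0)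
        else (e₄ + (if i = l then e₂ - e₄ else 0) + if j = l then e₃ - e₄ else 0) := by
    intro i j l
    by_cases hij : i = j
    · subst hij
      by_cases hil : i = l
      · subst hil
        simp only [if_true, add_sub_cancel]
        exact integral_pi_eval (P := P) (f := fun x => a x * K₁ x x * (b x * K₂ x x)) i
          (hm measurable_id measurable_id measurable_id).aestronglyMeasurable
      · simp only [if_true, hil, if_false, add_zero]
        rw [integral_pi_two (P := P) (f := fun x z => a x * K₁ x x * (b z * K₂ z x)) hil
          (hm measurable_fst measurable_fst measurable_snd) fun x z => hZ x x z]
        simp_rw [integral_const_mul]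
        rfl
    · by_cases hil : i = l
      · subst hil
        simp only [hij, Ne.symm hij, if_true, if_false, add_zero, add_sub_cancel]
        rw [integral_pi_two (P := P) (f := fun x y => a y * K₁ y x * (b x * K₂ x x)) hij
          (hm measurable_fst measurable_snd measurable_fst) fun x y => hZ x y x]
        simp_rw [integral_mul_const]
        rfl
      · by_cases hjl : j = l
        · subst hjl
          simp only [hij, if_true, if_false, add_zero, add_sub_cancel]
          rw [integral_pi_two (P := P) (f := fun y x => a y * K₁ y x * (b y * K₂ y x)) (Ne.symm hij)
            (hm measurable_snd measurable_fst measurable_fst) fun y x => hZ x y y]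
          have : ∀ y x, a y * K₁ y x * (b y * K₂ y x) = a y * b y * (K₁ y x * K₂ y x) :=
            fun y x => by ring
          simp_rw [this, integral_const_mul]
          rfl
        · simp only [hij, hil, hjl, if_false, add_zero]
          rw [integral_pi_three (P := P) (f := fun x y z => a y * K₁ y x * (b z * K₂ z x)) hij hil
            hjl (hm (measurable_fst.comp measurable_fst) (measurable_snd.comp measurable_fst)
              measurable_snd) hZ]
          simp_rw [integral_const_mul, integral_mul_const]
          rfl
  have sum_l : ∀ i j : Fin n, ∑ l : Fin n, (if i = j then (e₁ + if i = l then e₅ - e₁ else 0)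
        else (e₄ + (if i = l then e₂ - e₄ else 0) + if j = l then e₃ - e₄ else 0)) =
        (n * e₄ + (e₂ - e₄) + (e₃ - e₄)) +
        if i = j then (n * e₁ + (e₅ - e₁)) - (n * e₄ + (e₂ - e₄) + (e₃ - e₄)) else 0 := by
    intro i j
    by_cases h : i = j
    · simp [h, Finset.sum_add_distrib]
    · simp [h, Finset.sum_add_distrib]
  simp_rw [key, sum_l, Finset.sum_add_distrib]
  have : (n : ℝ) ≠ 0 := by positivity
  simp only [Finset.sum_const, Finset.card_univ, Fintype.card_fin, nsmul_eq_mul,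
    Finset.sum_ite_eq, Finset.mem_univ, if_true]
  field_simp
  ring

end VStatistics

/-! ### One-dimensional scaling functions and wavelets -/

section Dilates

variable {N J : ℕ} {f : ℝ → ℝ} {fL fR : ℕ → ℝ → ℝ}

theorem exists_bound_of_continuousOn_Ici {g : ℝ → ℝ} (hg : ContinuousOn g (Ici 0)) {R : ℝ}
    (hR : ∀ x > R, g x = 0) : ∃ C, 0 ≤ C ∧ ∀ x, 0 ≤ x → |g x| ≤ C := by
  obtain ⟨C, hC⟩ := (isCompact_Icc (a := (0 : ℝ)) (b := R)).exists_bound_of_continuousOn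
    (hg.mono Icc_subset_Ici_self)
  refine ⟨max C 0, le_max_right _ _, fun x hx => ?_⟩
  rcases le_or_gt x R with h | h
  · exact (hC x ⟨hx, h⟩).trans (le_max_left _ _)
  · rw [hR x h, abs_zero]; exact le_max_right _ _

/-- Size and localization of the dilates: the `m`-th function of level `j` is `O(2 ^ (j / 2))` and
lives within `O(2 ^ (-j))` of `m / 2 ^ j`. All kernel estimates come from this. -/
theorem exists_dilates_bound (hN : 2 * N ≤ 2 ^ J) (hf : Continuous f) (hfc : HasCompactSupport f)
    (hL : ∀ k < N, ContinuousOn (fL k) (Ici 0)) (hR : ∀ k < N, ContinuousOn (fR k) (Ici 0))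
    (he : ∃ R : ℝ, ∀ k < N, ∀ x > R, fL k x = 0 ∧ fR k x = 0) :
    ∃ B R : ℝ, 0 ≤ B ∧ 0 ≤ R ∧ ∀ j, J ≤ j → ∀ (m : Fin (2 ^ j)) (x : ℝ), x ∈ Icc (0 : ℝ) 1 →
      |dilates N f fL fR j m x| ≤ B * 2 ^ ((j : ℝ) / 2) ∧
      (dilates N f fL fR j m x ≠ 0 → |2 ^ j * x - (m : ℕ)| ≤ R) := by
  obtain ⟨C₀, hC₀⟩ := hfc.exists_bound_of_continuous hf
  obtain ⟨R₀, hR₀, hf0⟩ := hfc.exists_pos_le_norm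
  obtain ⟨R₁, hR₁⟩ := he
  choose! CL hCL0 hCL using fun k (hk : k < N) =>
    exists_bound_of_continuousOn_Ici (hL k hk) fun x hx => (hR₁ k hk x hx).1
  choose! CR hCR0 hCR using fun k (hk : k < N) =>
    exists_bound_of_continuousOn_Ici (hR k hk) fun x hx => (hR₁ k hk x hx).2
  set SL := ∑ k ∈ Finset.range N, CL k with hSL
  set SR := ∑ k ∈ Finset.range N, CR k with hSR
  have hSL0 : 0 ≤ SL := Finset.sum_nonneg fun k hk => hCL0 k (Finset.mem_range.1 hk)
  have hSR0 : 0 ≤ SR := Finset.sum_nonneg fun k hk => hCR0 k (Finset.mem_range.1 hk)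
  have hCLS : ∀ k < N, CL k ≤ SL := fun k hk => Finset.single_le_sum (f := CL)
    (fun i hi => hCL0 i (Finset.mem_range.1 hi)) (Finset.mem_range.2 hk)
  have hCRS : ∀ k < N, CR k ≤ SR := fun k hk => Finset.single_le_sum (f := CR)
    (fun i hi => hCR0 i (Finset.mem_range.1 hi)) (Finset.mem_range.2 hk)
  have hC₀0 : 0 ≤ C₀ := (norm_nonneg _).trans (hC₀ 0)
  refine ⟨C₀ + SL + SR, R₀ + |R₁| + N, by positivity, by positivity, fun j hj m x hx => ?_⟩
  have h2 : (0 : ℝ) < 2 ^ j := by positivity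
  have hr : (0 : ℝ) < 2 ^ ((j : ℝ) / 2) := by positivity
  have hm := m.2
  have hNj : 2 * N ≤ 2 ^ j := hN.trans (Nat.pow_le_pow_right (by norm_num) hj)
  have hx0 : 0 ≤ 2 ^ j * x := mul_nonneg h2.le hx.1
  have hx1 : 0 ≤ 2 ^ j * (1 - x) := mul_nonneg h2.le (by linarith [hx.2])
  have hR1 := le_abs_self R₁
  have hN0 : (0 : ℝ) ≤ N := by positivity
  have hR10 := abs_nonneg R₁
  unfold dilates
  split_ifs with h1 h3
  · constructor
    · rw [abs_mul, abs_of_pos hr, mul_comm]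
      gcongr
      linarith [hCL _ h1 _ hx0, hCLS _ h1]
    · intro hne
      have : ¬ (2 ^ j * x > R₁) := fun h => hne (by rw [(hR₁ _ h1 _ h).1, mul_zero])
      have h1' : ((m : ℕ) : ℝ) ≤ N := by exact_mod_cast h1.le
      have : (0 : ℝ) ≤ ((m : ℕ) : ℝ) := by positivity
      rw [abs_le]; constructor <;> linarith
  · constructor
    · rw [abs_mul, abs_of_pos hr, mul_comm]
      gcongr
      have := hC₀ (2 ^ j * x - (m : ℕ))
      rw [Real.norm_eq_abs] at this
      linarith
    · intro hne
      have : ¬ (R₀ ≤ ‖2 ^ j * x - ((m : ℕ) : ℝ)‖) := fun h => hne (by rw [hf0 _ h, mul_zero])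
      rw [Real.norm_eq_abs] at this
      linarith
  · have hk : 2 ^ j - 1 - (m : ℕ) < N := by omega
    constructor
    · rw [abs_mul, abs_of_pos hr, mul_comm]
      gcongr
      linarith [hCR _ hk _ hx1, hCRS _ hk]
    · intro hne
      have : ¬ (2 ^ j * (1 - x) > R₁) := fun h => hne (by rw [(hR₁ _ hk _ h).2, mul_zero])
      have h4 : ((m : ℕ) : ℝ) ≤ 2 ^ j := by exact_mod_cast hm.le
      have h5 : (2 : ℝ) ^ j ≤ (m : ℕ) + N := by
        have : 2 ^ j ≤ (m : ℕ) + N := by omega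
        exact_mod_cast this
      rw [abs_le]; constructor <;> nlinarith

theorem continuousOn_dilates (hN : 2 * N ≤ 2 ^ J) (hf : Continuous f)
    (hL : ∀ k < N, ContinuousOn (fL k) (Ici 0)) (hR : ∀ k < N, ContinuousOn (fR k) (Ici 0))
    {j : ℕ} (hj : J ≤ j) (m : Fin (2 ^ j)) :
    ContinuousOn (dilates N f fL fR j m) (Icc 0 1) := by
  have hm := m.2
  have hNj : 2 * N ≤ 2 ^ j := hN.trans (Nat.pow_le_pow_right (by norm_num) hj)
  have h2 : (0 : ℝ) < 2 ^ j := by positivity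
  unfold dilates
  refine continuousOn_const.mul ?_
  split_ifs with h1 h3
  · exact (hL _ h1).comp (by fun_prop) fun x hx => mul_nonneg h2.le hx.1
  · exact (hf.comp (by fun_prop)).continuousOn
  · have hk : 2 ^ j - 1 - (m : ℕ) < N := by omega
    exact (hR _ hk).comp (by fun_prop) fun x hx => mul_nonneg h2.le (by linarith [hx.2])

end Dilates

theorem sum_indicator_near_le (j : ℕ) (t : ℝ) {R : ℝ} (hR : 0 ≤ R) :
    ∑ m : Fin (2 ^ j), (if |t - ((m : ℕ) : ℝ)| ≤ R then (1 : ℝ) else 0) ≤ 2 * R + 1 := by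
  rw [Finset.sum_boole]
  set s := Finset.univ.filter fun m : Fin (2 ^ j) => |t - ((m : ℕ) : ℝ)| ≤ R
  have hcard : s.card ≤ (Finset.Icc ⌈t - R⌉ ⌊t + R⌋).card := by
    refine Finset.card_le_card_of_injOn (fun m => ((m : ℕ) : ℤ)) ?_ ?_
    · intro m hm
      have h := (Finset.mem_filter.1 hm).2
      rw [abs_le] at h
      simp only [Finset.coe_Icc, mem_Icc]
      refine ⟨Int.ceil_le.2 ?_, Int.le_floor.2 ?_⟩ <;> push_cast <;> linarith
    · intro a _ b _ h
      exact Fin.ext (by simpa using h)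
  rw [Int.card_Icc] at hcard
  have h1 := Int.floor_le (t + R)
  have h2 := Int.le_ceil (t - R)
  rcases le_or_gt 0 (⌊t + R⌋ + 1 - ⌈t - R⌉) with h | h
  · have h3 : (((⌊t + R⌋ + 1 - ⌈t - R⌉).toNat : ℤ) : ℝ) = ⌊t + R⌋ + 1 - ⌈t - R⌉ := by
      rw [Int.toNat_of_nonneg h]; push_cast; ring
    have h4 : (s.card : ℝ) ≤ (((⌊t + R⌋ + 1 - ⌈t - R⌉).toNat : ℤ) : ℝ) := by exact_mod_cast hcard
    linarith
  · rw [Int.toNat_of_nonpos h.le] at hcard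
    have : (s.card : ℝ) = 0 := by exact_mod_cast Nat.le_zero.1 hcard
    linarith

namespace CDVBasis

variable {S : ℕ} (W : CDVBasis S)

/-- The scaling functions (`ι = 0`) and the wavelets (`ι = 1`) in one family. -/
noncomputable def basis (ι : Fin 2) (l : ℕ) (m : Fin (2 ^ l)) (x : ℝ) : ℝ :=
  if ι = 0 then W.scaling l m x else W.wavelet l m x

theorem basis_zero (l : ℕ) (m : Fin (2 ^ l)) : W.basis 0 l m = W.scaling l m := by
  ext x; simp [basis]

theorem exists_basis_bound : ∃ B R : ℝ, 0 ≤ B ∧ 0 ≤ R ∧ ∀ (ι : Fin 2) (j : ℕ), W.J₀ ≤ j →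
    ∀ (m : Fin (2 ^ j)) (x : ℝ), x ∈ Icc (0 : ℝ) 1 →
      |W.basis ι j m x| ≤ B * 2 ^ ((j : ℝ) / 2) ∧
      (W.basis ι j m x ≠ 0 → |2 ^ j * x - (m : ℕ)| ≤ R) := by
  obtain ⟨R, hR⟩ := W.compact_edge
  obtain ⟨B₀, R₀, hB₀, hR₀, h₀⟩ := exists_dilates_bound W.two_mul_N_le W.continuous_φ W.compact_φ
    (fun k hk => (W.continuous_edge k hk).1) (fun k hk => (W.continuous_edge k hk).2.1)
    ⟨R, fun k hk x hx => ⟨(hR k hk x hx).1, (hR k hk x hx).2.1⟩⟩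
  obtain ⟨B₁, R₁, hB₁, hR₁, h₁⟩ := exists_dilates_bound W.two_mul_N_le W.continuous_ψ W.compact_ψ
    (fun k hk => (W.continuous_edge k hk).2.2.1) (fun k hk => (W.continuous_edge k hk).2.2.2)
    ⟨R, fun k hk x hx => ⟨(hR k hk x hx).2.2.1, (hR k hk x hx).2.2.2⟩⟩
  refine ⟨B₀ + B₁, R₀ + R₁, by positivity, by positivity, fun ι j hj m x hx => ?_⟩
  have hr : (0 : ℝ) < 2 ^ ((j : ℝ) / 2) := by positivity
  have hb0 := mul_nonneg hB₀ hr.le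
  have hb1 := mul_nonneg hB₁ hr.le
  by_cases hι : ι = 0
  · have := h₀ j hj m x hx
    simp only [basis, hι, if_true, scaling]
    exact ⟨by linarith [this.1], fun h => by linarith [this.2 h]⟩
  · have := h₁ j hj m x hx
    simp only [basis, hι, if_false, wavelet]
    exact ⟨by linarith [this.1], fun h => by linarith [this.2 h]⟩

variable {W} in
theorem continuousOn_basis {j : ℕ} (hj : W.J₀ ≤ j) (ι : Fin 2) (m : Fin (2 ^ j)) :
    ContinuousOn (W.basis ι j m) (Icc 0 1) := by
  unfold basis
  split_ifs
  · exact continuousOn_dilates W.two_mul_N_le W.continuous_φ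
      (fun k hk => (W.continuous_edge k hk).1) (fun k hk => (W.continuous_edge k hk).2.1) hj m
  · exact continuousOn_dilates W.two_mul_N_le W.continuous_ψ
      (fun k hk => (W.continuous_edge k hk).2.2.1) (fun k hk => (W.continuous_edge k hk).2.2.2) hj m

/-- At each point the functions of one level add up to `O(2 ^ (j / 2))`, as boundedly many of them
do not vanish there. -/
theorem exists_sum_abs_basis_le : ∃ C : ℝ, 0 ≤ C ∧ ∀ (ι : Fin 2) (j : ℕ), W.J₀ ≤ j →
    ∀ x ∈ Icc (0 : ℝ) 1, ∑ m, |W.basis ι j m x| ≤ C * 2 ^ ((j : ℝ) / 2) := by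
  obtain ⟨B, R, hB, hR, h⟩ := W.exists_basis_bound
  refine ⟨B * (2 * R + 1), by positivity, fun ι j hj x hx => ?_⟩
  have hr : (0 : ℝ) < 2 ^ ((j : ℝ) / 2) := by positivity
  calc ∑ m, |W.basis ι j m x|
      ≤ ∑ m : Fin (2 ^ j), B * 2 ^ ((j : ℝ) / 2) *
          (if |2 ^ j * x - ((m : ℕ) : ℝ)| ≤ R then (1 : ℝ) else 0) := by
        refine Finset.sum_le_sum fun m _ => ?_
        split_ifs with hm
        · rw [mul_one]; exact (h ι j hj m x hx).1
        · have : W.basis ι j m x = 0 := by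
            by_contra hne; exact hm ((h ι j hj m x hx).2 hne)
          simp [this]
    _ ≤ B * 2 ^ ((j : ℝ) / 2) * (2 * R + 1) := by
        rw [← Finset.mul_sum]
        exact mul_le_mul_of_nonneg_left (sum_indicator_near_le j _ hR) (by positivity)
    _ = _ := by ring

theorem two_rpow_half_mul_self (j : ℕ) :
    (2 : ℝ) ^ ((j : ℝ) / 2) * 2 ^ ((j : ℝ) / 2) = 2 ^ j := by
  rw [← Real.rpow_add (by norm_num), add_halves, Real.rpow_natCast]

/-- The `L¹` norms of the functions of level `j` are `O(2 ^ (-j / 2))`. -/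
theorem exists_integral_abs_scaling_le : ∃ C : ℝ, 0 ≤ C ∧ ∀ j : ℕ, W.J₀ ≤ j →
    ∀ m : Fin (2 ^ j), 2 ^ ((j : ℝ) / 2) * ∫ x in Icc (0 : ℝ) 1, |W.scaling j m x| ≤ C := by
  obtain ⟨B, R, hB, hR, h⟩ := W.exists_basis_bound
  refine ⟨B * (2 * R), by positivity, fun j hj m => ?_⟩
  have hr : (0 : ℝ) < 2 ^ ((j : ℝ) / 2) := by positivity
  have h2 : (0 : ℝ) < 2 ^ j := by positivity
  set I : Set ℝ := Icc (((m : ℕ) - R) / 2 ^ j) (((m : ℕ) + R) / 2 ^ j) with hI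
  have hle : ∫ x in Icc (0 : ℝ) 1, |W.scaling j m x| ≤
      ∫ x in Icc (0 : ℝ) 1, I.indicator (fun _ => B * 2 ^ ((j : ℝ) / 2)) x := by
    refine integral_mono_of_nonneg (Eventually.of_forall fun x => abs_nonneg _) ?_ ?_
    · exact (integrable_const _).indicator measurableSet_Icc
    · refine (ae_restrict_iff' measurableSet_Icc).2 (Eventually.of_forall fun x hx => ?_)
      have hb := h 0 j hj m x hx
      rw [basis_zero] at hb
      by_cases hxI : x ∈ I
      · rw [indicator_of_mem hxI]; exact hb.1
      · rw [indicator_of_notMem hxI]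
        have : W.scaling j m x = 0 := by
          by_contra hne
          have := abs_le.1 (hb.2 hne)
          refine hxI ⟨?_, ?_⟩
          · rw [div_le_iff₀ h2]; linarith
          · rw [le_div_iff₀ h2]; linarith
        simp [this]
  have hI2 : ∫ x in Icc (0 : ℝ) 1, I.indicator (fun _ => B * 2 ^ ((j : ℝ) / 2)) x ≤
      (B * 2 ^ ((j : ℝ) / 2)) * (2 * R / 2 ^ j) := by
    rw [integral_indicator measurableSet_Icc, setIntegral_const, smul_eq_mul, mul_comm]
    refine mul_le_mul_of_nonneg_left ?_ (by positivity)
    have h3 : volume.real I = 2 * R / 2 ^ j := by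
      rw [hI, Real.volume_real_Icc_of_le]
      · field_simp; ring
      · gcongr; linarith
    rw [← h3, measureReal_restrict_apply measurableSet_Icc]
    exact measureReal_mono inter_subset_left (by rw [hI]; exact measure_Icc_lt_top.ne)
  calc 2 ^ ((j : ℝ) / 2) * ∫ x in Icc (0 : ℝ) 1, |W.scaling j m x|
      ≤ 2 ^ ((j : ℝ) / 2) * ((B * 2 ^ ((j : ℝ) / 2)) * (2 * R / 2 ^ j)) :=
        mul_le_mul_of_nonneg_left (hle.trans hI2) hr.le
    _ = B * (2 * R) * ((2 ^ ((j : ℝ) / 2) * 2 ^ ((j : ℝ) / 2)) / 2 ^ j) := by ring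
    _ = B * (2 * R) := by rw [two_rpow_half_mul_self, div_self h2.ne', mul_one]

variable {W}

theorem integrableOn_basis_mul {j j' : ℕ} (hj : W.J₀ ≤ j) (hj' : W.J₀ ≤ j') (ι ι' : Fin 2)
    (m : Fin (2 ^ j)) (m' : Fin (2 ^ j')) :
    IntegrableOn (fun x => W.basis ι j m x * W.basis ι' j' m' x) (Icc 0 1) :=
  ((continuousOn_basis hj ι m).mul (continuousOn_basis hj' ι' m')).integrableOn_Icc

theorem integral_basis_mul_basis {j : ℕ} (hj : W.J₀ ≤ j) (a b : Fin 2 × Fin (2 ^ j)) :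
    ∫ x in Icc (0 : ℝ) 1, W.basis a.1 j a.2 x * W.basis b.1 j b.2 x = if a = b then 1 else 0 := by
  obtain ⟨ι, m⟩ := a
  obtain ⟨ι', m'⟩ := b
  fin_cases ι <;> fin_cases ι'
  · simpa [basis, scaling] using W.orthonormal_φ j hj m m'
  · simpa [basis, scaling, wavelet] using W.orthogonal j hj m m'
  · simpa [basis, scaling, wavelet, mul_comm] using W.orthogonal j hj m' m
  · simpa [basis, wavelet] using W.orthonormal_ψ j hj m m'

/-- The one-dimensional projection kernels satisfy `K_{j+1} = ∑ φ φ + ∑ ψ ψ`: the coefficients of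
the functions of level `j` in terms of the scaling functions of level `j + 1` form a square matrix
with orthonormal rows, hence with orthonormal columns. -/
theorem sum_basis_mul_basis_eq {j : ℕ} (hj : W.J₀ ≤ j) {x y : ℝ} (hx : x ∈ Icc (0 : ℝ) 1)
    (hy : y ∈ Icc (0 : ℝ) 1) :
    ∑ ι, ∑ m, W.basis ι j m x * W.basis ι j m y =
      ∑ r, W.scaling (j + 1) r x * W.scaling (j + 1) r y := by
  have hex : ∀ a : Fin 2 × Fin (2 ^ j), ∃ c : Fin (2 ^ (j + 1)) → ℝ, ∀ x ∈ Icc (0 : ℝ) 1,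
      W.basis a.1 j a.2 x = ∑ r, c r * W.scaling (j + 1) r x := by
    rintro ⟨ι, m⟩
    fin_cases ι
    · simpa [basis, scaling] using W.refine_φ j hj m
    · simpa [basis, wavelet, scaling] using W.refine_ψ j hj m
  choose c hc using hex
  have hj1 : W.J₀ ≤ j + 1 := hj.trans (Nat.le_succ j)
  set A : Matrix (Fin 2 × Fin (2 ^ j)) (Fin (2 ^ (j + 1))) ℝ := Matrix.of c with hA
  have hAA : A * A.transpose = 1 := by
    ext a b
    rw [Matrix.mul_apply, Matrix.one_apply, ← integral_basis_mul_basis hj a b,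
      setIntegral_congr_fun measurableSet_Icc (g := fun x =>
        ∑ r, ∑ r', c a r * c b r' * (W.basis 0 (j + 1) r x * W.basis 0 (j + 1) r' x))]
    · rw [integral_finsetSum _ fun r _ => integrable_finsetSum _ fun r' _ =>
        (integrableOn_basis_mul hj1 hj1 0 0 r r').const_mul _]
      refine Finset.sum_congr rfl fun r _ => ?_
      rw [integral_finsetSum _ fun r' _ =>
        (integrableOn_basis_mul hj1 hj1 0 0 r r').const_mul _]
      simp_rw [integral_const_mul]
      rw [Finset.sum_eq_single r]
      · have := integral_basis_mul_basis hj1 (0, r) (0, r)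
        simp only [if_true] at this
        rw [this, mul_one]; rfl
      · intro r' _ hr'
        have := integral_basis_mul_basis hj1 (0, r) (0, r')
        rw [if_neg (by simp [Ne.symm hr'])] at this
        simp only at this
        rw [this, mul_zero]
      · simp
    · intro x hx
      simp only
      rw [hc a x hx, hc b x hx, Finset.sum_mul_sum]
      refine Finset.sum_congr rfl fun r _ => Finset.sum_congr rfl fun r' _ => ?_
      rw [basis_zero, basis_zero]; ring
  have hcard : Fintype.card (Fin 2 × Fin (2 ^ j)) = Fintype.card (Fin (2 ^ (j + 1))) := by
    simp [pow_succ, mul_comm]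
  have hAA' : A.transpose * A = 1 := (Matrix.mul_eq_one_comm_of_card_eq _ _ _ hcard).1 hAA
  have hcol : ∀ r r', ∑ a, c a r * c a r' = if r = r' then 1 else 0 := fun r r' => by
    have := congrFun (congrFun hAA' r) r'
    rwa [Matrix.mul_apply, Matrix.one_apply] at this
  rw [← Fintype.sum_prod_type' (f := fun ι m => W.basis ι j m x * W.basis ι j m y)]
  calc ∑ a : Fin 2 × Fin (2 ^ j), W.basis a.1 j a.2 x * W.basis a.1 j a.2 y
      = ∑ a, ∑ r, ∑ r', c a r * c a r' * (W.scaling (j + 1) r x * W.scaling (j + 1) r' y) := by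
        refine Finset.sum_congr rfl fun a _ => ?_
        rw [hc a x hx, hc a y hy, Finset.sum_mul_sum]
        refine Finset.sum_congr rfl fun r _ => Finset.sum_congr rfl fun r' _ => ?_
        ring
    _ = ∑ r, ∑ r', (∑ a, c a r * c a r') * (W.scaling (j + 1) r x * W.scaling (j + 1) r' y) := by
        rw [Finset.sum_comm]
        refine Finset.sum_congr rfl fun r _ => ?_
        rw [Finset.sum_comm]
        refine Finset.sum_congr rfl fun r' _ => ?_
        rw [Finset.sum_mul]
    _ = _ := by
        simp_rw [hcol]
        simp

end CDVBasis

/-! ### Tensor products and projection kernels on the cube -/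

/-- Lebesgue measure on the unit cube is a product measure. -/
theorem volume_restrict_cube (d : ℕ) : (volume : Measure (Fin d → ℝ)).restrict (Icc 0 1) =
    Measure.pi fun _ => (volume : Measure ℝ).restrict (Icc 0 1) := by
  have : Icc (0 : Fin d → ℝ) 1 = Set.pi univ fun _ => Icc (0 : ℝ) 1 := by
    rw [← Set.pi_univ_Icc]; rfl
  rw [this, volume_pi, Measure.restrict_pi_pi]

instance isProbabilityMeasure_restrict_Icc :
    IsProbabilityMeasure ((volume : Measure ℝ).restrict (Icc 0 1)) :=
  ⟨by simp⟩

instance isProbabilityMeasure_restrict_cube (d : ℕ) :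
    IsProbabilityMeasure ((volume : Measure (Fin d → ℝ)).restrict (Icc 0 1)) := by
  rw [volume_restrict_cube]; infer_instance

theorem setIntegral_cube_prod {d : ℕ} (f : Fin d → ℝ → ℝ) :
    ∫ x in Icc (0 : Fin d → ℝ) 1, ∏ i, f i (x i) = ∏ i, ∫ t in Icc (0 : ℝ) 1, f i t := by
  rw [volume_restrict_cube]
  exact integral_fintype_prod_eq_prod (f := f)

theorem apply_mem_Icc_of_mem_cube {d : ℕ} {x : Fin d → ℝ} (hx : x ∈ Icc (0 : Fin d → ℝ) 1)
    (i : Fin d) : x i ∈ Icc (0 : ℝ) 1 :=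
  ⟨hx.1 i, hx.2 i⟩

theorem integrableOn_cube {d : ℕ} {h : (Fin d → ℝ) → ℝ} (hh : ContinuousOn h (Icc 0 1)) :
    IntegrableOn h (Icc 0 1) :=
  hh.integrableOn_compact isCompact_Icc

theorem integrableOn_cube_mul {d : ℕ} {g h : (Fin d → ℝ) → ℝ} (hg : ContinuousOn g (Icc 0 1))
    (hh : ContinuousOn h (Icc 0 1)) : IntegrableOn (fun x => g x * h x) (Icc 0 1) :=
  integrableOn_cube (hg.mul hh)

namespace CDVBasis

variable {S : ℕ} (W : CDVBasis S) {d : ℕ}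

theorem Psi_eq_prod_basis (ι : Fin d → Fin 2) (l : ℕ) (m : Fin d → Fin (2 ^ l)) (x : Fin d → ℝ) :
    W.Psi ι l m x = ∏ i, W.basis (ι i) l (m i) (x i) := rfl

theorem Psi_zero (l : ℕ) (m : Fin d → Fin (2 ^ l)) : W.Psi 0 l m = W.Phi l m := by
  ext x; simp [Psi, Phi]

theorem kernel_comm (l : ℕ) (x y : Fin d → ℝ) : W.kernel l x y = W.kernel l y x := by
  simp only [kernel, mul_comm]

theorem kernel_self_nonneg (l : ℕ) (x : Fin d → ℝ) : 0 ≤ W.kernel l x x :=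
  Finset.sum_nonneg fun _ _ => mul_self_nonneg _

theorem kernel_eq_prod (l : ℕ) (x y : Fin d → ℝ) :
    W.kernel l x y = ∏ i, ∑ m, W.scaling l m (x i) * W.scaling l m (y i) := by
  rw [Finset.prod_univ_sum, Fintype.piFinset_univ]
  simp only [kernel, Phi, Finset.prod_mul_distrib]

/-- `K_{l+1} = ∑_ι ∑_m Ψ^ι_{lm} Ψ^ι_{lm}` on the cube, where `ι = 0` gives `K_l`. -/
theorem sum_Psi_mul_Psi {l : ℕ} (hl : W.J₀ ≤ l) {x y : Fin d → ℝ} (hx : x ∈ Icc (0 : Fin d → ℝ) 1)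
    (hy : y ∈ Icc (0 : Fin d → ℝ) 1) :
    W.kernel (l + 1) x y = ∑ ι : Fin d → Fin 2, ∑ m, W.Psi ι l m x * W.Psi ι l m y := by
  rw [kernel_eq_prod]
  simp_rw [fun i => (sum_basis_mul_basis_eq hl (apply_mem_Icc_of_mem_cube hx i)
    (apply_mem_Icc_of_mem_cube hy i)).symm]
  rw [Finset.prod_univ_sum, Fintype.piFinset_univ]
  refine Finset.sum_congr rfl fun ι _ => ?_
  rw [Finset.prod_univ_sum, Fintype.piFinset_univ]
  refine Finset.sum_congr rfl fun m _ => ?_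
  rw [Psi_eq_prod_basis, Psi_eq_prod_basis, Finset.prod_mul_distrib]

/-- The projection kernels are bounded by a multiple of the resolution, and their integrals in one
variable are bounded. In dimension one this is the localization of the scaling functions; the kernels
on the cube are products. -/
theorem exists_kernel_bound (d : ℕ) : ∃ C : ℝ, 1 ≤ C ∧ ∀ l, W.J₀ ≤ l →
    ∀ x ∈ Icc (0 : Fin d → ℝ) 1, (∀ y ∈ Icc (0 : Fin d → ℝ) 1,
      |W.kernel l x y| ≤ C * resolution d l) ∧
      ∫ y in Icc (0 : Fin d → ℝ) 1, |W.kernel l x y| ≤ C := by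
  obtain ⟨C₁, hC₁, h₁⟩ := W.exists_sum_abs_basis_le
  obtain ⟨C₂, hC₂, h₂⟩ := W.exists_integral_abs_scaling_le
  have h₁' : ∀ l, W.J₀ ≤ l → ∀ x ∈ Icc (0 : ℝ) 1,
      ∑ m, |W.scaling l m x| ≤ C₁ * 2 ^ ((l : ℝ) / 2) := fun l hl x hx => by
    have := h₁ 0 l hl x hx
    simpa only [basis_zero] using this
  set C := max 1 (max (C₁ * C₁) (C₁ * C₂)) with hC
  have hC1 : 1 ≤ C := le_max_left _ _
  refine ⟨C ^ d, one_le_pow₀ hC1, fun l hl x hx => ⟨fun y hy => ?_, ?_⟩⟩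
  · rw [kernel_eq_prod, Finset.abs_prod, resolution, pow_mul, ← mul_pow]
    have : ∀ i : Fin d, |∑ m, W.scaling l m (x i) * W.scaling l m (y i)| ≤ C * 2 ^ l := by
      intro i
      have hxi := h₁' l hl _ (apply_mem_Icc_of_mem_cube hx i)
      have hyi := h₁' l hl _ (apply_mem_Icc_of_mem_cube hy i)
      have hr : (0 : ℝ) < 2 ^ ((l : ℝ) / 2) := by positivity
      calc |∑ m, W.scaling l m (x i) * W.scaling l m (y i)|
          ≤ ∑ m, |W.scaling l m (x i)| * |W.scaling l m (y i)| := by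
            refine (Finset.abs_sum_le_sum_abs _ _).trans (le_of_eq ?_)
            simp only [abs_mul]
        _ ≤ ∑ m, |W.scaling l m (x i)| * (C₁ * 2 ^ ((l : ℝ) / 2)) := by
            refine Finset.sum_le_sum fun m _ => mul_le_mul_of_nonneg_left ?_ (abs_nonneg _)
            exact (Finset.single_le_sum (f := fun m => |W.scaling l m (y i)|)
              (fun _ _ => abs_nonneg _) (Finset.mem_univ m)).trans hyi
        _ ≤ (C₁ * 2 ^ ((l : ℝ) / 2)) * (C₁ * 2 ^ ((l : ℝ) / 2)) := by
            rw [← Finset.sum_mul]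
            exact mul_le_mul_of_nonneg_right hxi (by positivity)
        _ = C₁ * C₁ * 2 ^ l := by rw [← two_rpow_half_mul_self]; ring
        _ ≤ C * 2 ^ l := by
            gcongr; exact (le_max_left _ _).trans (le_max_right _ _)
    calc ∏ i : Fin d, |∑ m, W.scaling l m (x i) * W.scaling l m (y i)|
        ≤ ∏ _i : Fin d, (C * 2 ^ l) :=
          Finset.prod_le_prod (fun _ _ => abs_nonneg _) fun i _ => this i
      _ = _ := by simp
  · simp_rw [kernel_eq_prod, Finset.abs_prod]
    rw [setIntegral_cube_prod fun i t => |∑ m, W.scaling l m (x i) * W.scaling l m t|]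
    have : ∀ i : Fin d, ∫ t in Icc (0 : ℝ) 1, |∑ m, W.scaling l m (x i) * W.scaling l m t| ≤ C := by
      intro i
      have hxi := h₁' l hl _ (apply_mem_Icc_of_mem_cube hx i)
      have hr : (0 : ℝ) < 2 ^ ((l : ℝ) / 2) := by positivity
      have hcont : ∀ m, IntegrableOn (fun t => |W.scaling l m t|) (Icc 0 1) := fun m => by
        have := continuousOn_basis (W := W) hl 0 m
        rw [basis_zero] at this
        exact this.abs.integrableOn_Icc
      calc ∫ t in Icc (0 : ℝ) 1, |∑ m, W.scaling l m (x i) * W.scaling l m t|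
          ≤ ∫ t in Icc (0 : ℝ) 1, ∑ m, |W.scaling l m (x i)| * |W.scaling l m t| := by
            refine integral_mono_of_nonneg (Eventually.of_forall fun _ => abs_nonneg _) ?_
              (Eventually.of_forall fun t => ?_)
            · exact integrable_finsetSum _ fun m _ => (hcont m).const_mul _
            · refine (Finset.abs_sum_le_sum_abs _ _).trans (le_of_eq ?_)
              simp only [abs_mul]
        _ = ∑ m, |W.scaling l m (x i)| * ∫ t in Icc (0 : ℝ) 1, |W.scaling l m t| := by
            rw [integral_finsetSum _ fun m _ => (hcont m).const_mul _]
            simp_rw [integral_const_mul]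
        _ ≤ ∑ m, |W.scaling l m (x i)| * (C₂ / 2 ^ ((l : ℝ) / 2)) := by
            refine Finset.sum_le_sum fun m _ => mul_le_mul_of_nonneg_left ?_ (abs_nonneg _)
            rw [le_div_iff₀ hr, mul_comm]; exact h₂ l hl m
        _ ≤ (C₁ * 2 ^ ((l : ℝ) / 2)) * (C₂ / 2 ^ ((l : ℝ) / 2)) := by
            rw [← Finset.sum_mul]
            exact mul_le_mul_of_nonneg_right hxi (by positivity)
        _ = C₁ * C₂ := by field_simp
        _ ≤ C := (le_max_right _ _).trans (le_max_right _ _)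
    calc ∏ i : Fin d, ∫ t in Icc (0 : ℝ) 1, |∑ m, W.scaling l m (x i) * W.scaling l m t|
        ≤ ∏ _i : Fin d, C := Finset.prod_le_prod
          (fun _ _ => integral_nonneg fun _ => abs_nonneg _) fun i _ => this i
      _ = _ := by simp

/-- The projection kernel of level `l` lives within `O(2 ^ (-l))` of the diagonal. -/
theorem exists_kernel_localized (d : ℕ) : ∃ R : ℝ, 0 ≤ R ∧ ∀ l, W.J₀ ≤ l →
    ∀ x ∈ Icc (0 : Fin d → ℝ) 1, ∀ y ∈ Icc (0 : Fin d → ℝ) 1, W.kernel l x y ≠ 0 →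
      dist x y ≤ R / 2 ^ l := by
  obtain ⟨B, R, hB, hR, h⟩ := W.exists_basis_bound
  refine ⟨2 * R, by positivity, fun l hl x hx y hy hne => ?_⟩
  have h2 : (0 : ℝ) < 2 ^ l := by positivity
  rw [kernel_eq_prod, Finset.prod_ne_zero_iff] at hne
  refine (dist_pi_le_iff (by positivity)).2 fun i => ?_
  obtain ⟨m, -, hm⟩ := Finset.exists_ne_zero_of_sum_ne_zero (hne i (Finset.mem_univ i))
  have e1 := (h 0 l hl m _ (apply_mem_Icc_of_mem_cube hx i)).2
  have e2 := (h 0 l hl m _ (apply_mem_Icc_of_mem_cube hy i)).2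
  rw [basis_zero] at e1 e2
  have e1 := abs_le.1 (e1 (left_ne_zero_of_mul hm))
  have e2 := abs_le.1 (e2 (right_ne_zero_of_mul hm))
  rw [Real.dist_eq, le_div_iff₀ h2]
  conv_lhs => rw [← abs_of_pos h2]
  rw [← abs_mul, abs_le]
  constructor <;> nlinarith

variable {W}

theorem continuousOn_Psi {l : ℕ} (hl : W.J₀ ≤ l) (ι : Fin d → Fin 2) (m : Fin d → Fin (2 ^ l)) :
    ContinuousOn (W.Psi ι l m) (Icc 0 1) := by
  refine continuousOn_finsetProd _ fun i _ => ?_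
  exact (continuousOn_basis hl (ι i) (m i)).comp (continuous_apply i).continuousOn
    fun x hx => apply_mem_Icc_of_mem_cube hx i

theorem continuousOn_Phi {l : ℕ} (hl : W.J₀ ≤ l) (m : Fin d → Fin (2 ^ l)) :
    ContinuousOn (W.Phi l m) (Icc 0 1) :=
  W.Psi_zero l m ▸ continuousOn_Psi hl 0 m

theorem continuousOn_kernel {l : ℕ} (hl : W.J₀ ≤ l) (x : Fin d → ℝ) :
    ContinuousOn (W.kernel l x) (Icc 0 1) :=
  continuousOn_finsetSum _ fun m _ => continuousOn_const.mul (continuousOn_Phi hl m)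

theorem continuousOn_kernel_self {l : ℕ} (hl : W.J₀ ≤ l) :
    ContinuousOn (fun x : Fin d → ℝ => W.kernel l x x) (Icc 0 1) :=
  continuousOn_finsetSum _ fun m _ => (continuousOn_Phi hl m).mul (continuousOn_Phi hl m)

theorem integral_Psi_mul_Psi {l : ℕ} (hl : W.J₀ ≤ l) (ι ι' : Fin d → Fin 2)
    (m m' : Fin d → Fin (2 ^ l)) :
    ∫ x in Icc (0 : Fin d → ℝ) 1, W.Psi ι l m x * W.Psi ι' l m' x =
      if ι = ι' ∧ m = m' then 1 else 0 := by
  simp_rw [Psi_eq_prod_basis, ← Finset.prod_mul_distrib]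
  rw [setIntegral_cube_prod fun i t => W.basis (ι i) l (m i) t * W.basis (ι' i) l (m' i) t]
  simp_rw [fun i => integral_basis_mul_basis hl (ι i, m i) (ι' i, m' i)]
  rw [Finset.prod_ite_zero]
  simp only [Finset.mem_univ, true_imp_iff, Prod.mk.injEq, Finset.prod_const_one, forall_and,
    funext_iff]

theorem integral_Phi_mul_Phi {l : ℕ} (hl : W.J₀ ≤ l) (m m' : Fin d → Fin (2 ^ l)) :
    ∫ x in Icc (0 : Fin d → ℝ) 1, W.Phi l m x * W.Phi l m' x = if m = m' then 1 else 0 := by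
  have := integral_Psi_mul_Psi hl 0 0 m m'
  simpa [Psi_zero] using this

theorem integral_kernel_self {l : ℕ} (hl : W.J₀ ≤ l) :
    ∫ x in Icc (0 : Fin d → ℝ) 1, W.kernel l x x = resolution d l := by
  simp only [kernel]
  rw [integral_finsetSum _ fun m _ =>
    integrableOn_cube_mul (continuousOn_Phi hl m) (continuousOn_Phi hl m)]
  simp_rw [integral_Phi_mul_Phi hl]
  simp [resolution, pow_mul]

variable (W) in
/-- The orthogonal projection of `h` onto the span `V_k` of the scaling functions of level `l`. -/
noncomputable def proj (l : ℕ) (h : (Fin d → ℝ) → ℝ) (x : Fin d → ℝ) : ℝ :=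
  ∫ y in Icc (0 : Fin d → ℝ) 1, W.kernel l x y * h y

theorem proj_eq_sum {l : ℕ} (hl : W.J₀ ≤ l) {h : (Fin d → ℝ) → ℝ} (hh : ContinuousOn h (Icc 0 1))
    (x : Fin d → ℝ) :
    W.proj l h x = ∑ m, (∫ y in Icc (0 : Fin d → ℝ) 1, h y * W.Phi l m y) * W.Phi l m x := by
  simp only [proj, kernel, Finset.sum_mul]
  have e : ∀ m y, W.Phi l m x * W.Phi l m y * h y = W.Phi l m x * (h y * W.Phi l m y) :=
    fun m y => by ring
  simp_rw [e]
  rw [integral_finsetSum _ fun m _ =>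
    (integrableOn_cube_mul hh (continuousOn_Phi hl m)).const_mul _]
  refine Finset.sum_congr rfl fun m _ => ?_
  rw [integral_const_mul, mul_comm]

theorem continuousOn_proj {l : ℕ} (hl : W.J₀ ≤ l) {h : (Fin d → ℝ) → ℝ}
    (hh : ContinuousOn h (Icc 0 1)) : ContinuousOn (W.proj l h) (Icc 0 1) := by
  have : W.proj l h = fun x =>
      ∑ m, (∫ y in Icc (0 : Fin d → ℝ) 1, h y * W.Phi l m y) * W.Phi l m x :=
    funext fun x => proj_eq_sum hl hh x
  rw [this]
  exact continuousOn_finsetSum _ fun m _ => continuousOn_const.mul (continuousOn_Phi hl m)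

theorem proj_sum {l : ℕ} (hl : W.J₀ ≤ l) {κ : Type*} (s : Finset κ) (c : κ → ℝ)
    {h : κ → (Fin d → ℝ) → ℝ} (hh : ∀ a, ContinuousOn (h a) (Icc 0 1)) (x : Fin d → ℝ) :
    W.proj l (fun y => ∑ a ∈ s, c a * h a y) x = ∑ a ∈ s, c a * W.proj l (h a) x := by
  simp only [proj, Finset.mul_sum]
  have e : ∀ a y, W.kernel l x y * (c a * h a y) = c a * (W.kernel l x y * h a y) :=
    fun a y => by ring
  simp_rw [e]
  rw [integral_finsetSum _ fun a _ =>
    (integrableOn_cube_mul (continuousOn_kernel hl x) (hh a)).const_mul _]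
  simp_rw [integral_const_mul]

theorem proj_congr {l : ℕ} {h h' : (Fin d → ℝ) → ℝ} (e : EqOn h h' (Icc 0 1)) (x : Fin d → ℝ) :
    W.proj l h x = W.proj l h' x :=
  setIntegral_congr_fun measurableSet_Icc fun y hy => by rw [e hy]

/-- The functions of level `l` are reproduced by the projection of level `l + 1`. -/
theorem proj_succ_Psi {l : ℕ} (hl : W.J₀ ≤ l) (ι : Fin d → Fin 2) (m : Fin d → Fin (2 ^ l)) :
    EqOn (W.proj (l + 1) (W.Psi ι l m)) (W.Psi ι l m) (Icc 0 1) := by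
  intro x hx
  have h1 : W.proj (l + 1) (W.Psi ι l m) x = ∫ y in Icc (0 : Fin d → ℝ) 1,
      ∑ ι' : Fin d → Fin 2, ∑ m', W.Psi ι' l m' x * (W.Psi ι' l m' y * W.Psi ι l m y) := by
    refine setIntegral_congr_fun measurableSet_Icc fun y hy => ?_
    rw [W.sum_Psi_mul_Psi hl hx hy, Finset.sum_mul]
    refine Finset.sum_congr rfl fun ι' _ => ?_
    rw [Finset.sum_mul]
    exact Finset.sum_congr rfl fun m' _ => mul_assoc _ _ _
  have hi : ∀ (ι' : Fin d → Fin 2) m', IntegrableOn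
      (fun y => W.Psi ι' l m' x * (W.Psi ι' l m' y * W.Psi ι l m y)) (Icc 0 1) := fun ι' m' =>
    (integrableOn_cube_mul (continuousOn_Psi hl ι' m') (continuousOn_Psi hl ι m)).const_mul _
  rw [h1, integral_finsetSum _ fun ι' _ => integrable_finsetSum _ fun m' _ => hi ι' m']
  simp_rw [fun ι' => integral_finsetSum Finset.univ fun m' _ => hi ι' m', integral_const_mul,
    integral_Psi_mul_Psi hl]
  rw [Finset.sum_eq_single ι]
  · simp
  · intro ι' _ hι'; simp [hι']
  · simp

theorem proj_eqOn_succ {l : ℕ} (hl : W.J₀ ≤ l) {h : (Fin d → ℝ) → ℝ}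
    (hh : ContinuousOn h (Icc 0 1)) (hr : EqOn (W.proj l h) h (Icc 0 1)) :
    EqOn (W.proj (l + 1) h) h (Icc 0 1) := by
  intro x hx
  have e : EqOn h (fun x => ∑ m, (∫ y in Icc (0 : Fin d → ℝ) 1, h y * W.Phi l m y) *
      W.Phi l m x) (Icc 0 1) := fun x hx => by rw [← hr hx, proj_eq_sum hl hh]
  rw [proj_congr e, proj_sum (hl.trans (Nat.le_succ l)) _ _ fun m => continuousOn_Phi hl m, e hx]
  refine Finset.sum_congr rfl fun m _ => ?_
  rw [← Psi_zero, proj_succ_Psi hl 0 m hx]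

theorem proj_eqOn_mono {l l' : ℕ} (hl : W.J₀ ≤ l) (hll' : l ≤ l') {h : (Fin d → ℝ) → ℝ}
    (hh : ContinuousOn h (Icc 0 1)) (hr : EqOn (W.proj l h) h (Icc 0 1)) :
    EqOn (W.proj l' h) h (Icc 0 1) := by
  induction l', hll' using Nat.le_induction with
  | base => exact hr
  | succ k hk ih => exact proj_eqOn_succ (hl.trans hk) hh ih

theorem proj_Phi {l : ℕ} (hl : W.J₀ ≤ l) (m : Fin d → Fin (2 ^ l)) (x : Fin d → ℝ) :
    W.proj l (W.Phi l m) x = W.Phi l m x := by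
  rw [proj_eq_sum hl (continuousOn_Phi hl m)]
  simp_rw [integral_Phi_mul_Phi hl]
  simp

/-- The scaling functions span the constants. -/
theorem proj_const (hS : 0 < S) {l : ℕ} (hl : W.J₀ ≤ l) (c : ℝ) :
    EqOn (W.proj l fun _ : Fin d → ℝ => c) (fun _ => c) (Icc 0 1) := by
  intro x hx
  obtain ⟨a, ha⟩ := W.polynomial l hl (Polynomial.C 1)
    (lt_of_le_of_lt Polynomial.degree_C_le (by exact_mod_cast hS))
  simp only [Polynomial.eval_C] at ha
  have hone : ∀ t ∈ Icc (0 : ℝ) 1,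
      ∫ s in Icc (0 : ℝ) 1, ∑ m, W.scaling l m t * W.scaling l m s = 1 := by
    intro t ht
    have hi : ∀ m r, IntegrableOn (fun s => W.scaling l m s * W.scaling l r s) (Icc 0 1) :=
      fun m r => by
        have := integrableOn_basis_mul hl hl 0 0 m r
        simpa only [basis_zero] using this
    have ho : ∀ m r, ∫ s in Icc (0 : ℝ) 1, W.scaling l m s * W.scaling l r s =
        if m = r then 1 else 0 := fun m r => W.orthonormal_φ l hl m r
    have h1 : ∫ s in Icc (0 : ℝ) 1, ∑ m, W.scaling l m t * W.scaling l m s =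
        ∫ s in Icc (0 : ℝ) 1, ∑ m, ∑ r,
          (W.scaling l m t * a r) * (W.scaling l m s * W.scaling l r s) := by
      refine setIntegral_congr_fun measurableSet_Icc fun s hs => ?_
      refine Finset.sum_congr rfl fun m _ => ?_
      calc W.scaling l m t * W.scaling l m s
          = W.scaling l m t * W.scaling l m s * 1 := (mul_one _).symm
        _ = W.scaling l m t * W.scaling l m s * ∑ r, a r * W.scaling l r s := by rw [ha s hs]; rfl
        _ = _ := by
          rw [Finset.mul_sum]
          exact Finset.sum_congr rfl fun r _ => by ring
    rw [h1, integral_finsetSum _ fun m _ => integrable_finsetSum _ fun r _ =>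
      (hi m r).const_mul _]
    simp_rw [fun m => integral_finsetSum Finset.univ fun r _ =>
      (hi m r).const_mul (W.scaling l m t * a r), integral_const_mul, ho]
    simp only [mul_ite, mul_one, mul_zero, Finset.sum_ite_eq, Finset.mem_univ, if_true]
    rw [ha t ht]
    exact Finset.sum_congr rfl fun m _ => mul_comm _ _
  simp only [proj]
  rw [integral_mul_const]
  simp_rw [kernel_eq_prod]
  rw [setIntegral_cube_prod fun i s => ∑ m, W.scaling l m (x i) * W.scaling l m s]
  simp_rw [fun i => hone (x i) (apply_mem_Icc_of_mem_cube hx i)]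
  simp

theorem integral_kernel_mul_kernel_of_le {l₁ l₂ : ℕ} (hl₁ : W.J₀ ≤ l₁) (h : l₁ ≤ l₂)
    (x : Fin d → ℝ) {y : Fin d → ℝ} (hy : y ∈ Icc (0 : Fin d → ℝ) 1) :
    ∫ z in Icc (0 : Fin d → ℝ) 1, W.kernel l₁ x z * W.kernel l₂ y z = W.kernel l₁ x y := by
  have h2 := proj_sum (W := W) (hl₁.trans h) Finset.univ (fun m => W.Phi l₁ m x)
    (fun m => continuousOn_Phi hl₁ m) y
  have h3 : W.proj l₂ (fun z => ∑ m, W.Phi l₁ m x * W.Phi l₁ m z) y =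
      ∫ z in Icc (0 : Fin d → ℝ) 1, W.kernel l₁ x z * W.kernel l₂ y z :=
    setIntegral_congr_fun measurableSet_Icc fun z _ => mul_comm _ _
  rw [← h3, h2]
  refine Finset.sum_congr rfl fun m _ => ?_
  rw [proj_eqOn_mono hl₁ h (continuousOn_Phi hl₁ m) (fun x _ => proj_Phi hl₁ m x) hy]

/-- As the projection spaces are nested, the kernels compose to the coarser one. -/
theorem integral_kernel_mul_kernel {l₁ l₂ : ℕ} (hl₁ : W.J₀ ≤ l₁) (hl₂ : W.J₀ ≤ l₂)
    {x y : Fin d → ℝ} (hx : x ∈ Icc (0 : Fin d → ℝ) 1) (hy : y ∈ Icc (0 : Fin d → ℝ) 1) :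
    ∫ z in Icc (0 : Fin d → ℝ) 1, W.kernel l₁ x z * W.kernel l₂ y z =
      W.kernel (min l₁ l₂) x y := by
  rcases le_total l₁ l₂ with h | h
  · rw [min_eq_left h, integral_kernel_mul_kernel_of_le hl₁ h x hy]
  · rw [min_eq_right h, W.kernel_comm, ← integral_kernel_mul_kernel_of_le hl₂ h y hx]
    simp only [mul_comm]

/-- A function in the span of the scaling functions of level `l` is orthogonal to the wavelets of
that level. -/
theorem integral_mul_Psi_eq_zero {l : ℕ} (hl : W.J₀ ≤ l) {h : (Fin d → ℝ) → ℝ}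
    (hh : ContinuousOn h (Icc 0 1)) (hr : EqOn (W.proj l h) h (Icc 0 1)) {ι : Fin d → Fin 2}
    (hι : ι ≠ 0) (m : Fin d → Fin (2 ^ l)) :
    ∫ x in Icc (0 : Fin d → ℝ) 1, h x * W.Psi ι l m x = 0 := by
  have h1 : ∫ x in Icc (0 : Fin d → ℝ) 1, h x * W.Psi ι l m x = ∫ x in Icc (0 : Fin d → ℝ) 1,
      ∑ m', (∫ y in Icc (0 : Fin d → ℝ) 1, h y * W.Phi l m' y) *
        (W.Psi 0 l m' x * W.Psi ι l m x) := by
    refine setIntegral_congr_fun measurableSet_Icc fun x hx => ?_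
    rw [← hr hx, proj_eq_sum hl hh, Finset.sum_mul]
    exact Finset.sum_congr rfl fun m' _ => by rw [Psi_zero]; ring
  rw [h1, integral_finsetSum _ fun m' _ =>
    (integrableOn_cube_mul (continuousOn_Psi hl 0 m') (continuousOn_Psi hl ι m)).const_mul _]
  refine Finset.sum_eq_zero fun m' _ => ?_
  rw [integral_const_mul, integral_Psi_mul_Psi hl, if_neg (fun e => hι e.1.symm), mul_zero]

/-- Wavelets of different levels are orthogonal. -/
theorem integral_Psi_mul_Psi_of_lt {l l' : ℕ} (hl : W.J₀ ≤ l) (h : l < l') (ι : Fin d → Fin 2)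
    (m : Fin d → Fin (2 ^ l)) {ι' : Fin d → Fin 2} (hι' : ι' ≠ 0) (m' : Fin d → Fin (2 ^ l')) :
    ∫ x in Icc (0 : Fin d → ℝ) 1, W.Psi ι l m x * W.Psi ι' l' m' x = 0 :=
  integral_mul_Psi_eq_zero (hl.trans h.le) (continuousOn_Psi hl ι m)
    (proj_eqOn_mono (hl.trans (Nat.le_succ l)) h (continuousOn_Psi hl ι m) (proj_succ_Psi hl ι m))
    hι' m'

end CDVBasis

/-! ### Approximation on Hölder balls -/

namespace CDVBasis

variable {S : ℕ} {W : CDVBasis S} {d : ℕ}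

variable (W) in
/-- The inner product `⟨Π_l p, Π_l b⟩ = ∑_m ⟨p, Φ_{lm}⟩ ⟨b, Φ_{lm}⟩` of the projections of `p`
and `b` at level `l`. -/
noncomputable def projInner (l : ℕ) (p b : (Fin d → ℝ) → ℝ) : ℝ :=
  ∑ m, (∫ x in Icc (0 : Fin d → ℝ) 1, p x * W.Phi l m x) *
    ∫ x in Icc (0 : Fin d → ℝ) 1, b x * W.Phi l m x

theorem projInner_comm (l : ℕ) (p b : (Fin d → ℝ) → ℝ) :
    W.projInner l p b = W.projInner l b p := by
  simp only [projInner, mul_comm]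

variable {p b : (Fin d → ℝ) → ℝ}

theorem integral_proj_mul {l : ℕ} (hl : W.J₀ ≤ l) (hp : ContinuousOn p (Icc 0 1))
    (hb : ContinuousOn b (Icc 0 1)) :
    ∫ x in Icc (0 : Fin d → ℝ) 1, W.proj l p x * b x = W.projInner l p b := by
  simp_rw [proj_eq_sum hl hp, Finset.sum_mul, mul_assoc]
  rw [integral_finsetSum _ fun m _ =>
    (integrableOn_cube_mul (continuousOn_Phi hl m) hb).const_mul _]
  simp_rw [integral_const_mul, projInner, mul_comm (W.Phi l _ _)]

theorem integral_proj_mul_proj_of_le {l₁ l₂ : ℕ} (hl₁ : W.J₀ ≤ l₁) (h : l₁ ≤ l₂)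
    (hp : ContinuousOn p (Icc 0 1)) (hb : ContinuousOn b (Icc 0 1)) :
    ∫ x in Icc (0 : Fin d → ℝ) 1, W.proj l₁ p x * W.proj l₂ b x = W.projInner l₁ p b := by
  have hl₂ := hl₁.trans h
  have hr : EqOn (W.proj l₁ (W.proj l₁ p)) (W.proj l₁ p) (Icc 0 1) := by
    intro x hx
    have e : EqOn (W.proj l₁ p) (fun x => ∑ m, (∫ y in Icc (0 : Fin d → ℝ) 1, p y * W.Phi l₁ m y) *
        W.Phi l₁ m x) (Icc 0 1) := fun x _ => proj_eq_sum hl₁ hp x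
    rw [proj_congr e, proj_sum hl₁ _ _ fun m => continuousOn_Phi hl₁ m, e hx]
    exact Finset.sum_congr rfl fun m _ => by rw [proj_Phi hl₁]
  have hr₂ := proj_eqOn_mono hl₁ h (continuousOn_proj hl₁ hp) hr
  simp_rw [mul_comm (W.proj l₁ p _)]
  rw [integral_proj_mul hl₂ hb (continuousOn_proj hl₁ hp), projInner_comm,
    ← integral_proj_mul hl₂ (continuousOn_proj hl₁ hp) hb, ← integral_proj_mul hl₁ hp hb]
  exact setIntegral_congr_fun measurableSet_Icc fun x hx => by rw [hr₂ hx]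

theorem integral_proj_mul_proj {l₁ l₂ : ℕ} (hl₁ : W.J₀ ≤ l₁) (hl₂ : W.J₀ ≤ l₂)
    (hp : ContinuousOn p (Icc 0 1)) (hb : ContinuousOn b (Icc 0 1)) :
    ∫ x in Icc (0 : Fin d → ℝ) 1, W.proj l₁ p x * W.proj l₂ b x =
      W.projInner (min l₁ l₂) p b := by
  rcases le_total l₁ l₂ with h | h
  · rw [min_eq_left h, integral_proj_mul_proj_of_le hl₁ h hp hb]
  · rw [min_eq_right h, projInner_comm, ← integral_proj_mul_proj_of_le hl₂ h hb hp]
    simp only [mul_comm]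

/-- The coefficients of level `l + 1` are those of level `l` plus the wavelet coefficients. -/
theorem projInner_succ {l : ℕ} (hl : W.J₀ ≤ l) (hp : ContinuousOn p (Icc 0 1))
    (hb : ContinuousOn b (Icc 0 1)) :
    W.projInner (l + 1) p b = W.projInner l p b +
      ∑ ι ∈ Finset.univ.erase (0 : Fin d → Fin 2), ∑ m,
        (∫ x in Icc (0 : Fin d → ℝ) 1, p x * W.Psi ι l m x) *
          ∫ x in Icc (0 : Fin d → ℝ) 1, b x * W.Psi ι l m x := by
  have hi : ∀ ι m, IntegrableOn (fun y => p y * W.Psi ι l m y) (Icc (0 : Fin d → ℝ) 1) :=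
    fun ι m => integrableOn_cube_mul hp (continuousOn_Psi hl ι m)
  have hi' : ∀ ι m, IntegrableOn (fun y => b y * W.Psi ι l m y) (Icc (0 : Fin d → ℝ) 1) :=
    fun ι m => integrableOn_cube_mul hb (continuousOn_Psi hl ι m)
  have h1 : ∀ x ∈ Icc (0 : Fin d → ℝ) 1, W.proj (l + 1) p x =
      ∑ ι, ∑ m, (∫ y in Icc (0 : Fin d → ℝ) 1, p y * W.Psi ι l m y) * W.Psi ι l m x := by
    intro x hx
    have : W.proj (l + 1) p x = ∫ y in Icc (0 : Fin d → ℝ) 1,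
        ∑ ι, ∑ m, W.Psi ι l m x * (p y * W.Psi ι l m y) := by
      refine setIntegral_congr_fun measurableSet_Icc fun y hy => ?_
      rw [W.sum_Psi_mul_Psi hl hx hy, Finset.sum_mul]
      refine Finset.sum_congr rfl fun ι _ => ?_
      rw [Finset.sum_mul]
      exact Finset.sum_congr rfl fun m _ => by ring
    rw [this, integral_finsetSum _ fun ι _ => integrable_finsetSum _ fun m _ =>
      (hi ι m).const_mul _]
    refine Finset.sum_congr rfl fun ι _ => ?_
    rw [integral_finsetSum _ fun m _ => (hi ι m).const_mul _]
    refine Finset.sum_congr rfl fun m _ => ?_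
    rw [integral_const_mul, mul_comm]
  have h2 : W.projInner (l + 1) p b = ∑ ι : Fin d → Fin 2, ∑ m,
        (∫ x in Icc (0 : Fin d → ℝ) 1, p x * W.Psi ι l m x) *
          ∫ x in Icc (0 : Fin d → ℝ) 1, b x * W.Psi ι l m x := by
    rw [← integral_proj_mul (hl.trans (Nat.le_succ l)) hp hb]
    have : ∫ x in Icc (0 : Fin d → ℝ) 1, W.proj (l + 1) p x * b x =
        ∫ x in Icc (0 : Fin d → ℝ) 1, ∑ ι, ∑ m,
          (∫ y in Icc (0 : Fin d → ℝ) 1, p y * W.Psi ι l m y) * (b x * W.Psi ι l m x) := by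
      refine setIntegral_congr_fun measurableSet_Icc fun x hx => ?_
      rw [h1 x hx, Finset.sum_mul]
      refine Finset.sum_congr rfl fun ι _ => ?_
      rw [Finset.sum_mul]
      exact Finset.sum_congr rfl fun m _ => by ring
    rw [this, integral_finsetSum _ fun ι _ => integrable_finsetSum _ fun m _ =>
      (hi' ι m).const_mul _]
    refine Finset.sum_congr rfl fun ι _ => ?_
    rw [integral_finsetSum _ fun m _ => (hi' ι m).const_mul _]
    exact Finset.sum_congr rfl fun m _ => integral_const_mul _ _
  rw [h2, ← Finset.add_sum_erase _ _ (Finset.mem_univ 0)]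
  simp only [Psi_zero, projInner]

/-- The projections of a continuous function converge to it uniformly: the kernels reproduce
constants, are bounded in `L¹` and concentrate on the diagonal. -/
theorem tendsto_projInner (hS : 0 < S) (hp : ContinuousOn p (Icc 0 1))
    (hb : ContinuousOn b (Icc 0 1)) :
    Tendsto (fun l => W.projInner l p b) atTop (𝓝 (∫ x in Icc (0 : Fin d → ℝ) 1, p x * b x)) := by
  obtain ⟨C, hC1, hC⟩ := W.exists_kernel_bound d
  obtain ⟨R, hR, hloc⟩ := W.exists_kernel_localized d
  obtain ⟨Bb, hBb⟩ := (isCompact_Icc (a := (0 : Fin d → ℝ)) (b := 1)).exists_bound_of_continuousOn hb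
  have hB0 : 0 ≤ Bb := (norm_nonneg _).trans (hBb 0 ⟨le_rfl, zero_le_one⟩)
  have huc := isCompact_Icc.uniformContinuousOn_of_continuous hp
  rw [Metric.tendsto_atTop]
  intro ε hε
  set η := ε / (C * Bb + 1) with hη
  have hη0 : 0 < η := by positivity
  obtain ⟨δ, hδ, hδp⟩ := Metric.uniformContinuousOn_iff.1 huc η hη0
  have ht : Tendsto (fun l : ℕ => R / (2 : ℝ) ^ l) atTop (𝓝 0) :=
    tendsto_const_nhds.div_atTop (tendsto_pow_atTop_atTop_of_one_lt one_lt_two)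
  obtain ⟨L, hL⟩ := eventually_atTop.1 (ht.eventually (gt_mem_nhds hδ))
  refine ⟨max L W.J₀, fun l hl => ?_⟩
  have hlJ : W.J₀ ≤ l := (le_max_right _ _).trans hl
  have hlL : R / 2 ^ l < δ := hL l ((le_max_left _ _).trans hl)
  have hpt : ∀ x ∈ Icc (0 : Fin d → ℝ) 1, |W.proj l p x - p x| ≤ η * C := by
    intro x hx
    have e : W.proj l p x - p x = ∫ y in Icc (0 : Fin d → ℝ) 1, W.kernel l x y * (p y - p x) := by
      have h1 := proj_const (W := W) hS hlJ (p x) hx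
      simp only at h1
      conv_lhs => rw [← h1]
      simp only [proj]
      rw [← integral_sub (integrableOn_cube_mul (continuousOn_kernel hlJ x) hp)
        (integrableOn_cube_mul (continuousOn_kernel hlJ x) continuousOn_const)]
      simp_rw [mul_sub]
    rw [e]
    calc |∫ y in Icc (0 : Fin d → ℝ) 1, W.kernel l x y * (p y - p x)|
        ≤ ∫ y in Icc (0 : Fin d → ℝ) 1, |W.kernel l x y * (p y - p x)| := abs_integral_le_integral_abs
      _ ≤ ∫ y in Icc (0 : Fin d → ℝ) 1, η * |W.kernel l x y| := by
        refine setIntegral_mono_on ?_ ?_ measurableSet_Icc fun y hy => ?_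
        · exact integrableOn_cube (((continuousOn_kernel hlJ x).mul (hp.sub continuousOn_const)).abs)
        · exact integrableOn_cube (continuousOn_const.mul (continuousOn_kernel hlJ x).abs)
        · rw [abs_mul, mul_comm]
          by_cases hk : W.kernel l x y = 0
          · simp [hk]
          · refine mul_le_mul_of_nonneg_right ?_ (abs_nonneg _)
            have := hδp y hy x hx (by
              rw [dist_comm]; exact lt_of_le_of_lt (hloc l hlJ x hx y hy hk) hlL)
            rw [Real.dist_eq] at this
            exact this.le
      _ ≤ η * C := by
        rw [integral_const_mul]
        exact mul_le_mul_of_nonneg_left (hC l hlJ x hx).2 hη0.le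
  rw [Real.dist_eq, ← integral_proj_mul hlJ hp hb,
    ← integral_sub (integrableOn_cube_mul (continuousOn_proj hlJ hp) hb)
      (integrableOn_cube_mul hp hb)]
  have : ∀ x ∈ Icc (0 : Fin d → ℝ) 1, ‖W.proj l p x * b x - p x * b x‖ ≤ η * C * Bb := by
    intro x hx
    rw [← sub_mul, norm_mul]
    exact mul_le_mul (hpt x hx) (hBb x hx) (norm_nonneg _) (by positivity)
  have h2 := norm_setIntegral_le_of_norm_le_const
    (μ := (volume : Measure (Fin d → ℝ))) (s := Icc 0 1) isCompact_Icc.measure_lt_top this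
  have h3 : (volume : Measure (Fin d → ℝ)).real (Icc 0 1) = 1 := by
    have := (isProbabilityMeasure_restrict_cube d).measure_univ
    rw [Measure.restrict_apply_univ] at this
    simp [Measure.real, this]
  rw [h3, mul_one, Real.norm_eq_abs] at h2
  refine lt_of_le_of_lt h2 ?_
  rw [hη, div_mul_eq_mul_div, div_mul_eq_mul_div, div_lt_iff₀ (by positivity)]
  nlinarith

/-- Decay of the wavelet coefficients in a Hölder ball. -/
theorem abs_integral_mul_Psi_le {s M : ℝ} (hM : 0 ≤ M) {h : (Fin d → ℝ) → ℝ}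
    (hh : h ∈ W.holderBall d s M) {l : ℕ} (hl : W.J₀ ≤ l) {ι : Fin d → Fin 2} (hι : ι ≠ 0)
    (m : Fin d → Fin (2 ^ l)) :
    |∫ x in Icc (0 : Fin d → ℝ) 1, h x * W.Psi ι l m x| ≤
      M * (2 : ℝ) ^ (-((l : ℝ) * (s + d / 2))) := by
  have h1 : ENNReal.ofReal ((2 : ℝ) ^ ((l : ℝ) * (s + (d : ℝ) / 2))) *
        ‖∫ x in Icc (0 : Fin d → ℝ) 1, h x * W.Psi ι l m x‖ₑ ≤ ENNReal.ofReal M := by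
    refine le_trans ?_ hh.2
    refine le_trans ?_ le_add_self
    refine le_trans ?_ (le_iSup₂ (f := fun (l : ℕ) (_ : W.J₀ ≤ l) =>
      ⨆ (m : Fin d → Fin (2 ^ l)) (ι : Fin d → Fin 2) (_ : ι ≠ 0),
      ENNReal.ofReal ((2 : ℝ) ^ ((l : ℝ) * (s + (d : ℝ) / 2))) *
        ‖∫ x in Icc (0 : Fin d → ℝ) 1, h x * W.Psi ι l m x‖ₑ) l hl)
    refine le_trans ?_ (le_iSup _ m)
    exact le_iSup₂ (f := fun (ι : Fin d → Fin 2) (_ : ι ≠ 0) =>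
      ENNReal.ofReal ((2 : ℝ) ^ ((l : ℝ) * (s + (d : ℝ) / 2))) *
        ‖∫ x in Icc (0 : Fin d → ℝ) 1, h x * W.Psi ι l m x‖ₑ) ι hι
  have hr : (0 : ℝ) < (2 : ℝ) ^ ((l : ℝ) * (s + (d : ℝ) / 2)) := by positivity
  rw [Real.enorm_eq_ofReal_abs, ← ENNReal.ofReal_mul hr.le, ENNReal.ofReal_le_ofReal_iff hM] at h1
  rw [Real.rpow_neg (by norm_num), ← div_eq_mul_inv, le_div_iff₀ hr, mul_comm]
  exact h1

theorem card_index (d l : ℕ) : (Fintype.card (Fin d → Fin (2 ^ l)) : ℝ) = resolution d l := by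
  simp [resolution, pow_mul]

theorem resolution_pos (d l : ℕ) : 0 < resolution d l := by unfold resolution; positivity

theorem resolution_rpow (hd : 0 < d) (l : ℕ) (s : ℝ) :
    resolution d l ^ (-s / (d : ℝ)) = ((2 : ℝ) ^ (-s)) ^ l := by
  have : (d : ℝ) ≠ 0 := by positivity
  rw [resolution, ← Real.rpow_natCast, ← Real.rpow_natCast, ← Real.rpow_mul (by norm_num),
    ← Real.rpow_mul (by norm_num)]
  congr 1
  push_cast
  field_simp

theorem two_rpow_mul_resolution (l : ℕ) (s t : ℝ) :
    (2 : ℝ) ^ (-((l : ℝ) * (s + d / 2))) * (2 : ℝ) ^ (-((l : ℝ) * (t + d / 2))) * resolution d l =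
      ((2 : ℝ) ^ (-(s + t))) ^ l := by
  rw [resolution, ← Real.rpow_natCast 2 (l * d), ← Real.rpow_natCast _ l,
    ← Real.rpow_mul (by norm_num), ← Real.rpow_add (by norm_num), ← Real.rpow_add (by norm_num)]
  congr 1
  push_cast
  ring

/-- Approximation error of the projection inner product on Hölder balls. The error telescopes over the
levels, and level `j` contributes `2 ^ (j d)` products of wavelet coefficients, of total order
`2 ^ (-j (α + β))`. -/
theorem abs_integral_sub_projInner_le (hS : 0 < S) {α β M : ℝ} (hα : 0 < α) (hβ : 0 < β)
    (hM : 0 ≤ M) (hp : p ∈ W.holderBall d α M) (hb : b ∈ W.holderBall d β M) {l : ℕ}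
    (hl : W.J₀ ≤ l) :
    |(∫ x in Icc (0 : Fin d → ℝ) 1, p x * b x) - W.projInner l p b| ≤
      2 ^ d * M ^ 2 / (1 - (2 : ℝ) ^ (-(α + β))) * ((2 : ℝ) ^ (-(α + β))) ^ l := by
  set ρ := (2 : ℝ) ^ (-(α + β)) with hρ
  have hρ0 : 0 < ρ := by positivity
  have hρ1 : ρ < 1 := Real.rpow_lt_one_of_one_lt_of_neg (by norm_num) (by linarith)
  set D := (2 : ℝ) ^ d * M ^ 2 with hD
  have hD0 : 0 ≤ D := by positivity
  have step : ∀ j, W.J₀ ≤ j → |W.projInner (j + 1) p b - W.projInner j p b| ≤ D * ρ ^ j := by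
    intro j hj
    rw [projInner_succ hj hp.1 hb.1, add_sub_cancel_left]
    calc _ ≤ ∑ ι ∈ Finset.univ.erase (0 : Fin d → Fin 2), ∑ _m : Fin d → Fin (2 ^ j),
          (M * (2 : ℝ) ^ (-((j : ℝ) * (α + d / 2)))) * (M * (2 : ℝ) ^ (-((j : ℝ) * (β + d / 2)))) := by
          refine (Finset.abs_sum_le_sum_abs _ _).trans (Finset.sum_le_sum fun ι hι =>
            (Finset.abs_sum_le_sum_abs _ _).trans (Finset.sum_le_sum fun m _ => ?_))
          have hι0 := Finset.ne_of_mem_erase hι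
          rw [abs_mul]
          exact mul_le_mul (abs_integral_mul_Psi_le hM hp hj hι0 m)
            (abs_integral_mul_Psi_le hM hb hj hι0 m) (abs_nonneg _) (by positivity)
      _ ≤ ∑ ι : Fin d → Fin 2, ∑ _m : Fin d → Fin (2 ^ j),
          (M * (2 : ℝ) ^ (-((j : ℝ) * (α + d / 2)))) * (M * (2 : ℝ) ^ (-((j : ℝ) * (β + d / 2)))) :=
          Finset.sum_le_sum_of_subset_of_nonneg (Finset.erase_subset _ _) fun _ _ _ =>
            Finset.sum_nonneg fun _ _ => by positivity
      _ = D * ρ ^ j := by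
          rw [← two_rpow_mul_resolution, ← card_index]
          simp only [Finset.sum_const, Finset.card_univ, nsmul_eq_mul, hD]
          rw [Fintype.card_fun, Fintype.card_fin, Fintype.card_fin]
          push_cast
          ring
  have hk : ∀ k, |W.projInner (l + k) p b - W.projInner l p b| ≤ D / (1 - ρ) * (ρ ^ l - ρ ^ (l + k)) := by
    intro k
    induction k with
    | zero => simp
    | succ k ih =>
      have h1 := step (l + k) (hl.trans (Nat.le_add_right l k))
      have h2 : W.projInner (l + (k + 1)) p b - W.projInner l p b =
        (W.projInner (l + k + 1) p b - W.projInner (l + k) p b) +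
          (W.projInner (l + k) p b - W.projInner l p b) := by rw [← add_assoc]; ring
      rw [h2]
      refine (abs_add_le _ _).trans ((add_le_add h1 ih).trans (le_of_eq ?_))
      have : 1 - ρ ≠ 0 := by linarith
      field_simp
      ring
  have hlim : Tendsto (fun k => |W.projInner (l + k) p b - W.projInner l p b|) atTop
      (𝓝 |(∫ x in Icc (0 : Fin d → ℝ) 1, p x * b x) - W.projInner l p b|) := by
    have := (tendsto_projInner (W := W) hS hp.1 hb.1).comp (tendsto_add_atTop_nat l)
    have h2 := (this.sub_const (W.projInner l p b)).abs
    refine h2.congr fun k => ?_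
    simp [add_comm]
  refine le_of_tendsto hlim (Eventually.of_forall fun k => (hk k).trans ?_)
  have : 0 ≤ D / (1 - ρ) := div_nonneg hD0 (by linarith)
  refine mul_le_mul_of_nonneg_left ?_ this
  have : 0 < ρ ^ (l + k) := by positivity
  linarith

/-! ### Perturbations of constants at one resolution level -/

/-- The nearest point of the unit cube. -/
noncomputable def clampCube {d : ℕ} (x : Fin d → ℝ) : Fin d → ℝ := fun i => max 0 (min 1 (x i))

theorem clampCube_mem (x : Fin d → ℝ) : clampCube x ∈ Icc (0 : Fin d → ℝ) 1 :=
  ⟨fun i => le_max_left _ _, fun i => max_le (by simp) (min_le_left _ _)⟩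

theorem clampCube_of_mem {x : Fin d → ℝ} (hx : x ∈ Icc (0 : Fin d → ℝ) 1) : clampCube x = x := by
  ext i
  have := apply_mem_Icc_of_mem_cube hx i
  simp [clampCube, this.1, this.2]

theorem continuous_clampCube : Continuous (clampCube (d := d)) :=
  continuous_pi fun i => by unfold clampCube; fun_prop

theorem continuous_comp_clampCube {h : (Fin d → ℝ) → ℝ} (hh : ContinuousOn h (Icc 0 1)) :
    Continuous fun x => h (clampCube x) :=
  hh.comp_continuous continuous_clampCube clampCube_mem

variable (W) in
/-- The sum of all wavelets `Ψ^{(1,…,1)}_{lm}` of level `l`, scaled to have norm `ε` in the Hölder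
space of smoothness `s`, extended continuously outside the cube. -/
noncomputable def bump (s ε : ℝ) (l : ℕ) (x : Fin d → ℝ) : ℝ :=
  ε * (2 : ℝ) ^ (-((l : ℝ) * (s + d / 2))) * ∑ m, W.Psi 1 l m (clampCube x)

theorem continuous_bump {l : ℕ} (hl : W.J₀ ≤ l) (s ε : ℝ) :
    Continuous (W.bump (d := d) s ε l) := by
  refine continuous_const.mul (continuous_finsetSum _ fun m _ => ?_)
  exact continuous_comp_clampCube (continuousOn_Psi hl 1 m)

theorem bump_of_mem {s ε : ℝ} {l : ℕ} {x : Fin d → ℝ} (hx : x ∈ Icc (0 : Fin d → ℝ) 1) :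
    W.bump s ε l x = ∑ m, (ε * (2 : ℝ) ^ (-((l : ℝ) * (s + d / 2)))) * W.Psi 1 l m x := by
  rw [bump, clampCube_of_mem hx, Finset.mul_sum]

/-- The bumps are uniformly small: boundedly many wavelets overlap, and the factor `2 ^ (l d / 2)` in
their size is compensated by the scaling. -/
theorem exists_bump_bound (W : CDVBasis S) (d : ℕ) : ∃ C : ℝ, 1 ≤ C ∧ ∀ s ε : ℝ, 0 < s → 0 ≤ ε →
    ∀ l, W.J₀ ≤ l → ∀ x : Fin d → ℝ, |W.bump s ε l x| ≤ ε * C := by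
  obtain ⟨C, hC, h⟩ := W.exists_sum_abs_basis_le
  refine ⟨max 1 C ^ d, one_le_pow₀ (le_max_left _ _), fun s ε hs hε l hl x => ?_⟩
  have hx := clampCube_mem x
  have h1 : |∑ m, W.Psi 1 l m (clampCube x)| ≤ (max 1 C * 2 ^ ((l : ℝ) / 2)) ^ d := by
    have e : ∑ m, W.Psi 1 l m (clampCube x) = ∏ i, ∑ m, W.basis 1 l m (clampCube x i) := by
      rw [Finset.prod_univ_sum, Fintype.piFinset_univ]; rfl
    rw [e, Finset.abs_prod]
    calc ∏ i, |∑ m, W.basis 1 l m (clampCube x i)| ≤ ∏ _i : Fin d, (max 1 C * 2 ^ ((l : ℝ) / 2)) := by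
          refine Finset.prod_le_prod (fun _ _ => abs_nonneg _) fun i _ => ?_
          refine (Finset.abs_sum_le_sum_abs _ _).trans
            ((h 1 l hl _ (apply_mem_Icc_of_mem_cube hx i)).trans ?_)
          gcongr
          exact le_max_right _ _
      _ = _ := by simp
  have h2 : (2 : ℝ) ^ (-((l : ℝ) * (s + d / 2))) * (max 1 C * 2 ^ ((l : ℝ) / 2)) ^ d ≤ max 1 C ^ d := by
    rw [mul_pow, ← Real.rpow_natCast ((2 : ℝ) ^ ((l : ℝ) / 2)) d, ← Real.rpow_mul (by norm_num),
      mul_left_comm, ← Real.rpow_add (by norm_num)]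
    refine mul_le_of_le_one_right (by positivity) ?_
    refine Real.rpow_le_one_of_one_le_of_nonpos (by norm_num) ?_
    have : 0 ≤ (l : ℝ) * s := by positivity
    linarith
  rw [bump, abs_mul, abs_of_nonneg (by positivity), mul_assoc]
  refine mul_le_mul_of_nonneg_left ?_ hε
  exact (mul_le_mul_of_nonneg_left h1 (by positivity)).trans h2

theorem integral_bump_mul {l : ℕ} (hl : W.J₀ ≤ l) (s ε : ℝ) {h : (Fin d → ℝ) → ℝ}
    (hh : ContinuousOn h (Icc 0 1)) :
    ∫ x in Icc (0 : Fin d → ℝ) 1, W.bump s ε l x * h x =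
      ∑ m, (ε * (2 : ℝ) ^ (-((l : ℝ) * (s + d / 2)))) *
        ∫ x in Icc (0 : Fin d → ℝ) 1, W.Psi 1 l m x * h x := by
  rw [setIntegral_congr_fun measurableSet_Icc (g := fun x =>
    ∑ m, (ε * (2 : ℝ) ^ (-((l : ℝ) * (s + d / 2)))) * (W.Psi 1 l m x * h x))]
  · rw [integral_finsetSum _ fun m _ =>
      (integrableOn_cube_mul (continuousOn_Psi hl 1 m) hh).const_mul _]
    simp_rw [integral_const_mul]
  · intro x hx
    simp only
    rw [bump_of_mem hx, Finset.sum_mul]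
    simp only [mul_assoc]

theorem one_index_ne_zero (hd : 0 < d) : (1 : Fin d → Fin 2) ≠ 0 := fun h =>
  absurd (congrFun h ⟨0, hd⟩) (by simp)

/-- The bump of level `l` is orthogonal to everything that the projection of level `l` reproduces. -/
theorem integral_bump_mul_eq_zero (hd : 0 < d) {l : ℕ} (hl : W.J₀ ≤ l) (s ε : ℝ)
    {h : (Fin d → ℝ) → ℝ} (hh : ContinuousOn h (Icc 0 1)) (hr : EqOn (W.proj l h) h (Icc 0 1)) :
    ∫ x in Icc (0 : Fin d → ℝ) 1, W.bump s ε l x * h x = 0 := by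
  rw [integral_bump_mul hl s ε hh]
  refine Finset.sum_eq_zero fun m _ => ?_
  simp_rw [mul_comm (W.Psi 1 l m _)]
  rw [integral_mul_Psi_eq_zero hl hh hr (one_index_ne_zero hd), mul_zero]

theorem abs_integral_bump_mul_Psi_le (hd : 0 < d) {l : ℕ} (hl : W.J₀ ≤ l) (s : ℝ) {ε : ℝ}
    (hε : 0 ≤ ε) {l' : ℕ} (hl' : W.J₀ ≤ l') {ι : Fin d → Fin 2} (hι : ι ≠ 0)
    (m : Fin d → Fin (2 ^ l')) :
    |∫ x in Icc (0 : Fin d → ℝ) 1, W.bump s ε l x * W.Psi ι l' m x| ≤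
      ε * (2 : ℝ) ^ (-((l' : ℝ) * (s + d / 2))) := by
  have hpos : 0 ≤ ε * (2 : ℝ) ^ (-((l' : ℝ) * (s + d / 2))) := by positivity
  rcases lt_trichotomy l l' with h | h | h
  · rw [integral_bump_mul hl s ε (continuousOn_Psi hl' ι m), Finset.sum_eq_zero, abs_zero]
    · exact hpos
    · intro m' _
      rw [integral_Psi_mul_Psi_of_lt hl h 1 m' hι m, mul_zero]
  · subst h
    rw [integral_bump_mul hl s ε (continuousOn_Psi hl' ι m)]
    simp_rw [integral_Psi_mul_Psi hl]
    by_cases h1 : 1 = ι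
    · simp only [h1, true_and, mul_ite, mul_one, mul_zero, Finset.sum_ite_eq', Finset.mem_univ,
        if_true]
      rw [abs_of_nonneg hpos]
    · simpa [h1] using hpos
  · rw [integral_bump_mul_eq_zero hd hl s ε (continuousOn_Psi hl' ι m), abs_zero]
    · exact hpos
    · exact proj_eqOn_mono (hl'.trans (Nat.le_succ l')) h (continuousOn_Psi hl' ι m)
        (proj_succ_Psi hl' ι m)

theorem integral_bump (hd : 0 < d) (hS : 0 < S) {l : ℕ} (hl : W.J₀ ≤ l) (s ε : ℝ) :
    ∫ x in Icc (0 : Fin d → ℝ) 1, W.bump s ε l x = 0 := by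
  have := integral_bump_mul_eq_zero hd hl s ε (h := fun _ => 1) continuousOn_const
    (proj_const hS hl 1)
  simpa using this

theorem integral_bump_mul_bump {l : ℕ} (hl : W.J₀ ≤ l) (s t ε : ℝ) :
    ∫ x in Icc (0 : Fin d → ℝ) 1, W.bump s ε l x * W.bump t ε l x =
      ε ^ 2 * ((2 : ℝ) ^ (-(s + t))) ^ l := by
  rw [integral_bump_mul hl s ε (continuous_bump hl t ε).continuousOn]
  simp_rw [mul_comm (W.Psi 1 l _ _), integral_bump_mul hl t ε (continuousOn_Psi hl 1 _),
    integral_Psi_mul_Psi hl]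
  simp only [true_and, mul_ite, mul_one, mul_zero, Finset.sum_ite_eq', Finset.mem_univ, if_true,
    Finset.sum_const, Finset.card_univ, nsmul_eq_mul]
  rw [card_index, ← two_rpow_mul_resolution (d := d)]
  ring

theorem integral_const_mul_Psi (hS : 0 < S) {l : ℕ} (hl : W.J₀ ≤ l) (c : ℝ)
    {ι : Fin d → Fin 2} (hι : ι ≠ 0) (m : Fin d → Fin (2 ^ l)) :
    ∫ x in Icc (0 : Fin d → ℝ) 1, c * W.Psi ι l m x = 0 :=
  integral_mul_Psi_eq_zero hl (h := fun _ => c) continuousOn_const (proj_const hS hl c) hι m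

theorem integral_const_add_bump_mul_Phi (hd : 0 < d) {l l' : ℕ} (hl : W.J₀ ≤ l)
    (hll' : l ≤ l') (c s ε : ℝ) (m : Fin d → Fin (2 ^ l)) :
    ∫ x in Icc (0 : Fin d → ℝ) 1, (c + W.bump s ε l' x) * W.Phi l m x =
      ∫ x in Icc (0 : Fin d → ℝ) 1, c * W.Phi l m x := by
  simp_rw [add_mul]
  rw [integral_add (integrableOn_cube_mul continuousOn_const (continuousOn_Phi hl m))
    (integrableOn_cube_mul (continuous_bump (hl.trans hll') s ε).continuousOn
      (continuousOn_Phi hl m)),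
    integral_bump_mul_eq_zero hd (hl.trans hll') s ε (continuousOn_Phi hl m)
      (proj_eqOn_mono hl hll' (continuousOn_Phi hl m) fun x _ => proj_Phi hl m x), add_zero]

/-- A bump has wavelet coefficients at its own level only, and constants have none. -/
theorem holderNorm_const_add_bump_le (hd : 0 < d) (hS : 0 < S) {l : ℕ} (hl : W.J₀ ≤ l)
    (c s : ℝ) {ε : ℝ} (hε : 0 ≤ ε) :
    W.holderNorm (d := d) s (fun x => c + W.bump s ε l x) ≤
      W.holderNorm (d := d) s (fun _ => c) + ENNReal.ofReal ε := by
  unfold holderNorm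
  simp_rw [integral_const_add_bump_mul_Phi hd le_rfl hl]
  refine add_le_add le_self_add ?_
  refine iSup₂_le fun l' hl' => iSup_le fun m => iSup₂_le fun ι hι => ?_
  have hr : (0 : ℝ) < (2 : ℝ) ^ ((l' : ℝ) * (s + (d : ℝ) / 2)) := by positivity
  rw [Real.enorm_eq_ofReal_abs, ← ENNReal.ofReal_mul hr.le]
  refine ENNReal.ofReal_le_ofReal ?_
  simp_rw [add_mul]
  rw [integral_add (integrableOn_cube_mul continuousOn_const (continuousOn_Psi hl' ι m))
    (integrableOn_cube_mul (continuous_bump hl s ε).continuousOn (continuousOn_Psi hl' ι m)),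
    integral_const_mul_Psi hS hl' c hι, zero_add]
  have := abs_integral_bump_mul_Psi_le hd hl s hε hl' hι m
  rw [Real.rpow_neg (by norm_num), ← div_eq_mul_inv, le_div_iff₀ hr, mul_comm] at this
  exact this

theorem projInner_const (hS : 0 < S) {l : ℕ} (hl : W.J₀ ≤ l) (c : ℝ) :
    W.projInner l (fun _ : Fin d → ℝ => c) (fun _ => c) = c ^ 2 := by
  rw [← integral_proj_mul hl continuousOn_const continuousOn_const,
    setIntegral_congr_fun measurableSet_Icc (g := fun _ => c * c) fun x hx => by
      simp only; rw [proj_const hS hl c hx]]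
  simp [sq]

theorem projInner_const_add_bump (hd : 0 < d) (hS : 0 < S) {l : ℕ} (hl : W.J₀ ≤ l)
    (c s t ε : ℝ) :
    W.projInner l (fun x : Fin d → ℝ => c + W.bump s ε l x) (fun x => c + W.bump t ε l x) =
      c ^ 2 := by
  unfold projInner
  simp_rw [integral_const_add_bump_mul_Phi hd hl le_rfl]
  exact projInner_const hS hl c

theorem integral_const_add_bump_mul (hd : 0 < d) (hS : 0 < S) {l : ℕ} (hl : W.J₀ ≤ l)
    (c s t ε : ℝ) :
    ∫ x in Icc (0 : Fin d → ℝ) 1, (c + W.bump s ε l x) * (c + W.bump t ε l x) =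
      c ^ 2 + ε ^ 2 * ((2 : ℝ) ^ (-(s + t))) ^ l := by
  have cs := (continuous_bump (W := W) (d := d) hl s ε).continuousOn (s := Icc 0 1)
  have ct := (continuous_bump (W := W) (d := d) hl t ε).continuousOn (s := Icc 0 1)
  have e : ∀ x : Fin d → ℝ, (c + W.bump s ε l x) * (c + W.bump t ε l x) =
      c ^ 2 + (c * W.bump s ε l x + (c * W.bump t ε l x + W.bump s ε l x * W.bump t ε l x)) :=
    fun x => by ring
  simp_rw [e]
  have i1 : IntegrableOn (fun x => c * W.bump s ε l x) (Icc (0 : Fin d → ℝ) 1) :=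
    (integrableOn_cube cs).const_mul c
  have i2 : IntegrableOn (fun x => c * W.bump t ε l x) (Icc (0 : Fin d → ℝ) 1) :=
    (integrableOn_cube ct).const_mul c
  have i3 := integrableOn_cube_mul cs ct
  have i4 : IntegrableOn (fun x => c * W.bump t ε l x + W.bump s ε l x * W.bump t ε l x)
      (Icc (0 : Fin d → ℝ) 1) := i2.add i3
  have i5 : IntegrableOn (fun x => c * W.bump s ε l x +
      (c * W.bump t ε l x + W.bump s ε l x * W.bump t ε l x)) (Icc (0 : Fin d → ℝ) 1) := i1.add i4
  rw [integral_add (integrable_const _) i5, integral_add i1 i4, integral_add i2 i3,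
    integral_const_mul, integral_const_mul, integral_bump hd hS hl, integral_bump hd hS hl,
    integral_bump_mul_bump hl]
  simp

theorem holderNorm_const_le (hS : 0 < S) (d : ℕ) (s : ℝ) :
    ∃ Λ : ℝ, 0 ≤ Λ ∧ ∀ c : ℝ, W.holderNorm (d := d) s (fun _ => c) ≤ ENNReal.ofReal (|c| * Λ) := by
  set Λ := (2 : ℝ) ^ ((W.J₀ : ℝ) * (s + (d : ℝ) / 2)) *
    ∑ m, |∫ x in Icc (0 : Fin d → ℝ) 1, W.Phi W.J₀ m x| with hΛ
  refine ⟨Λ, by positivity, fun c => ?_⟩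
  unfold holderNorm
  have h2 : (⨆ (l : ℕ) (_ : W.J₀ ≤ l) (m : Fin d → Fin (2 ^ l)) (ι : Fin d → Fin 2) (_ : ι ≠ 0),
      ENNReal.ofReal ((2 : ℝ) ^ ((l : ℝ) * (s + (d : ℝ) / 2))) *
        ‖∫ x in Icc (0 : Fin d → ℝ) 1, c * W.Psi ι l m x‖ₑ) = 0 := by
    refine le_antisymm ?_ zero_le
    refine iSup₂_le fun l' hl' => iSup_le fun m => iSup₂_le fun ι hι => ?_
    rw [integral_const_mul_Psi hS hl' c hι]
    simp
  rw [h2, add_zero, mul_left_comm, ENNReal.ofReal_mul (by positivity)]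
  gcongr
  refine iSup_le fun m => ?_
  rw [Real.enorm_eq_ofReal_abs, integral_const_mul, abs_mul]
  refine ENNReal.ofReal_le_ofReal (mul_le_mul_of_nonneg_left ?_ (abs_nonneg _))
  exact Finset.single_le_sum (f := fun m => |∫ x in Icc (0 : Fin d → ℝ) 1, W.Phi W.J₀ m x|)
    (fun _ _ => abs_nonneg _) (Finset.mem_univ m)

/-- The constant in the nondegeneracy assumption can be taken different from zero. -/
theorem exists_ne_zero_const (hS : 0 < S) {s t M C₁ C₂ : ℝ} (hM : 0 < M)
    (hc : ∃ c ∈ Set.Ioo C₁ C₂, W.holderNorm (d := d) s (fun _ => c) < ENNReal.ofReal M ∧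
      W.holderNorm (d := d) t (fun _ => c) < ENNReal.ofReal M) :
    ∃ c ∈ Set.Ioo C₁ C₂, c ≠ 0 ∧ W.holderNorm (d := d) s (fun _ => c) < ENNReal.ofReal M ∧
      W.holderNorm (d := d) t (fun _ => c) < ENNReal.ofReal M := by
  obtain ⟨c, hcI, h1, h2⟩ := hc
  by_cases hc0 : c = 0
  · subst hc0
    obtain ⟨Λ, hΛ, hs⟩ := holderNorm_const_le (W := W) hS d s
    obtain ⟨Λ', hΛ', ht⟩ := holderNorm_const_le (W := W) hS d t
    set c := min (C₂ / 2) (M / (2 * (Λ + Λ' + 1))) with hc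
    have hcpos : 0 < c := lt_min (by linarith [hcI.2]) (by positivity)
    have hcM : c * (Λ + Λ' + 1) ≤ M / 2 := by
      calc c * (Λ + Λ' + 1) ≤ M / (2 * (Λ + Λ' + 1)) * (Λ + Λ' + 1) := by
            gcongr; exact min_le_right _ _
        _ = M / 2 := by field_simp
    refine ⟨c, ⟨by linarith [hcI.1], ?_⟩, hcpos.ne', (hs c).trans_lt ?_, (ht c).trans_lt ?_⟩
    · exact (min_le_left _ _).trans_lt (by linarith [hcI.2])
    · rw [ENNReal.ofReal_lt_ofReal_iff hM, abs_of_pos hcpos]; nlinarith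
    · rw [ENNReal.ofReal_lt_ofReal_iff hM, abs_of_pos hcpos]; nlinarith
  · exact ⟨c, hcI, hc0, h1, h2⟩

end CDVBasis

/-! ### Consequences of the model assumptions -/

theorem measurable_obsX {d : ℕ} : Measurable (Obs.X (d := d)) := measurable_fst

theorem measurable_obsA {d : ℕ} : Measurable (Obs.A (d := d)) :=
  measurable_fst.comp measurable_snd

theorem measurable_obsY {d : ℕ} : Measurable (Obs.Y (d := d)) :=
  measurable_snd.comp measurable_snd

/-- The nearest point of the interval `[C₁, C₂]`. -/
noncomputable def clampIcc (C₁ C₂ t : ℝ) : ℝ := max C₁ (min C₂ t)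

theorem clampIcc_of_mem {C₁ C₂ t : ℝ} (ht : t ∈ Icc C₁ C₂) : clampIcc C₁ C₂ t = t := by
  simp [clampIcc, ht.1, ht.2]

theorem measurable_clampIcc (C₁ C₂ : ℝ) : Measurable (clampIcc C₁ C₂) := by
  unfold clampIcc; fun_prop

theorem abs_le_of_mem_Icc {C₁ C₂ t : ℝ} (ht : t ∈ Icc C₁ C₂) : |t| ≤ max |C₁| |C₂| :=
  abs_le_max_abs_abs ht.1 ht.2

theorem abs_clampIcc_le {C₁ C₂ : ℝ} (h : C₁ ≤ C₂) (t : ℝ) :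
    |clampIcc C₁ C₂ t| ≤ max |C₁| |C₂| :=
  abs_le_of_mem_Icc ⟨le_max_left _ _, max_le h (min_le_left _ _)⟩

namespace CDVBasis

variable {S : ℕ} {W : CDVBasis S} {d : ℕ}

/-- The law `P` of an observation has regression functions `p` and `b`, in a form without
conditional expectations. The responses are truncated to `[C₁, C₂]` and the covariates projected
to the cube; this changes the observations on a null set only and makes all functions bounded and
measurable. -/
structure IsRegression (C₁ C₂ : ℝ) (P : Measure (Obs d)) (p b : (Fin d → ℝ) → ℝ) : Prop where
  prob : IsProbabilityMeasure P
  contp : ContinuousOn p (Icc 0 1)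
  contb : ContinuousOn b (Icc 0 1)
  ae_mem : ∀ᵐ o ∂P, o.X ∈ Icc (0 : Fin d → ℝ) 1 ∧ o.A ∈ Icc C₁ C₂ ∧ o.Y ∈ Icc C₁ C₂
  integral_X : ∀ g : (Fin d → ℝ) → ℝ, ContinuousOn g (Icc 0 1) →
    ∫ o, g (clampCube o.X) ∂P = ∫ x in Icc (0 : Fin d → ℝ) 1, g x
  integral_A : ∀ g : (Fin d → ℝ) → ℝ, ContinuousOn g (Icc 0 1) →
    ∫ o, clampIcc C₁ C₂ o.A * g (clampCube o.X) ∂P = ∫ x in Icc (0 : Fin d → ℝ) 1, p x * g x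
  integral_Y : ∀ g : (Fin d → ℝ) → ℝ, ContinuousOn g (Icc 0 1) →
    ∫ o, clampIcc C₁ C₂ o.Y * g (clampCube o.X) ∂P = ∫ x in Icc (0 : Fin d → ℝ) 1, b x * g x
  psi_eq : psi P = (∫ o, clampIcc C₁ C₂ o.A * clampIcc C₁ C₂ o.Y ∂P) -
    ∫ x in Icc (0 : Fin d → ℝ) 1, p x * b x
  abs_p_le : ∀ᵐ x ∂(volume : Measure (Fin d → ℝ)).restrict (Icc 0 1), |p x| ≤ max |C₁| |C₂|
  abs_b_le : ∀ᵐ x ∂(volume : Measure (Fin d → ℝ)).restrict (Icc 0 1), |b x| ≤ max |C₁| |C₂|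

theorem sigmaX_le : Obs.sigmaX d ≤ (inferInstance : MeasurableSpace (Obs d)) :=
  measurable_obsX.comap_le

theorem exists_bound_comp_clampCube {g : (Fin d → ℝ) → ℝ} (hg : ContinuousOn g (Icc 0 1)) :
    ∃ C, ∀ x, |g (clampCube x)| ≤ C := by
  obtain ⟨C, hC⟩ := isCompact_Icc.exists_bound_of_continuousOn hg
  exact ⟨C, fun x => hC _ (clampCube_mem x)⟩

theorem ae_X_mem {P : Measure (Obs d)}
    (hX : P.map Obs.X = (volume : Measure (Fin d → ℝ)).restrict (Icc 0 1)) :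
    ∀ᵐ o ∂P, o.X ∈ Icc (0 : Fin d → ℝ) 1 := by
  have : ∀ᵐ x ∂(P.map Obs.X), x ∈ Icc (0 : Fin d → ℝ) 1 := by
    rw [hX]; exact ae_restrict_mem measurableSet_Icc
  exact ae_of_ae_map measurable_obsX.aemeasurable this

theorem integral_comp_X {P : Measure (Obs d)}
    (hX : P.map Obs.X = (volume : Measure (Fin d → ℝ)).restrict (Icc 0 1)) {g : (Fin d → ℝ) → ℝ}
    (hg : ContinuousOn g (Icc 0 1)) :
    ∫ o, g (clampCube o.X) ∂P = ∫ x in Icc (0 : Fin d → ℝ) 1, g x := by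
  rw [← integral_map (φ := Obs.X) (f := fun x => g (clampCube x)) measurable_obsX.aemeasurable
    (continuous_comp_clampCube hg).aestronglyMeasurable, hX]
  exact setIntegral_congr_fun measurableSet_Icc fun x hx => by rw [clampCube_of_mem hx]

theorem measurable_comp_X {g : (Fin d → ℝ) → ℝ} (hg : ContinuousOn g (Icc 0 1)) :
    Measurable fun o : Obs d => g (clampCube o.X) :=
  (continuous_comp_clampCube hg).measurable.comp measurable_obsX

/-- The defining property of a regression function `r` of the response `U`. -/
theorem integral_mul_comp_X {P : Measure (Obs d)} [IsProbabilityMeasure P]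
    (hX : P.map Obs.X = (volume : Measure (Fin d → ℝ)).restrict (Icc 0 1)) {C₁ C₂ : ℝ}
    {U : Obs d → ℝ} (hUm : Measurable U) (hU : ∀ᵐ o ∂P, U o ∈ Icc C₁ C₂)
    {r : (Fin d → ℝ) → ℝ} (hr : ContinuousOn r (Icc 0 1))
    (hce : P[U|Obs.sigmaX d] =ᵐ[P] fun o => r o.X) {g : (Fin d → ℝ) → ℝ}
    (hg : ContinuousOn g (Icc 0 1)) :
    ∫ o, clampIcc C₁ C₂ (U o) * g (clampCube o.X) ∂P =
      ∫ x in Icc (0 : Fin d → ℝ) 1, r x * g x := by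
  obtain ⟨C, hgC⟩ := exists_bound_comp_clampCube hg
  have hUi : Integrable U P := Integrable.of_bound hUm.aestronglyMeasurable (max |C₁| |C₂|)
    (hU.mono fun o ho => abs_le_of_mem_Icc ho)
  have hGs : StronglyMeasurable[Obs.sigmaX d] fun o : Obs d => g (clampCube o.X) :=
    ((continuous_comp_clampCube hg).measurable.comp (comap_measurable _)).stronglyMeasurable
  have hUG : Integrable (U * fun o : Obs d => g (clampCube o.X)) P :=
    hUi.mul_bdd (c := C) (measurable_comp_X hg).aestronglyMeasurable (Eventually.of_forall fun o => hgC _)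
  have h1 := condExp_mul_of_stronglyMeasurable_right hGs hUG hUi
  calc ∫ o, clampIcc C₁ C₂ (U o) * g (clampCube o.X) ∂P
      = ∫ o, (U * fun o : Obs d => g (clampCube o.X)) o ∂P :=
        integral_congr_ae (hU.mono fun o ho => by simp only [Pi.mul_apply]; rw [clampIcc_of_mem ho])
    _ = ∫ o, (P[U * fun o : Obs d => g (clampCube o.X)|Obs.sigmaX d]) o ∂P :=
        (integral_condExp sigmaX_le).symm
    _ = ∫ o, (fun x => r x * g x) (clampCube o.X) ∂P := by
        refine integral_congr_ae ?_
        filter_upwards [h1, hce, ae_X_mem hX] with o h1 h2 h3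
        rw [h1, Pi.mul_apply, h2, clampCube_of_mem h3]
    _ = _ := integral_comp_X hX (hr.mul hg)

theorem abs_regression_le {P : Measure (Obs d)} [IsProbabilityMeasure P]
    (hX : P.map Obs.X = (volume : Measure (Fin d → ℝ)).restrict (Icc 0 1)) {C₁ C₂ : ℝ}
    {U : Obs d → ℝ} (hU : ∀ᵐ o ∂P, U o ∈ Icc C₁ C₂) {r : (Fin d → ℝ) → ℝ}
    (hr : ContinuousOn r (Icc 0 1)) (hce : P[U|Obs.sigmaX d] =ᵐ[P] fun o => r o.X) :
    ∀ᵐ x ∂(volume : Measure (Fin d → ℝ)).restrict (Icc 0 1), |r x| ≤ max |C₁| |C₂| := by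
  have h1 := ae_bdd_abs_condExp_of_ae_bdd_abs (m := Obs.sigmaX d) (μ := P) (f := U)
    (R := max |C₁| |C₂|) (hU.mono fun o ho => abs_le_of_mem_Icc ho)
  have h2 : ∀ᵐ o ∂P, |r (clampCube o.X)| ≤ max |C₁| |C₂| := by
    filter_upwards [h1, hce, ae_X_mem hX] with o h1 h2 h3
    rw [clampCube_of_mem h3, ← h2]; exact h1
  have hm : MeasurableSet {x : Fin d → ℝ | |r (clampCube x)| ≤ max |C₁| |C₂|} :=
    measurableSet_le (continuous_comp_clampCube hr).abs.measurable measurable_const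
  have h3 := (ae_map_iff measurable_obsX.aemeasurable hm).2 h2
  rw [hX] at h3
  filter_upwards [h3, ae_restrict_mem measurableSet_Icc] with x h4 h5
  rwa [clampCube_of_mem h5] at h4

/-- For `psi_eq`: expanding `E[(A - p(X)) (Y - b(X))]` gives `E[A Y] - ∫ p b`. -/
theorem isRegression_of_condExp {P : Measure (Obs d)} [IsProbabilityMeasure P]
    (hX : P.map Obs.X = (volume : Measure (Fin d → ℝ)).restrict (Icc 0 1)) {C₁ C₂ : ℝ}
    (hC : C₁ ≤ C₂) (hAY : ∀ᵐ o ∂P, o.A ∈ Icc C₁ C₂ ∧ o.Y ∈ Icc C₁ C₂)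
    {p b : (Fin d → ℝ) → ℝ} (hp : ContinuousOn p (Icc 0 1)) (hb : ContinuousOn b (Icc 0 1))
    (hcp : P[Obs.A|Obs.sigmaX d] =ᵐ[P] fun o => p o.X)
    (hcb : P[Obs.Y|Obs.sigmaX d] =ᵐ[P] fun o => b o.X) : IsRegression C₁ C₂ P p b := by
  have hA : ∀ᵐ o ∂P, o.A ∈ Icc C₁ C₂ := hAY.mono fun o h => h.1
  have hY : ∀ᵐ o ∂P, o.Y ∈ Icc C₁ C₂ := hAY.mono fun o h => h.2
  refine ⟨inferInstance, hp, hb, ?_, fun g hg => integral_comp_X hX hg,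
    fun g hg => integral_mul_comp_X hX measurable_obsA hA hp hcp hg,
    fun g hg => integral_mul_comp_X hX measurable_obsY hY hb hcb hg, ?_,
    abs_regression_le hX hA hp hcp, abs_regression_le hX hY hb hcb⟩
  · filter_upwards [ae_X_mem hX, hAY] with o h1 h2 using ⟨h1, h2⟩
  · rw [psi]
    simp only [condCovAY]
    rw [integral_condExp sigmaX_le]
    set a : Obs d → ℝ := fun o => clampIcc C₁ C₂ o.A with ha
    set y : Obs d → ℝ := fun o => clampIcc C₁ C₂ o.Y with hy
    set p' : Obs d → ℝ := fun o => p (clampCube o.X) with hp'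
    set b' : Obs d → ℝ := fun o => b (clampCube o.X) with hb'
    have e : ∫ o, (o.A - (P[Obs.A|Obs.sigmaX d]) o) * (o.Y - (P[Obs.Y|Obs.sigmaX d]) o) ∂P =
        ∫ o, (a o * y o - a o * b' o - y o * p' o + p' o * b' o) ∂P := by
      refine integral_congr_ae ?_
      filter_upwards [ae_X_mem hX, hA, hY, hcp, hcb] with o h1 h2 h3 h4 h5
      simp only [ha, hy, hp', hb']
      rw [h4, h5, clampCube_of_mem h1, clampIcc_of_mem h2, clampIcc_of_mem h3]
      ring
    obtain ⟨Cp, hCp⟩ := exists_bound_comp_clampCube hp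
    obtain ⟨Cb, hCb⟩ := exists_bound_comp_clampCube hb
    have ma : Measurable a := (measurable_clampIcc _ _).comp measurable_obsA
    have my : Measurable y := (measurable_clampIcc _ _).comp measurable_obsY
    have mp : Measurable p' := measurable_comp_X hp
    have mb : Measurable b' := measurable_comp_X hb
    have prod : ∀ {u v : Obs d → ℝ} {c c' : ℝ}, Measurable u → Measurable v → (∀ o, |u o| ≤ c) →
        (∀ o, |v o| ≤ c') → Integrable (fun o => u o * v o) P := by
      intro u v c c' hu hv hc hc'
      refine integrable_of_measurable_of_bound (hu.mul hv) (B := c * c') fun o => ?_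
      simp only [abs_mul]
      exact mul_le_mul (hc o) (hc' o) (abs_nonneg _) ((abs_nonneg _).trans (hc o))
    have ba : ∀ o, |a o| ≤ max |C₁| |C₂| := fun o => abs_clampIcc_le hC _
    have by' : ∀ o, |y o| ≤ max |C₁| |C₂| := fun o => abs_clampIcc_le hC _
    have i1 := prod ma my ba by'
    have i2 := prod ma mb ba fun o => hCb _
    have i3 := prod my mp by' fun o => hCp _
    have i4 := prod mp mb (fun o => hCp _) fun o => hCb _
    have i5 : Integrable (fun o => a o * y o - a o * b' o) P := i1.sub i2
    have i6 : Integrable (fun o => a o * y o - a o * b' o - y o * p' o) P := i5.sub i3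
    rw [e, integral_add i6 i4, integral_sub i5 i3, integral_sub i1 i2,
      integral_mul_comp_X hX measurable_obsA hA hp hcp hb,
      integral_mul_comp_X hX measurable_obsY hY hb hcb hp,
      integral_comp_X hX (g := fun x => p x * b x) (hp.mul hb)]
    simp only [mul_comm (b _) (p _)]
    ring

theorem exists_isRegression {α β M C₁ C₂ : ℝ} (hC : C₁ ≤ C₂) {P : Measure (Obs d)}
    (hP : P ∈ W.model d α β M C₁ C₂) :
    ∃ p ∈ W.holderBall d α M, ∃ b ∈ W.holderBall d β M, IsRegression C₁ C₂ P p b := by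
  obtain ⟨hprob, hX, hAY, ⟨p, hp, hcp⟩, b, hb, hcb⟩ := hP
  exact ⟨p, hp, b, hb, isRegression_of_condExp hX hC hAY hp.1 hb.1 hcp hcb⟩

/-! ### Test laws -/

/-- The law of `(X, p(X) + ξ θ, b(X) + ξ θ)` with `X` uniform on the cube and an independent random
sign `ξ`; the regression functions are `p` and `b`, the conditional covariance is `θ ^ 2`. -/
noncomputable def testLaw (p b : (Fin d → ℝ) → ℝ) (θ : ℝ) : Measure (Obs d) :=
  (2⁻¹ : ℝ≥0∞) • ((volume : Measure (Fin d → ℝ)).restrict (Icc 0 1)).map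
      (fun x => (x, p x + θ, b x + θ)) +
    (2⁻¹ : ℝ≥0∞) • ((volume : Measure (Fin d → ℝ)).restrict (Icc 0 1)).map
      (fun x => (x, p x - θ, b x - θ))

section TestLaw

variable {p b : (Fin d → ℝ) → ℝ} {θ : ℝ}

theorem measurable_testLaw_map (hp : Continuous p) (hb : Continuous b) (θ : ℝ) :
    Measurable fun x : Fin d → ℝ => ((x, p x + θ, b x + θ) : Obs d) :=
  measurable_id.prodMk ((hp.measurable.add_const θ).prodMk (hb.measurable.add_const θ))

theorem measurable_testLaw_map' (hp : Continuous p) (hb : Continuous b) (θ : ℝ) :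
    Measurable fun x : Fin d → ℝ => ((x, p x - θ, b x - θ) : Obs d) :=
  measurable_id.prodMk ((hp.measurable.sub_const θ).prodMk (hb.measurable.sub_const θ))

theorem isProbabilityMeasure_testLaw (hp : Continuous p) (hb : Continuous b) :
    IsProbabilityMeasure (testLaw p b θ) := by
  constructor
  have h1 := Measure.isProbabilityMeasure_map
    (μ := (volume : Measure (Fin d → ℝ)).restrict (Icc 0 1))
    (measurable_testLaw_map hp hb θ).aemeasurable
  have h2 := Measure.isProbabilityMeasure_map
    (μ := (volume : Measure (Fin d → ℝ)).restrict (Icc 0 1))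
    (measurable_testLaw_map' hp hb θ).aemeasurable
  simp only [testLaw, Measure.add_apply, Measure.smul_apply, smul_eq_mul, h1.measure_univ,
    h2.measure_univ, mul_one]
  exact ENNReal.inv_two_add_inv_two

theorem map_X_testLaw (hp : Continuous p) (hb : Continuous b) :
    (testLaw p b θ).map Obs.X = (volume : Measure (Fin d → ℝ)).restrict (Icc 0 1) := by
  rw [testLaw, Measure.map_add _ _ measurable_obsX, Measure.map_smul, Measure.map_smul,
    Measure.map_map measurable_obsX (measurable_testLaw_map hp hb θ),
    Measure.map_map measurable_obsX (measurable_testLaw_map' hp hb θ)]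
  have e1 : (Obs.X ∘ fun x : Fin d → ℝ => ((x, p x + θ, b x + θ) : Obs d)) = id := rfl
  have e2 : (Obs.X ∘ fun x : Fin d → ℝ => ((x, p x - θ, b x - θ) : Obs d)) = id := rfl
  rw [e1, e2, Measure.map_id, ← add_smul, ENNReal.inv_two_add_inv_two, one_smul]

theorem integral_testLaw (hp : Continuous p) (hb : Continuous b) {F : Obs d → ℝ} (hF : Measurable F)
    (h₁ : IntegrableOn (fun x => F (x, p x + θ, b x + θ)) (Icc 0 1))
    (h₂ : IntegrableOn (fun x => F (x, p x - θ, b x - θ)) (Icc 0 1)) :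
    ∫ o, F o ∂(testLaw p b θ) =
      ∫ x in Icc (0 : Fin d → ℝ) 1,
        2⁻¹ * (F (x, p x + θ, b x + θ) + F (x, p x - θ, b x - θ)) := by
  have m₁ := measurable_testLaw_map hp hb θ
  have m₂ := measurable_testLaw_map' hp hb θ
  have i₁ : Integrable F ((2⁻¹ : ℝ≥0∞) • ((volume : Measure (Fin d → ℝ)).restrict (Icc 0 1)).map
      (fun x => ((x, p x + θ, b x + θ) : Obs d))) :=
    ((integrable_map_measure hF.aestronglyMeasurable m₁.aemeasurable).2 h₁).smul_measure (by simp)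
  have i₂ : Integrable F ((2⁻¹ : ℝ≥0∞) • ((volume : Measure (Fin d → ℝ)).restrict (Icc 0 1)).map
      (fun x => ((x, p x - θ, b x - θ) : Obs d))) :=
    ((integrable_map_measure hF.aestronglyMeasurable m₂.aemeasurable).2 h₂).smul_measure (by simp)
  rw [testLaw, integral_add_measure i₁ i₂, integral_smul_measure, integral_smul_measure,
    integral_map m₁.aemeasurable hF.aestronglyMeasurable,
    integral_map m₂.aemeasurable hF.aestronglyMeasurable, integral_const_mul, integral_add h₁ h₂]
  simp [mul_add]

theorem ae_testLaw (hp : Continuous p) (hb : Continuous b) {Q : Obs d → Prop}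
    (hQ : MeasurableSet {o | Q o}) (h₁ : ∀ x, Q (x, p x + θ, b x + θ))
    (h₂ : ∀ x, Q (x, p x - θ, b x - θ)) : ∀ᵐ o ∂(testLaw p b θ), Q o := by
  rw [testLaw, ae_add_measure_iff]
  constructor
  · refine Measure.ae_smul_measure ?_ _
    exact (ae_map_iff (measurable_testLaw_map hp hb θ).aemeasurable hQ).2 (Eventually.of_forall h₁)
  · refine Measure.ae_smul_measure ?_ _
    exact (ae_map_iff (measurable_testLaw_map' hp hb θ).aemeasurable hQ).2 (Eventually.of_forall h₂)

/-- The random sign averages out in the conditional mean. -/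
theorem condExp_testLaw (hp : Continuous p) (hb : Continuous b) {U : Obs d → ℝ} (hU : Measurable U)
    {r : (Fin d → ℝ) → ℝ} (hr : Continuous r) {B : ℝ} (hUB : ∀ᵐ o ∂(testLaw p b θ), |U o| ≤ B)
    (h₁ : ∀ x, U (x, p x + θ, b x + θ) = r x + θ) (h₂ : ∀ x, U (x, p x - θ, b x - θ) = r x - θ) :
    (testLaw p b θ)[U|Obs.sigmaX d] =ᵐ[testLaw p b θ] fun o => r o.X := by
  have hprob := isProbabilityMeasure_testLaw (θ := θ) hp hb
  have hX := map_X_testLaw (θ := θ) hp hb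
  have hUi : Integrable U (testLaw p b θ) := Integrable.of_bound hU.aestronglyMeasurable B hUB
  have hri : Integrable (fun o : Obs d => r o.X) (testLaw p b θ) := by
    have : Integrable r ((testLaw p b θ).map Obs.X) := by
      rw [hX]; exact integrableOn_cube hr.continuousOn
    exact this.comp_measurable measurable_obsX
  refine (ae_eq_condExp_of_forall_setIntegral_eq sigmaX_le hUi (fun s _ _ => hri.integrableOn)
    ?_ ?_).symm
  · rintro s ⟨t, ht, rfl⟩ -
    have hs : MeasurableSet (Obs.X (d := d) ⁻¹' t) := measurable_obsX ht
    have it : ∀ {g : (Fin d → ℝ) → ℝ}, Continuous g → IntegrableOn (t.indicator g) (Icc 0 1) :=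
      fun hg => (integrableOn_cube hg.continuousOn).integrable.indicator ht
    rw [← integral_indicator hs, ← integral_indicator hs]
    have e : ∀ (V : Obs d → ℝ) (x : Fin d → ℝ) (u v : ℝ),
        (Obs.X ⁻¹' t).indicator V (x, u, v) = t.indicator (fun x => V (x, u, v)) x :=
      fun V x u v => by
        by_cases hx : x ∈ t
        · rw [indicator_of_mem hx, indicator_of_mem (by exact hx)]
        · rw [indicator_of_notMem hx, indicator_of_notMem (by exact hx)]
    have eU₁ : ∀ x, (Obs.X ⁻¹' t).indicator U (x, p x + θ, b x + θ) =
        t.indicator (fun x => r x + θ) x := fun x => by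
      rw [e]
      by_cases hx : x ∈ t
      · rw [indicator_of_mem hx, indicator_of_mem hx, h₁]
      · rw [indicator_of_notMem hx, indicator_of_notMem hx]
    have eU₂ : ∀ x, (Obs.X ⁻¹' t).indicator U (x, p x - θ, b x - θ) =
        t.indicator (fun x => r x - θ) x := fun x => by
      rw [e]
      by_cases hx : x ∈ t
      · rw [indicator_of_mem hx, indicator_of_mem hx, h₂]
      · rw [indicator_of_notMem hx, indicator_of_notMem hx]
    have er : ∀ (x : Fin d → ℝ) (u v : ℝ), (Obs.X ⁻¹' t).indicator (fun o : Obs d => r o.X) (x, u, v) =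
        t.indicator r x := fun x u v => e _ x u v
    have hrm : Measurable fun o : Obs d => r o.X := hr.measurable.comp measurable_obsX
    rw [integral_testLaw hp hb (hU.indicator hs), integral_testLaw hp hb (hrm.indicator hs)]
    · simp_rw [eU₁, eU₂]
      refine integral_congr_ae (Eventually.of_forall fun x => ?_)
      simp only
      have e1 := er x (p x + θ) (b x + θ)
      have e2 := er x (p x - θ) (b x - θ)
      rw [e1, e2]
      by_cases hx : x ∈ t
      · simp only [indicator_of_mem hx]; ring
      · simp only [indicator_of_notMem hx]
    · refine (it hr).congr (Eventually.of_forall fun x => ?_)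
      exact (er _ _ _).symm
    · refine (it hr).congr (Eventually.of_forall fun x => ?_)
      exact (er _ _ _).symm
    · simp_rw [eU₁]; exact it (hr.add continuous_const)
    · simp_rw [eU₂]; exact it (hr.sub continuous_const)
  · exact (hr.measurable.comp (comap_measurable _)).stronglyMeasurable.aestronglyMeasurable

/-- Test laws with regression functions in the Hölder balls belong to the model. -/
theorem testLaw_mem_model {α β M C₁ C₂ : ℝ} (hp : Continuous p) (hb : Continuous b)
    (hC : C₁ ≤ C₂)
    (hp₁ : ∀ x, p x + θ ∈ Icc C₁ C₂) (hp₂ : ∀ x, p x - θ ∈ Icc C₁ C₂)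
    (hb₁ : ∀ x, b x + θ ∈ Icc C₁ C₂) (hb₂ : ∀ x, b x - θ ∈ Icc C₁ C₂)
    (hpM : W.holderNorm α p ≤ ENNReal.ofReal M) (hbM : W.holderNorm β b ≤ ENNReal.ofReal M) :
    testLaw p b θ ∈ W.model d α β M C₁ C₂ ∧ IsRegression C₁ C₂ (testLaw p b θ) p b := by
  have hprob := isProbabilityMeasure_testLaw (θ := θ) hp hb
  have hX := map_X_testLaw (θ := θ) hp hb
  have hAY : ∀ᵐ o ∂(testLaw p b θ), o.A ∈ Icc C₁ C₂ ∧ o.Y ∈ Icc C₁ C₂ :=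
    ae_testLaw hp hb ((measurable_obsA measurableSet_Icc).inter (measurable_obsY measurableSet_Icc))
      (fun x => ⟨hp₁ x, hb₁ x⟩) fun x => ⟨hp₂ x, hb₂ x⟩
  have hcp := condExp_testLaw hp hb measurable_obsA hp
    (hAY.mono fun o ho => abs_le_of_mem_Icc ho.1) (fun _ => rfl) fun _ => rfl
  have hcb := condExp_testLaw hp hb measurable_obsY hb
    (hAY.mono fun o ho => abs_le_of_mem_Icc ho.2) (fun _ => rfl) fun _ => rfl
  exact ⟨⟨hprob, hX, hAY, ⟨p, ⟨hp.continuousOn, hpM⟩, hcp⟩, b, ⟨hb.continuousOn, hbM⟩, hcb⟩,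
    isRegression_of_condExp hX hC hAY hp.continuousOn hb.continuousOn hcp hcb⟩

theorem integral_AY_testLaw {C₁ C₂ : ℝ} (hp : Continuous p) (hb : Continuous b)
    (hp₁ : ∀ x, p x + θ ∈ Icc C₁ C₂) (hp₂ : ∀ x, p x - θ ∈ Icc C₁ C₂)
    (hb₁ : ∀ x, b x + θ ∈ Icc C₁ C₂) (hb₂ : ∀ x, b x - θ ∈ Icc C₁ C₂)
    {g : (Fin d → ℝ) → ℝ} (hg : ContinuousOn g (Icc 0 1)) :
    ∫ o, clampIcc C₁ C₂ o.A * clampIcc C₁ C₂ o.Y * g (clampCube o.X) ∂(testLaw p b θ) =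
      ∫ x in Icc (0 : Fin d → ℝ) 1, (p x * b x + θ ^ 2) * g x := by
  have hg' := continuous_comp_clampCube hg
  have e₁ : ∀ x : Fin d → ℝ, clampIcc C₁ C₂ (Obs.A (x, p x + θ, b x + θ)) *
      clampIcc C₁ C₂ (Obs.Y (x, p x + θ, b x + θ)) *
      g (clampCube (Obs.X (x, p x + θ, b x + θ))) =
      (p x + θ) * (b x + θ) * g (clampCube x) := fun x => by
    simp only [Obs.A, Obs.Y, Obs.X]
    rw [clampIcc_of_mem (hp₁ x), clampIcc_of_mem (hb₁ x)]
  have e₂ : ∀ x : Fin d → ℝ, clampIcc C₁ C₂ (Obs.A (x, p x - θ, b x - θ)) *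
      clampIcc C₁ C₂ (Obs.Y (x, p x - θ, b x - θ)) *
      g (clampCube (Obs.X (x, p x - θ, b x - θ))) =
      (p x - θ) * (b x - θ) * g (clampCube x) := fun x => by
    simp only [Obs.A, Obs.Y, Obs.X]
    rw [clampIcc_of_mem (hp₂ x), clampIcc_of_mem (hb₂ x)]
  rw [integral_testLaw hp hb]
  · simp_rw [e₁, e₂]
    refine setIntegral_congr_fun measurableSet_Icc fun x hx => ?_
    simp only [clampCube_of_mem hx]
    ring
  · exact (((measurable_clampIcc _ _).comp measurable_obsA).mul
      ((measurable_clampIcc _ _).comp measurable_obsY)).mul (measurable_comp_X hg)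
  · simp_rw [e₁]
    exact integrableOn_cube (((hp.add continuous_const).mul (hb.add continuous_const)).mul
      hg').continuousOn
  · simp_rw [e₂]
    exact integrableOn_cube (((hp.sub continuous_const).mul (hb.sub continuous_const)).mul
      hg').continuousOn

end TestLaw

end CDVBasis

/-! ### Bias of the estimators -/

theorem resolution_mono (d : ℕ) {l l' : ℕ} (h : l ≤ l') : resolution d l ≤ resolution d l' := by
  unfold resolution
  exact pow_le_pow_right₀ (by norm_num) (Nat.mul_le_mul_right d h)

theorem kMin_eq (d l₁ l₂ : ℕ) : kMin d l₁ l₂ = resolution d (min l₁ l₂) := by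
  rcases le_total l₁ l₂ with h | h
  · rw [kMin, min_eq_left h, min_eq_left (resolution_mono d h)]
  · rw [kMin, min_eq_right h, min_eq_right (resolution_mono d h)]

theorem kMax_eq (d l₁ l₂ : ℕ) : kMax d l₁ l₂ = resolution d (max l₁ l₂) := by
  rcases le_total l₁ l₂ with h | h
  · rw [kMax, max_eq_right h, max_eq_right (resolution_mono d h)]
  · rw [kMax, max_eq_left h, max_eq_left (resolution_mono d h)]

theorem one_le_resolution (d l : ℕ) : 1 ≤ resolution d l := by
  unfold resolution; exact one_le_pow₀ (by norm_num)

theorem kMin_mul_kMax (d l₁ l₂ : ℕ) :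
    kMin d l₁ l₂ * kMax d l₁ l₂ = resolution d l₁ * resolution d l₂ :=
  min_mul_max _ _

namespace CDVBasis

variable {S : ℕ} {W : CDVBasis S} {d : ℕ}

/-- The truncated treatment. -/
noncomputable def truncA (d : ℕ) (C₁ C₂ : ℝ) (o : Obs d) : ℝ := clampIcc C₁ C₂ o.A

/-- The truncated outcome. -/
noncomputable def truncY (d : ℕ) (C₁ C₂ : ℝ) (o : Obs d) : ℝ := clampIcc C₁ C₂ o.Y

variable (W) in
/-- The projection kernel as a function of two observations. -/
noncomputable def obsKernel (l : ℕ) (o o' : Obs d) : ℝ :=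
  W.kernel l (clampCube o.X) (clampCube o'.X)

theorem measurable_truncA (C₁ C₂ : ℝ) : Measurable (truncA d C₁ C₂) :=
  (measurable_clampIcc _ _).comp measurable_obsA

theorem measurable_truncY (C₁ C₂ : ℝ) : Measurable (truncY d C₁ C₂) :=
  (measurable_clampIcc _ _).comp measurable_obsY

theorem measurable_obsKernel {l : ℕ} (hl : W.J₀ ≤ l) :
    Measurable (Function.uncurry (W.obsKernel (d := d) l)) := by
  have h : ∀ m, Measurable fun o : Obs d => W.Phi l m (clampCube o.X) := fun m =>
    measurable_comp_X (continuousOn_Phi hl m)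
  exact Finset.measurable_sum _ fun m _ =>
    ((h m).comp measurable_fst).mul ((h m).comp measurable_snd)

theorem obsKernel_comm (l : ℕ) (o o' : Obs d) : W.obsKernel l o o' = W.obsKernel l o' o :=
  W.kernel_comm _ _ _

section Regression

variable {C₁ C₂ : ℝ} {P : Measure (Obs d)} {p b : (Fin d → ℝ) → ℝ}

theorem lintegral_obsKernel_le (hR : IsRegression C₁ C₂ P p b) {C : ℝ} {l : ℕ} (hl : W.J₀ ≤ l)
    (hC : ∀ x ∈ Icc (0 : Fin d → ℝ) 1, ∫ y in Icc (0 : Fin d → ℝ) 1, |W.kernel l x y| ≤ C)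
    (o : Obs d) : ∫⁻ o', ‖W.obsKernel l o o'‖ₑ ∂P ≤ ENNReal.ofReal C := by
  have := hR.prob
  have hc := continuousOn_kernel (W := W) hl (clampCube o.X)
  obtain ⟨c, hcb⟩ := exists_bound_comp_clampCube hc
  have hi : Integrable (fun o' => W.obsKernel l o o') P :=
    integrable_of_measurable_of_bound (measurable_comp_X hc) fun o' => hcb _
  rw [← ofReal_integral_norm_eq_lintegral_enorm hi]
  refine ENNReal.ofReal_le_ofReal ((le_of_eq ?_).trans (hC _ (clampCube_mem o.X)))
  exact hR.integral_X (fun y => |W.kernel l (clampCube o.X) y|) hc.abs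

theorem integral_truncA_mul_obsKernel (hR : IsRegression C₁ C₂ P p b) {l : ℕ} (hl : W.J₀ ≤ l)
    (o : Obs d) :
    ∫ o', truncA d C₁ C₂ o' * W.obsKernel l o' o ∂P = W.proj l p (clampCube o.X) := by
  simp_rw [fun o' => W.obsKernel_comm l o' o]
  refine (hR.integral_A _ (continuousOn_kernel hl (clampCube o.X))).trans ?_
  simp only [proj, mul_comm]

theorem integral_truncY_mul_obsKernel (hR : IsRegression C₁ C₂ P p b) {l : ℕ} (hl : W.J₀ ≤ l)
    (o : Obs d) :
    ∫ o', truncY d C₁ C₂ o' * W.obsKernel l o' o ∂P = W.proj l b (clampCube o.X) := by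
  simp_rw [fun o' => W.obsKernel_comm l o' o]
  refine (hR.integral_Y _ (continuousOn_kernel hl (clampCube o.X))).trans ?_
  simp only [proj, mul_comm]

theorem integral_obsKernel_mul_obsKernel (hR : IsRegression C₁ C₂ P p b) {l₁ l₂ : ℕ}
    (hl₁ : W.J₀ ≤ l₁) (hl₂ : W.J₀ ≤ l₂) (o o' : Obs d) :
    ∫ o'', W.obsKernel l₁ o o'' * W.obsKernel l₂ o' o'' ∂P = W.obsKernel (min l₁ l₂) o o' :=
  (hR.integral_X _ ((continuousOn_kernel hl₁ _).mul (continuousOn_kernel hl₂ _))).trans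
    (integral_kernel_mul_kernel hl₁ hl₂ (clampCube_mem _) (clampCube_mem _))

variable (W) in
/-- The mean `E[A Y K_l(X, X)]` of the diagonal terms. -/
noncomputable def diagMean (C₁ C₂ : ℝ) (P : Measure (Obs d)) (l : ℕ) : ℝ :=
  ∫ o, truncA d C₁ C₂ o * truncY d C₁ C₂ o * W.obsKernel l o o ∂P

variable (W) in
/-- The mean `E[A Y K_{l₁}(X, X) K_{l₂}(X, X)]` of the terms in which all three indices agree. -/
noncomputable def diagMean₂ (C₁ C₂ : ℝ) (P : Measure (Obs d)) (l₁ l₂ : ℕ) : ℝ :=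
  ∫ o, truncA d C₁ C₂ o * W.obsKernel l₁ o o * (truncY d C₁ C₂ o * W.obsKernel l₂ o o) ∂P

variable (W) in
/-- The mean `∫ r(x) K_l(x, x) (Π_{l'} h)(x) dx` of the terms in which a kernel is evaluated on the
diagonal and the other one is not. -/
noncomputable def crossMean (r h : (Fin d → ℝ) → ℝ) (l l' : ℕ) : ℝ :=
  ∫ x in Icc (0 : Fin d → ℝ) 1, r x * (W.kernel l x x * W.proj l' h x)

theorem abs_truncA_le (h : C₁ ≤ C₂) (o : Obs d) : |truncA d C₁ C₂ o| ≤ max |C₁| |C₂| :=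
  abs_clampIcc_le h _

theorem abs_truncY_le (h : C₁ ≤ C₂) (o : Obs d) : |truncY d C₁ C₂ o| ≤ max |C₁| |C₂| :=
  abs_clampIcc_le h _

theorem integral_vStat₂_obs (hR : IsRegression C₁ C₂ P p b) (hC : C₁ ≤ C₂) {l n : ℕ}
    (hl : W.J₀ ≤ l) (hn : 0 < n) :
    ∫ D, vStat₂ (truncA d C₁ C₂) (truncY d C₁ C₂) (W.obsKernel l) D
        ∂(Measure.pi fun _ : Fin n => P) =
      (1 - 1 / n) * W.projInner l p b + 1 / n * W.diagMean C₁ C₂ P l := by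
  have := hR.prob
  obtain ⟨C, hC1, hCk⟩ := W.exists_kernel_bound d
  rw [integral_vStat₂ (measurable_truncA C₁ C₂) (measurable_truncY C₁ C₂) (measurable_obsKernel hl)
    (abs_truncA_le hC) (abs_truncY_le hC) ((abs_nonneg _).trans (le_max_left _ _))
    (fun o o' => (hCk l hl _ (clampCube_mem o.X)).1 _ (clampCube_mem o'.X)) hn]
  congr 2
  have e : ∀ o : Obs d, ∫ o', truncA d C₁ C₂ o * truncY d C₁ C₂ o' * W.obsKernel l o o' ∂P =
      truncA d C₁ C₂ o * W.proj l b (clampCube o.X) := fun o => by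
    simp_rw [mul_assoc]
    rw [integral_const_mul, ← integral_truncY_mul_obsKernel hR hl]
    simp_rw [fun o' => W.obsKernel_comm l o' o]
  simp_rw [e]
  refine (hR.integral_A _ (continuousOn_proj hl hR.contb)).trans ?_
  rw [projInner_comm, ← integral_proj_mul hl hR.contb hR.contp]
  simp only [mul_comm]

theorem integral_vStat₃_obs (hR : IsRegression C₁ C₂ P p b) (hC : C₁ ≤ C₂) {l₁ l₂ n : ℕ}
    (hl₁ : W.J₀ ≤ l₁) (hl₂ : W.J₀ ≤ l₂) (hn : 0 < n) :
    ∫ D, vStat₃ (truncA d C₁ C₂) (truncY d C₁ C₂) (W.obsKernel l₁) (W.obsKernel l₂) D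
        ∂(Measure.pi fun _ : Fin n => P) =
      1 / (n : ℝ) ^ 2 * ((n - 1) * (n - 2) * W.projInner (min l₁ l₂) p b +
        (n - 1) * (W.crossMean p b l₁ l₂ + W.crossMean b p l₂ l₁ +
          W.diagMean C₁ C₂ P (min l₁ l₂)) + W.diagMean₂ C₁ C₂ P l₁ l₂) := by
  have := hR.prob
  obtain ⟨C, hC1, hCk⟩ := W.exists_kernel_bound d
  rw [integral_vStat₃ (measurable_truncA C₁ C₂) (measurable_truncY C₁ C₂)
    (measurable_obsKernel hl₁) (measurable_obsKernel hl₂)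
    (abs_truncA_le hC) (abs_truncY_le hC) ((abs_nonneg _).trans (le_max_left _ _))
    (mul_nonneg (by linarith) (resolution_pos d l₁).le)
    (fun o o' => (hCk l₁ hl₁ _ (clampCube_mem o.X)).1 _ (clampCube_mem o'.X))
    (fun o o' => (hCk l₂ hl₂ _ (clampCube_mem o.X)).1 _ (clampCube_mem o'.X)) hn]
  simp_rw [integral_truncA_mul_obsKernel hR hl₁, integral_truncY_mul_obsKernel hR hl₂,
    integral_obsKernel_mul_obsKernel hR hl₁ hl₂]
  have cp := continuousOn_proj (W := W) hl₁ hR.contp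
  have cb := continuousOn_proj (W := W) hl₂ hR.contb
  have e₄ : ∫ o, W.proj l₁ p (clampCube (Obs.X o)) * W.proj l₂ b (clampCube (Obs.X o)) ∂P =
      W.projInner (min l₁ l₂) p b :=
    (hR.integral_X _ (cp.mul cb)).trans (integral_proj_mul_proj hl₁ hl₂ hR.contp hR.contb)
  have e₁ : ∫ o, truncA d C₁ C₂ o * W.obsKernel l₁ o o * W.proj l₂ b (clampCube o.X) ∂P =
      W.crossMean p b l₁ l₂ := by
    simp_rw [mul_assoc]
    exact hR.integral_A _ ((continuousOn_kernel_self hl₁).mul cb)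
  have e₂ : ∫ o, W.proj l₁ p (clampCube o.X) * (truncY d C₁ C₂ o * W.obsKernel l₂ o o) ∂P =
      W.crossMean b p l₂ l₁ := by
    have e : ∀ o : Obs d, W.proj l₁ p (clampCube o.X) * (truncY d C₁ C₂ o * W.obsKernel l₂ o o) =
        truncY d C₁ C₂ o * (W.obsKernel l₂ o o * W.proj l₁ p (clampCube o.X)) := fun o => by ring
    simp_rw [e]
    exact hR.integral_Y _ ((continuousOn_kernel_self hl₂).mul cp)
  rw [e₄, e₁, e₂]
  rfl

/-! The estimators coincide almost surely with bounded V-statistics. -/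

theorem ae_forall_obs (hR : IsRegression C₁ C₂ P p b) (n : ℕ) :
    ∀ᵐ D ∂(Measure.pi fun _ : Fin n => P), ∀ i, (D i).X ∈ Icc (0 : Fin d → ℝ) 1 ∧
      (D i).A ∈ Icc C₁ C₂ ∧ (D i).Y ∈ Icc C₁ C₂ := by
  have := hR.prob
  rw [ae_all_iff]
  exact fun i => (measurePreserving_eval (fun _ : Fin n => P) i).quasiMeasurePreserving.ae hR.ae_mem

theorem vStat₁_obs_eq {n : ℕ} {D : Fin n → Obs d}
    (hD : ∀ i, (D i).X ∈ Icc (0 : Fin d → ℝ) 1 ∧ (D i).A ∈ Icc C₁ C₂ ∧ (D i).Y ∈ Icc C₁ C₂) :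
    vStat₁ (truncA d C₁ C₂) (truncY d C₁ C₂) D = 1 / (n : ℝ) * ∑ i, (D i).A * (D i).Y := by
  simp only [vStat₁, truncA, truncY, clampIcc_of_mem (hD _).2.1, clampIcc_of_mem (hD _).2.2]

theorem vStat₂_obs_eq {n : ℕ} {D : Fin n → Obs d}
    (hD : ∀ i, (D i).X ∈ Icc (0 : Fin d → ℝ) 1 ∧ (D i).A ∈ Icc C₁ C₂ ∧ (D i).Y ∈ Icc C₁ C₂)
    (l : ℕ) :
    vStat₂ (truncA d C₁ C₂) (truncY d C₁ C₂) (W.obsKernel l) D =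
      1 / (n : ℝ) ^ 2 * ∑ i, ∑ j, (D i).A * (D j).Y * W.kernel l (D i).X (D j).X := by
  simp only [vStat₂, truncA, truncY, clampIcc_of_mem (hD _).2.1, clampIcc_of_mem (hD _).2.2,
    obsKernel, clampCube_of_mem (hD _).1]

theorem vStat₃_obs_eq {n : ℕ} {D : Fin n → Obs d}
    (hD : ∀ i, (D i).X ∈ Icc (0 : Fin d → ℝ) 1 ∧ (D i).A ∈ Icc C₁ C₂ ∧ (D i).Y ∈ Icc C₁ C₂)
    (l₁ l₂ : ℕ) :
    vStat₃ (truncA d C₁ C₂) (truncY d C₁ C₂) (W.obsKernel l₁) (W.obsKernel l₂) D =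
      1 / (n : ℝ) * ∑ i, W.pHat l₁ D (D i).X * W.bHat l₂ D (D i).X := by
  simp only [vStat₃, truncA, truncY, clampIcc_of_mem (hD _).2.1, clampIcc_of_mem (hD _).2.2,
    obsKernel, clampCube_of_mem (hD _).1, pHat, bHat]
  rw [Finset.mul_sum, Finset.mul_sum]
  refine Finset.sum_congr rfl fun i _ => ?_
  rw [← Finset.sum_mul_sum]
  ring

theorem psiMC_ae_eq (hR : IsRegression C₁ C₂ P p b) (n l₁ l₂ : ℕ) :
    W.psiMC (n := n) l₁ l₂ =ᵐ[Measure.pi fun _ : Fin n => P] fun D =>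
      vStat₁ (truncA d C₁ C₂) (truncY d C₁ C₂) D -
      vStat₃ (truncA d C₁ C₂) (truncY d C₁ C₂) (W.obsKernel l₁) (W.obsKernel l₂) D := by
  filter_upwards [ae_forall_obs hR n] with D hD
  rw [vStat₁_obs_eq hD, vStat₃_obs_eq hD, psiMC]

theorem psiIF_ae_eq (hR : IsRegression C₁ C₂ P p b) (n l₁ l₂ : ℕ) :
    W.psiIF (n := n) l₁ l₂ =ᵐ[Measure.pi fun _ : Fin n => P] fun D =>
      (vStat₁ (truncA d C₁ C₂) (truncY d C₁ C₂) D -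
        vStat₂ (truncA d C₁ C₂) (truncY d C₁ C₂) (W.obsKernel l₂) D) -
      (vStat₂ (truncA d C₁ C₂) (truncY d C₁ C₂) (W.obsKernel l₁) D -
        vStat₃ (truncA d C₁ C₂) (truncY d C₁ C₂) (W.obsKernel l₁) (W.obsKernel l₂) D) := by
  filter_upwards [ae_forall_obs hR n] with D hD
  rw [vStat₁_obs_eq hD, vStat₂_obs_eq hD, vStat₂_obs_eq hD, vStat₃_obs_eq hD, psiIF]
  have e : ∀ i, ((D i).A - W.pHat l₁ D (D i).X) * ((D i).Y - W.bHat l₂ D (D i).X) =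
      (D i).A * (D i).Y - (D i).A * W.bHat l₂ D (D i).X -
        (W.pHat l₁ D (D i).X * (D i).Y - W.pHat l₁ D (D i).X * W.bHat l₂ D (D i).X) :=
    fun i => by ring
  have h₂ : 1 / (n : ℝ) * ∑ i, (D i).A * W.bHat l₂ D (D i).X =
      1 / (n : ℝ) ^ 2 * ∑ i, ∑ j, (D i).A * (D j).Y * W.kernel l₂ (D i).X (D j).X := by
    rw [Finset.mul_sum, Finset.mul_sum]
    refine Finset.sum_congr rfl fun i _ => ?_
    simp only [bHat, Finset.mul_sum]
    refine Finset.sum_congr rfl fun j _ => ?_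
    rw [W.kernel_comm]; ring
  have h₁ : 1 / (n : ℝ) * ∑ i, W.pHat l₁ D (D i).X * (D i).Y =
      1 / (n : ℝ) ^ 2 * ∑ i, ∑ j, (D i).A * (D j).Y * W.kernel l₁ (D i).X (D j).X := by
    rw [Finset.sum_comm, Finset.mul_sum, Finset.mul_sum]
    refine Finset.sum_congr rfl fun i _ => ?_
    simp only [pHat, Finset.mul_sum, Finset.sum_mul]
    refine Finset.sum_congr rfl fun j _ => ?_
    ring
  simp_rw [e, Finset.sum_sub_distrib, mul_sub]
  rw [h₁, h₂]

theorem psiINT_ae_eq (hR : IsRegression C₁ C₂ P p b) (n : ℕ) {l₁ l₂ : ℕ} (hl₁ : W.J₀ ≤ l₁)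
    (hl₂ : W.J₀ ≤ l₂) :
    W.psiINT (n := n) l₁ l₂ =ᵐ[Measure.pi fun _ : Fin n => P] fun D =>
      vStat₁ (truncA d C₁ C₂) (truncY d C₁ C₂) D -
      vStat₂ (truncA d C₁ C₂) (truncY d C₁ C₂) (W.obsKernel (min l₁ l₂)) D := by
  filter_upwards [ae_forall_obs hR n] with D hD
  rw [vStat₁_obs_eq hD, vStat₂_obs_eq hD, psiINT]
  congr 1
  have e : ∀ x, W.pHat l₁ D x * W.bHat l₂ D x = ∑ i, ∑ j, (1 / (n : ℝ) ^ 2 * ((D i).A * (D j).Y)) *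
      (W.kernel l₁ (D i).X x * W.kernel l₂ (D j).X x) := fun x => by
    simp only [pHat, bHat]
    rw [mul_mul_mul_comm, Finset.sum_mul_sum, Finset.mul_sum]
    refine Finset.sum_congr rfl fun i _ => ?_
    rw [Finset.mul_sum]
    exact Finset.sum_congr rfl fun j _ => by ring
  simp_rw [e]
  have hi : ∀ i j, IntegrableOn (fun x => W.kernel l₁ (D i).X x * W.kernel l₂ (D j).X x)
      (Icc (0 : Fin d → ℝ) 1) := fun i j =>
    integrableOn_cube_mul (continuousOn_kernel hl₁ _) (continuousOn_kernel hl₂ _)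
  rw [integral_finsetSum _ fun i _ => integrable_finsetSum _ fun j _ => (hi i j).const_mul _,
    Finset.mul_sum]
  refine Finset.sum_congr rfl fun i _ => ?_
  rw [integral_finsetSum _ fun j _ => (hi i j).const_mul _, Finset.mul_sum]
  refine Finset.sum_congr rfl fun j _ => ?_
  rw [integral_const_mul, integral_kernel_mul_kernel hl₁ hl₂ (hD i).1 (hD j).1]
  ring

theorem integrable_vStat₁_obs (hR : IsRegression C₁ C₂ P p b) (hC : C₁ ≤ C₂) (n : ℕ) :
    Integrable (vStat₁ (truncA d C₁ C₂) (truncY d C₁ C₂)) (Measure.pi fun _ : Fin n => P) := by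
  have := hR.prob
  refine integrable_of_measurable_of_bound
    (measurable_vStat₁ (measurable_truncA C₁ C₂) (measurable_truncY C₁ C₂))
    (B := |1 / (n : ℝ)| * ∑ _i : Fin n, max |C₁| |C₂| * max |C₁| |C₂|) fun D => ?_
  rw [vStat₁, abs_mul]
  refine mul_le_mul_of_nonneg_left ((Finset.abs_sum_le_sum_abs _ _).trans
    (Finset.sum_le_sum fun i _ => ?_)) (abs_nonneg _)
  rw [abs_mul]
  exact mul_le_mul (abs_truncA_le hC _) (abs_truncY_le hC _) (abs_nonneg _)
    ((abs_nonneg _).trans (le_max_left _ _))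

theorem integrable_vStat₂_obs (hR : IsRegression C₁ C₂ P p b) (hC : C₁ ≤ C₂) (n : ℕ) {l : ℕ}
    (hl : W.J₀ ≤ l) : Integrable (vStat₂ (truncA d C₁ C₂) (truncY d C₁ C₂) (W.obsKernel l))
      (Measure.pi fun _ : Fin n => P) := by
  have := hR.prob
  obtain ⟨C, hC1, hCk⟩ := W.exists_kernel_bound d
  have hB : 0 ≤ max |C₁| |C₂| := (abs_nonneg _).trans (le_max_left _ _)
  refine integrable_of_measurable_of_bound
    (measurable_vStat₂ (measurable_truncA C₁ C₂) (measurable_truncY C₁ C₂)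
      (measurable_obsKernel hl))
    (B := |1 / (n : ℝ) ^ 2| * ∑ _i : Fin n, ∑ _j : Fin n,
      max |C₁| |C₂| * max |C₁| |C₂| * (C * resolution d l)) fun D => ?_
  rw [vStat₂, abs_mul]
  refine mul_le_mul_of_nonneg_left ((Finset.abs_sum_le_sum_abs _ _).trans
    (Finset.sum_le_sum fun i _ => (Finset.abs_sum_le_sum_abs _ _).trans
    (Finset.sum_le_sum fun j _ => ?_))) (abs_nonneg _)
  rw [abs_mul, abs_mul]
  exact mul_le_mul (mul_le_mul (abs_truncA_le hC _) (abs_truncY_le hC _) (abs_nonneg _) hB)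
    ((hCk l hl _ (clampCube_mem _)).1 _ (clampCube_mem _)) (abs_nonneg _) (mul_nonneg hB hB)

theorem integrable_vStat₃_obs (hR : IsRegression C₁ C₂ P p b) (hC : C₁ ≤ C₂) (n : ℕ) {l₁ l₂ : ℕ}
    (hl₁ : W.J₀ ≤ l₁) (hl₂ : W.J₀ ≤ l₂) :
    Integrable (vStat₃ (truncA d C₁ C₂) (truncY d C₁ C₂) (W.obsKernel l₁) (W.obsKernel l₂))
      (Measure.pi fun _ : Fin n => P) := by
  have := hR.prob
  obtain ⟨C, hC1, hCk⟩ := W.exists_kernel_bound d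
  have hB : 0 ≤ max |C₁| |C₂| := (abs_nonneg _).trans (le_max_left _ _)
  have hr₁ := (resolution_pos d l₁).le
  have hr₂ := (resolution_pos d l₂).le
  refine integrable_of_measurable_of_bound
    (measurable_vStat₃ (measurable_truncA C₁ C₂) (measurable_truncY C₁ C₂)
      (measurable_obsKernel hl₁) (measurable_obsKernel hl₂))
    (B := |1 / (n : ℝ) ^ 3| * ∑ _i : Fin n, ∑ _j : Fin n, ∑ _l : Fin n,
      max |C₁| |C₂| * (C * resolution d l₁) * (max |C₁| |C₂| * (C * resolution d l₂))) fun D => ?_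
  rw [vStat₃, abs_mul]
  refine mul_le_mul_of_nonneg_left ((Finset.abs_sum_le_sum_abs _ _).trans
    (Finset.sum_le_sum fun i _ => (Finset.abs_sum_le_sum_abs _ _).trans
    (Finset.sum_le_sum fun j _ => (Finset.abs_sum_le_sum_abs _ _).trans
    (Finset.sum_le_sum fun l _ => ?_)))) (abs_nonneg _)
  rw [abs_mul, abs_mul, abs_mul]
  exact mul_le_mul (mul_le_mul (abs_truncA_le hC _)
      ((hCk l₁ hl₁ _ (clampCube_mem _)).1 _ (clampCube_mem _)) (abs_nonneg _) hB)
    (mul_le_mul (abs_truncY_le hC _)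
      ((hCk l₂ hl₂ _ (clampCube_mem _)).1 _ (clampCube_mem _)) (abs_nonneg _) hB)
    (by positivity) (by positivity)

/-- The bias of the integral-based estimator: approximation error plus diagonal terms. -/
theorem bias_psiINT (hR : IsRegression C₁ C₂ P p b) (hC : C₁ ≤ C₂) {n l₁ l₂ : ℕ}
    (hl₁ : W.J₀ ≤ l₁) (hl₂ : W.J₀ ≤ l₂) (hn : 0 < n) :
    ∫ D, (W.psiINT l₁ l₂ D - psi P) ∂(Measure.pi fun _ : Fin n => P) =
      ((∫ x in Icc (0 : Fin d → ℝ) 1, p x * b x) - W.projInner (min l₁ l₂) p b) +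
        1 / n * (W.projInner (min l₁ l₂) p b - W.diagMean C₁ C₂ P (min l₁ l₂)) := by
  have := hR.prob
  have i1 := integrable_vStat₁_obs hR hC n
  have i2 := integrable_vStat₂_obs hR hC n (le_min hl₁ hl₂)
  have e : ∫ D, (W.psiINT l₁ l₂ D - psi P) ∂(Measure.pi fun _ : Fin n => P) =
      ∫ D, (vStat₁ (truncA d C₁ C₂) (truncY d C₁ C₂) D -
        vStat₂ (truncA d C₁ C₂) (truncY d C₁ C₂) (W.obsKernel (min l₁ l₂)) D - psi P)
        ∂(Measure.pi fun _ : Fin n => P) :=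
    integral_congr_ae ((psiINT_ae_eq hR n hl₁ hl₂).mono fun D hD => by simp only [hD])
  have i3 : Integrable (fun D => vStat₁ (truncA d C₁ C₂) (truncY d C₁ C₂) D -
      vStat₂ (truncA d C₁ C₂) (truncY d C₁ C₂) (W.obsKernel (min l₁ l₂)) D)
      (Measure.pi fun _ : Fin n => P) := i1.sub i2
  rw [e, integral_sub i3 (integrable_const _), integral_sub i1 i2,
    integral_vStat₁ (measurable_truncA C₁ C₂) (measurable_truncY C₁ C₂) (abs_truncA_le hC)
      (abs_truncY_le hC) hn, integral_vStat₂_obs hR hC (le_min hl₁ hl₂) hn, hR.psi_eq]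
  simp only [integral_const, probReal_univ, one_smul, truncA, truncY]
  ring

/-- The bias of the Monte Carlo estimator: approximation error plus terms with coinciding
indices. -/
theorem bias_psiMC (hR : IsRegression C₁ C₂ P p b) (hC : C₁ ≤ C₂) {n l₁ l₂ : ℕ}
    (hl₁ : W.J₀ ≤ l₁) (hl₂ : W.J₀ ≤ l₂) (hn : 0 < n) :
    ∫ D, (W.psiMC l₁ l₂ D - psi P) ∂(Measure.pi fun _ : Fin n => P) =
      (∫ x in Icc (0 : Fin d → ℝ) 1, p x * b x) -
      1 / (n : ℝ) ^ 2 * ((n - 1) * (n - 2) * W.projInner (min l₁ l₂) p b +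
        (n - 1) * (W.crossMean p b l₁ l₂ + W.crossMean b p l₂ l₁ +
          W.diagMean C₁ C₂ P (min l₁ l₂)) + W.diagMean₂ C₁ C₂ P l₁ l₂) := by
  have := hR.prob
  have i1 := integrable_vStat₁_obs hR hC n
  have i2 := integrable_vStat₃_obs hR hC n hl₁ hl₂
  have e : ∫ D, (W.psiMC l₁ l₂ D - psi P) ∂(Measure.pi fun _ : Fin n => P) =
      ∫ D, (vStat₁ (truncA d C₁ C₂) (truncY d C₁ C₂) D -
        vStat₃ (truncA d C₁ C₂) (truncY d C₁ C₂) (W.obsKernel l₁) (W.obsKernel l₂) D - psi P)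
        ∂(Measure.pi fun _ : Fin n => P) :=
    integral_congr_ae ((psiMC_ae_eq (W := W) hR n l₁ l₂).mono fun D hD => by simp only [hD])
  have i3 : Integrable (fun D => vStat₁ (truncA d C₁ C₂) (truncY d C₁ C₂) D -
      vStat₃ (truncA d C₁ C₂) (truncY d C₁ C₂) (W.obsKernel l₁) (W.obsKernel l₂) D)
      (Measure.pi fun _ : Fin n => P) := i1.sub i2
  rw [e, integral_sub i3 (integrable_const _), integral_sub i1 i2,
    integral_vStat₁ (measurable_truncA C₁ C₂) (measurable_truncY C₁ C₂) (abs_truncA_le hC)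
      (abs_truncY_le hC) hn, integral_vStat₃_obs hR hC hl₁ hl₂ hn, hR.psi_eq]
  simp only [integral_const, probReal_univ, one_smul, truncA, truncY]
  ring

/-- The bias of the bias-corrected estimator: the expectations of both double sums are subtracted, that
of the triple sum is added. -/
theorem bias_psiIF (hR : IsRegression C₁ C₂ P p b) (hC : C₁ ≤ C₂) {n l₁ l₂ : ℕ}
    (hl₁ : W.J₀ ≤ l₁) (hl₂ : W.J₀ ≤ l₂) (hn : 0 < n) :
    ∫ D, (W.psiIF l₁ l₂ D - psi P) ∂(Measure.pi fun _ : Fin n => P) =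
      (∫ x in Icc (0 : Fin d → ℝ) 1, p x * b x) -
      ((1 - 1 / n) * W.projInner l₁ p b + 1 / n * W.diagMean C₁ C₂ P l₁) -
      ((1 - 1 / n) * W.projInner l₂ p b + 1 / n * W.diagMean C₁ C₂ P l₂) +
      1 / (n : ℝ) ^ 2 * ((n - 1) * (n - 2) * W.projInner (min l₁ l₂) p b +
        (n - 1) * (W.crossMean p b l₁ l₂ + W.crossMean b p l₂ l₁ +
          W.diagMean C₁ C₂ P (min l₁ l₂)) + W.diagMean₂ C₁ C₂ P l₁ l₂) := by
  have := hR.prob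
  have i1 := integrable_vStat₁_obs hR hC n
  have i2 := integrable_vStat₂_obs hR hC n hl₂
  have i2' := integrable_vStat₂_obs hR hC n hl₁
  have i3 := integrable_vStat₃_obs hR hC n hl₁ hl₂
  have e : ∫ D, (W.psiIF l₁ l₂ D - psi P) ∂(Measure.pi fun _ : Fin n => P) =
      ∫ D, ((vStat₁ (truncA d C₁ C₂) (truncY d C₁ C₂) D -
        vStat₂ (truncA d C₁ C₂) (truncY d C₁ C₂) (W.obsKernel l₂) D) -
      (vStat₂ (truncA d C₁ C₂) (truncY d C₁ C₂) (W.obsKernel l₁) D -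
        vStat₃ (truncA d C₁ C₂) (truncY d C₁ C₂) (W.obsKernel l₁) (W.obsKernel l₂) D) - psi P)
        ∂(Measure.pi fun _ : Fin n => P) :=
    integral_congr_ae ((psiIF_ae_eq (W := W) hR n l₁ l₂).mono fun D hD => by simp only [hD])
  have i4 : Integrable (fun D => vStat₁ (truncA d C₁ C₂) (truncY d C₁ C₂) D -
        vStat₂ (truncA d C₁ C₂) (truncY d C₁ C₂) (W.obsKernel l₂) D)
      (Measure.pi fun _ : Fin n => P) := i1.sub i2
  have i5 : Integrable (fun D => vStat₂ (truncA d C₁ C₂) (truncY d C₁ C₂) (W.obsKernel l₁) D -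
        vStat₃ (truncA d C₁ C₂) (truncY d C₁ C₂) (W.obsKernel l₁) (W.obsKernel l₂) D)
      (Measure.pi fun _ : Fin n => P) := i2'.sub i3
  have i6 : Integrable (fun D => (vStat₁ (truncA d C₁ C₂) (truncY d C₁ C₂) D -
        vStat₂ (truncA d C₁ C₂) (truncY d C₁ C₂) (W.obsKernel l₂) D) -
      (vStat₂ (truncA d C₁ C₂) (truncY d C₁ C₂) (W.obsKernel l₁) D -
        vStat₃ (truncA d C₁ C₂) (truncY d C₁ C₂) (W.obsKernel l₁) (W.obsKernel l₂) D))
      (Measure.pi fun _ : Fin n => P) := i4.sub i5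
  rw [e, integral_sub i6 (integrable_const _), integral_sub i4 i5, integral_sub i1 i2,
    integral_sub i2' i3,
    integral_vStat₁ (measurable_truncA C₁ C₂) (measurable_truncY C₁ C₂) (abs_truncA_le hC)
      (abs_truncY_le hC) hn, integral_vStat₂_obs hR hC hl₁ hn, integral_vStat₂_obs hR hC hl₂ hn,
    integral_vStat₃_obs hR hC hl₁ hl₂ hn, hR.psi_eq]
  simp only [integral_const, probReal_univ, one_smul, truncA, truncY]
  ring

theorem abs_proj_le {l : ℕ} (hl : W.J₀ ≤ l) {C : ℝ}
    (hC : ∀ x ∈ Icc (0 : Fin d → ℝ) 1, ∫ y in Icc (0 : Fin d → ℝ) 1, |W.kernel l x y| ≤ C)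
    {h : (Fin d → ℝ) → ℝ} {B : ℝ} (hB : 0 ≤ B)
    (hh : ∀ᵐ x ∂(volume : Measure (Fin d → ℝ)).restrict (Icc 0 1), |h x| ≤ B)
    {x : Fin d → ℝ} (hx : x ∈ Icc (0 : Fin d → ℝ) 1) : |W.proj l h x| ≤ C * B := by
  calc |W.proj l h x| ≤ ∫ y in Icc (0 : Fin d → ℝ) 1, |W.kernel l x y * h y| :=
        abs_integral_le_integral_abs
    _ ≤ ∫ y in Icc (0 : Fin d → ℝ) 1, |W.kernel l x y| * B := by
        refine integral_mono_of_nonneg (Eventually.of_forall fun _ => abs_nonneg _)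
          ((integrableOn_cube (continuousOn_kernel hl x).abs).mul_const B) ?_
        filter_upwards [hh] with y hy
        rw [abs_mul]
        exact mul_le_mul_of_nonneg_left hy (abs_nonneg _)
    _ ≤ C * B := by
        rw [integral_mul_const]
        exact mul_le_mul_of_nonneg_right (hC x hx) hB

theorem abs_setIntegral_cube_le {h : (Fin d → ℝ) → ℝ} {B : ℝ}
    (hh : ∀ᵐ x ∂(volume : Measure (Fin d → ℝ)).restrict (Icc 0 1), |h x| ≤ B) :
    |∫ x in Icc (0 : Fin d → ℝ) 1, h x| ≤ B := by
  have := norm_integral_le_of_norm_le_const (f := h) (C := B)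
    (μ := (volume : Measure (Fin d → ℝ)).restrict (Icc 0 1)) hh
  simpa using this

/-- Bounds on the ingredients of the bias, with constants that do not depend on the law. -/
theorem bias_term_bounds (hR : IsRegression C₁ C₂ P p b) (hC : C₁ ≤ C₂) {K : ℝ} (hK : 1 ≤ K)
    (hCk : ∀ l, W.J₀ ≤ l → ∀ x ∈ Icc (0 : Fin d → ℝ) 1, (∀ y ∈ Icc (0 : Fin d → ℝ) 1,
      |W.kernel l x y| ≤ K * resolution d l) ∧
      ∫ y in Icc (0 : Fin d → ℝ) 1, |W.kernel l x y| ≤ K) {l₁ l₂ : ℕ}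
    (hl₁ : W.J₀ ≤ l₁) (hl₂ : W.J₀ ≤ l₂) :
    |W.projInner l₁ p b| ≤ (max |C₁| |C₂| * K) ^ 2 ∧
    |W.diagMean C₁ C₂ P l₁| ≤ (max |C₁| |C₂| * K) ^ 2 * resolution d l₁ ∧
    |W.crossMean p b l₁ l₂| ≤ (max |C₁| |C₂| * K) ^ 2 * resolution d l₁ ∧
    |W.crossMean b p l₁ l₂| ≤ (max |C₁| |C₂| * K) ^ 2 * resolution d l₁ ∧
    |W.diagMean₂ C₁ C₂ P l₁ l₂| ≤
      (max |C₁| |C₂| * K) ^ 2 * (resolution d l₁ * resolution d l₂) := by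
  have := hR.prob
  set B := max |C₁| |C₂| with hB
  have hB0 : 0 ≤ B := (abs_nonneg _).trans (le_max_left _ _)
  have hK0 : 0 ≤ K := by linarith
  have hr₁ := (resolution_pos d l₁).le
  have hr₂ := (resolution_pos d l₂).le
  have hBK : B * B * K ≤ (B * K) ^ 2 := by nlinarith [mul_nonneg (mul_nonneg hB0 hB0) hK0]
  have hk₁ : ∀ o : Obs d, |W.obsKernel l₁ o o| ≤ K * resolution d l₁ := fun o =>
    (hCk l₁ hl₁ _ (clampCube_mem o.X)).1 _ (clampCube_mem o.X)
  have hk₂ : ∀ o : Obs d, |W.obsKernel l₂ o o| ≤ K * resolution d l₂ := fun o =>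
    (hCk l₂ hl₂ _ (clampCube_mem o.X)).1 _ (clampCube_mem o.X)
  have cross : ∀ {r h : (Fin d → ℝ) → ℝ},
      (∀ᵐ x ∂(volume : Measure (Fin d → ℝ)).restrict (Icc 0 1), |r x| ≤ B) →
      (∀ᵐ x ∂(volume : Measure (Fin d → ℝ)).restrict (Icc 0 1), |h x| ≤ B) →
      |W.crossMean r h l₁ l₂| ≤ (B * K) ^ 2 * resolution d l₁ := by
    intro r h hr hh
    refine abs_setIntegral_cube_le ?_
    filter_upwards [hr, ae_restrict_mem measurableSet_Icc] with x h1 hx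
    rw [abs_mul, abs_mul]
    have h3 := (hCk l₁ hl₁ x hx).1 x hx
    have h4 := abs_proj_le hl₂ (fun x hx => (hCk l₂ hl₂ x hx).2) hB0 hh hx
    calc |r x| * (|W.kernel l₁ x x| * |W.proj l₂ h x|)
        ≤ B * ((K * resolution d l₁) * (K * B)) := by gcongr
      _ = _ := by ring
  refine ⟨?_, ?_, cross hR.abs_p_le hR.abs_b_le, cross hR.abs_b_le hR.abs_p_le, ?_⟩
  · rw [← integral_proj_mul hl₁ hR.contp hR.contb]
    refine (abs_setIntegral_cube_le (B := K * B * B) ?_).trans (by linarith)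
    filter_upwards [hR.abs_b_le, ae_restrict_mem measurableSet_Icc] with x h2 hx
    rw [abs_mul]
    exact mul_le_mul (abs_proj_le hl₁ (fun x hx => (hCk l₁ hl₁ x hx).2) hB0 hR.abs_p_le hx) h2
      (abs_nonneg _) (by positivity)
  · refine (abs_integral_le_of_bound (P := P) (B := B * B * (K * resolution d l₁)) fun o => ?_).trans
      ?_
    · rw [abs_mul, abs_mul]
      exact mul_le_mul (mul_le_mul (abs_truncA_le hC _) (abs_truncY_le hC _) (abs_nonneg _) hB0)
        (hk₁ o) (abs_nonneg _) (by positivity)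
    · rw [← mul_assoc]
      exact mul_le_mul_of_nonneg_right hBK hr₁
  · refine (abs_integral_le_of_bound (P := P)
      (B := B * (K * resolution d l₁) * (B * (K * resolution d l₂))) fun o => ?_).trans
      (le_of_eq (by ring))
    rw [abs_mul, abs_mul, abs_mul]
    exact mul_le_mul (mul_le_mul (abs_truncA_le hC _) (hk₁ o) (abs_nonneg _) hB0)
      (mul_le_mul (abs_truncY_le hC _) (hk₂ o) (abs_nonneg _) hB0) (by positivity) (by positivity)

end Regression

end CDVBasis

/-! ### Variance of the estimators -/

theorem evariance_sub_le {Ω : Type*} [MeasurableSpace Ω] {μ : Measure Ω} {X Y : Ω → ℝ}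
    (hX : Integrable X μ) (hY : Integrable Y μ) :
    ProbabilityTheory.evariance (fun ω => X ω - Y ω) μ ≤
      2 * (ProbabilityTheory.evariance X μ + ProbabilityTheory.evariance Y μ) := by
  have hs : ∀ x y : ℝ, ‖x - y‖ₑ ^ 2 ≤ 2 * (‖x‖ₑ ^ 2 + ‖y‖ₑ ^ 2) := fun x y => by
    simp only [Real.enorm_eq_ofReal_abs]
    rw [← ENNReal.ofReal_pow (abs_nonneg _), ← ENNReal.ofReal_pow (abs_nonneg _),
      ← ENNReal.ofReal_pow (abs_nonneg _), ← ENNReal.ofReal_add (by positivity) (by positivity),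
      ← ENNReal.ofReal_ofNat, ← ENNReal.ofReal_mul (by norm_num)]
    refine ENNReal.ofReal_le_ofReal ?_
    simp only [sq_abs]
    nlinarith [sq_nonneg (x + y)]
  unfold ProbabilityTheory.evariance
  have hm : AEMeasurable (fun ω => ‖X ω - ∫ ω, X ω ∂μ‖ₑ ^ 2) μ :=
    (hX.aemeasurable.sub_const _).enorm.pow_const _
  rw [← lintegral_add_left' hm, ← lintegral_const_mul' _ _ (by norm_num), integral_sub hX hY]
  refine lintegral_mono fun ω => ?_
  rw [sub_sub_sub_comm]
  exact hs _ _

namespace CDVBasis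

variable {S : ℕ} {W : CDVBasis S} {d : ℕ}

variable (W) in
/-- `K` bounds the projection kernels relative to the resolution, and their integrals in one
variable. -/
def IsKernelBound (d : ℕ) (K : ℝ) : Prop :=
  1 ≤ K ∧ ∀ l, W.J₀ ≤ l → ∀ x ∈ Icc (0 : Fin d → ℝ) 1,
    (∀ y ∈ Icc (0 : Fin d → ℝ) 1, |W.kernel l x y| ≤ K * resolution d l) ∧
      ∫ y in Icc (0 : Fin d → ℝ) 1, |W.kernel l x y| ≤ K

/-- A bound for the order of the variance of the Monte Carlo and of the bias-corrected estimator, in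
terms of the sample size and the two resolutions. -/
noncomputable def varRate (d n l₁ l₂ : ℕ) : ℝ :=
  1 / (n : ℝ) + kMax d l₁ l₂ ^ 2 / (n : ℝ) ^ 3 +
    kMin d l₁ l₂ ^ 2 * kMax d l₁ l₂ ^ 2 / (n : ℝ) ^ 5

section Regression

variable {C₁ C₂ : ℝ} {P : Measure (Obs d)} {p b : (Fin d → ℝ) → ℝ} {K : ℝ}

theorem evariance_vStat₁_obs_le (hR : IsRegression C₁ C₂ P p b) (hC : C₁ ≤ C₂) (hK : 1 ≤ K)
    {n : ℕ} (hn : 0 < n) :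
    ProbabilityTheory.evariance (vStat₁ (truncA d C₁ C₂) (truncY d C₁ C₂))
      (Measure.pi fun _ : Fin n => P) ≤ ENNReal.ofReal ((max |C₁| |C₂| * K) ^ 4 * (1 / n)) := by
  have := hR.prob
  have hn' : (0 : ℝ) < n := by exact_mod_cast hn
  refine (evariance_vStat₁_le (measurable_truncA C₁ C₂) (measurable_truncY C₁ C₂)
    (abs_truncA_le hC) (abs_truncY_le hC)).trans (ENNReal.ofReal_le_ofReal ?_)
  calc (n : ℝ) * (max |C₁| |C₂| ^ 2 / n) ^ 2 = max |C₁| |C₂| ^ 4 * (1 / n) := by field_simp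
    _ ≤ (max |C₁| |C₂| * K) ^ 4 * (1 / n) := by
      have : (1 : ℝ) ≤ K ^ 4 := one_le_pow₀ hK
      rw [mul_pow]
      refine mul_le_mul_of_nonneg_right ?_ (by positivity)
      exact le_mul_of_one_le_right (by positivity) this

theorem evariance_vStat₂_obs_le (hR : IsRegression C₁ C₂ P p b) (hC : C₁ ≤ C₂)
    (hK : W.IsKernelBound d K) {l n : ℕ} (hl : W.J₀ ≤ l) (hn : 0 < n) :
    ProbabilityTheory.evariance (vStat₂ (truncA d C₁ C₂) (truncY d C₁ C₂) (W.obsKernel l))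
      (Measure.pi fun _ : Fin n => P) ≤ ENNReal.ofReal (128 * (max |C₁| |C₂| * K) ^ 4 *
        (1 / n + resolution d l ^ 2 / (n : ℝ) ^ 3)) := by
  have := hR.prob
  have hn' : (0 : ℝ) < n := by exact_mod_cast hn
  have hK0 : 0 ≤ K := by linarith [hK.1]
  have hk := (resolution_pos d l).le
  refine (evariance_vStat₂_le (c := K * resolution d l) (measurable_truncA C₁ C₂)
    (measurable_truncY C₁ C₂) (measurable_obsKernel hl) (obsKernel_comm l)
    (abs_truncA_le hC) (abs_truncY_le hC) ((abs_nonneg _).trans (le_max_left _ _))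
    (mul_nonneg hK0 hk) hK0
    (fun o o' => (hK.2 l hl _ (clampCube_mem o.X)).1 _ (clampCube_mem o'.X))
    (lintegral_obsKernel_le hR hl fun x hx => (hK.2 l hl x hx).2)).trans
    (ENNReal.ofReal_le_ofReal ?_)
  set B := max |C₁| |C₂|
  set k := resolution d l
  calc (n : ℝ) * (2 * (B ^ 2 / n ^ 2) * (4 * (K * k) + n * K)) ^ 2
      = 4 * (B ^ 4 * K ^ 2) / n ^ 3 * (4 * k + n) ^ 2 := by field_simp; ring
    _ ≤ 4 * (B ^ 4 * K ^ 4) / n ^ 3 * (32 * (k ^ 2 + n ^ 2)) := by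
        have h1 : K ^ 2 ≤ K ^ 4 := pow_le_pow_right₀ hK.1 (by norm_num)
        have h2 : (4 * k + n) ^ 2 ≤ 32 * (k ^ 2 + n ^ 2) := by
          nlinarith [sq_nonneg (4 * k - n), sq_nonneg (n : ℝ)]
        gcongr
    _ = _ := by field_simp; ring

theorem evariance_vStat₃_obs_le (hR : IsRegression C₁ C₂ P p b) (hC : C₁ ≤ C₂)
    (hK : W.IsKernelBound d K) {l₁ l₂ n : ℕ} (hl₁ : W.J₀ ≤ l₁) (hl₂ : W.J₀ ≤ l₂) (hn : 0 < n) :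
    ProbabilityTheory.evariance
      (vStat₃ (truncA d C₁ C₂) (truncY d C₁ C₂) (W.obsKernel l₁) (W.obsKernel l₂))
      (Measure.pi fun _ : Fin n => P) ≤
        ENNReal.ofReal (18432 * (max |C₁| |C₂| * K) ^ 4 * varRate d n l₁ l₂) := by
  have := hR.prob
  have hn' : (0 : ℝ) < n := by exact_mod_cast hn
  have hK0 : 0 ≤ K := by linarith [hK.1]
  have hk₁ := (resolution_pos d l₁).le
  have hk₂ := (resolution_pos d l₂).le
  refine (evariance_vStat₃_le (c₁ := K * resolution d l₁) (c₂ := K * resolution d l₂)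
    (measurable_truncA C₁ C₂) (measurable_truncY C₁ C₂) (measurable_obsKernel hl₁)
    (measurable_obsKernel hl₂) (obsKernel_comm l₁) (obsKernel_comm l₂)
    (abs_truncA_le hC) (abs_truncY_le hC) ((abs_nonneg _).trans (le_max_left _ _))
    (mul_nonneg hK0 hk₁) (mul_nonneg hK0 hk₂) hK0
    (fun o o' => (hK.2 l₁ hl₁ _ (clampCube_mem o.X)).1 _ (clampCube_mem o'.X))
    (fun o o' => (hK.2 l₂ hl₂ _ (clampCube_mem o.X)).1 _ (clampCube_mem o'.X))
    (lintegral_obsKernel_le hR hl₁ fun x hx => (hK.2 l₁ hl₁ x hx).2)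
    (lintegral_obsKernel_le hR hl₂ fun x hx => (hK.2 l₂ hl₂ x hx).2)).trans
    (ENNReal.ofReal_le_ofReal ?_)
  have hmm : kMin d l₁ l₂ ^ 2 * kMax d l₁ l₂ ^ 2 = resolution d l₁ ^ 2 * resolution d l₂ ^ 2 := by
    rw [← mul_pow, kMin_mul_kMax, mul_pow]
  have hm₁ : resolution d l₁ ^ 2 ≤ kMax d l₁ l₂ ^ 2 := pow_le_pow_left₀ hk₁ (le_max_left _ _) 2
  have hm₂ : resolution d l₂ ^ 2 ≤ kMax d l₁ l₂ ^ 2 := pow_le_pow_left₀ hk₂ (le_max_right _ _) 2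
  rw [varRate, hmm]
  set B := max |C₁| |C₂|
  set k₁ := resolution d l₁
  set k₂ := resolution d l₂
  set k := kMax d l₁ l₂
  have h : ∀ t : ℝ, (4 * t + n) ^ 2 ≤ 32 * (t ^ 2 + n ^ 2) := fun t => by
    nlinarith [sq_nonneg (4 * t - n), sq_nonneg (n : ℝ)]
  calc (n : ℝ) * (9 * (B ^ 2 / n ^ 3 * ((4 * (K * k₁) + n * K) * (4 * (K * k₂) + n * K))) ^ 2)
      = 9 * (B ^ 4 * K ^ 4) / n ^ 5 * ((4 * k₁ + n) ^ 2 * (4 * k₂ + n) ^ 2) := by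
        field_simp
    _ ≤ 9 * (B ^ 4 * K ^ 4) / n ^ 5 * (32 * (k₁ ^ 2 + n ^ 2) * (32 * (k₂ ^ 2 + n ^ 2))) := by
        gcongr
        · exact h _
        · exact h _
    _ = 9216 * (B ^ 4 * K ^ 4) / n ^ 5 * (k₁ ^ 2 * k₂ ^ 2 + n ^ 2 * (k₁ ^ 2 + k₂ ^ 2) + n ^ 4) := by
        ring
    _ ≤ 9216 * (B ^ 4 * K ^ 4) / n ^ 5 *
          (2 * (k₁ ^ 2 * k₂ ^ 2) + n ^ 2 * (2 * k ^ 2) + 2 * n ^ 4) := by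
        have : 0 ≤ k₁ ^ 2 * k₂ ^ 2 := by positivity
        have h4 : (0 : ℝ) ≤ n ^ 4 := by positivity
        refine mul_le_mul_of_nonneg_left (add_le_add (add_le_add (by linarith)
          (mul_le_mul_of_nonneg_left (by linarith) (by positivity))) (by linarith)) (by positivity)
    _ = _ := by field_simp; ring

theorem evariance_psiINT_le (hR : IsRegression C₁ C₂ P p b) (hC : C₁ ≤ C₂)
    (hK : W.IsKernelBound d K) {l₁ l₂ n : ℕ} (hl₁ : W.J₀ ≤ l₁) (hl₂ : W.J₀ ≤ l₂) (hn : 0 < n) :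
    ProbabilityTheory.evariance (W.psiINT l₁ l₂) (Measure.pi fun _ : Fin n => P) ≤
      ENNReal.ofReal (258 * (max |C₁| |C₂| * K) ^ 4 *
        (1 / n + kMin d l₁ l₂ ^ 2 / (n : ℝ) ^ 2)) := by
  have hn' : (1 : ℝ) ≤ n := by exact_mod_cast hn
  rw [ProbabilityTheory.evariance_congr (psiINT_ae_eq hR n hl₁ hl₂)]
  refine (evariance_sub_le (integrable_vStat₁_obs hR hC n)
    (integrable_vStat₂_obs hR hC n (le_min hl₁ hl₂))).trans ?_
  refine (mul_le_mul_right (add_le_add (evariance_vStat₁_obs_le hR hC hK.1 hn)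
    (evariance_vStat₂_obs_le hR hC hK (le_min hl₁ hl₂) hn)) 2).trans ?_
  rw [← ENNReal.ofReal_add (by positivity) (by positivity), ← ENNReal.ofReal_ofNat,
    ← ENNReal.ofReal_mul (by norm_num), kMin_eq]
  refine ENNReal.ofReal_le_ofReal ?_
  set L := (max |C₁| |C₂| * K) ^ 4
  set k := resolution d (min l₁ l₂)
  have hL : 0 ≤ L := by positivity
  have h1 : k ^ 2 / (n : ℝ) ^ 3 ≤ k ^ 2 / (n : ℝ) ^ 2 :=
    div_le_div_of_nonneg_left (by positivity) (by positivity)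
      (pow_le_pow_right₀ hn' (by norm_num))
  have h2 : 0 ≤ k ^ 2 / (n : ℝ) ^ 2 := by positivity
  nlinarith [mul_le_mul_of_nonneg_left h1 hL, mul_nonneg hL h2]

theorem one_div_add_sq_div_le_varRate (d : ℕ) {n l₁ l₂ l : ℕ} (h : resolution d l ≤ kMax d l₁ l₂) :
    1 / (n : ℝ) + resolution d l ^ 2 / (n : ℝ) ^ 3 ≤ varRate d n l₁ l₂ := by
  have h1 : resolution d l ^ 2 / (n : ℝ) ^ 3 ≤ kMax d l₁ l₂ ^ 2 / (n : ℝ) ^ 3 :=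
    div_le_div_of_nonneg_right (pow_le_pow_left₀ (resolution_pos d l).le h 2) (by positivity)
  have h2 : 0 ≤ kMin d l₁ l₂ ^ 2 * kMax d l₁ l₂ ^ 2 / (n : ℝ) ^ 5 := by positivity
  unfold varRate
  linarith

theorem one_div_le_varRate (d n l₁ l₂ : ℕ) : 1 / (n : ℝ) ≤ varRate d n l₁ l₂ := by
  have h1 : 0 ≤ kMax d l₁ l₂ ^ 2 / (n : ℝ) ^ 3 := by positivity
  have h2 : 0 ≤ kMin d l₁ l₂ ^ 2 * kMax d l₁ l₂ ^ 2 / (n : ℝ) ^ 5 := by positivity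
  unfold varRate
  linarith

theorem varRate_nonneg (d n l₁ l₂ : ℕ) : 0 ≤ varRate d n l₁ l₂ := by
  unfold varRate; positivity

theorem evariance_psiMC_le (hR : IsRegression C₁ C₂ P p b) (hC : C₁ ≤ C₂)
    (hK : W.IsKernelBound d K) {l₁ l₂ n : ℕ} (hl₁ : W.J₀ ≤ l₁) (hl₂ : W.J₀ ≤ l₂) (hn : 0 < n) :
    ProbabilityTheory.evariance (W.psiMC l₁ l₂) (Measure.pi fun _ : Fin n => P) ≤
      ENNReal.ofReal (75000 * (max |C₁| |C₂| * K) ^ 4 * varRate d n l₁ l₂) := by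
  have hv := varRate_nonneg d n l₁ l₂
  rw [ProbabilityTheory.evariance_congr (psiMC_ae_eq hR n l₁ l₂)]
  refine (evariance_sub_le (integrable_vStat₁_obs hR hC n)
    (integrable_vStat₃_obs hR hC n hl₁ hl₂)).trans ?_
  refine (mul_le_mul_right (add_le_add (evariance_vStat₁_obs_le hR hC hK.1 hn)
    (evariance_vStat₃_obs_le hR hC hK hl₁ hl₂ hn)) 2).trans ?_
  rw [← ENNReal.ofReal_add (by positivity) (by positivity), ← ENNReal.ofReal_ofNat,
    ← ENNReal.ofReal_mul (by norm_num)]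
  refine ENNReal.ofReal_le_ofReal ?_
  have hL : 0 ≤ (max |C₁| |C₂| * K) ^ 4 := by positivity
  nlinarith [mul_le_mul_of_nonneg_left (one_div_le_varRate d n l₁ l₂) hL, mul_nonneg hL hv]

theorem evariance_psiIF_le (hR : IsRegression C₁ C₂ P p b) (hC : C₁ ≤ C₂)
    (hK : W.IsKernelBound d K) {l₁ l₂ n : ℕ} (hl₁ : W.J₀ ≤ l₁) (hl₂ : W.J₀ ≤ l₂) (hn : 0 < n) :
    ProbabilityTheory.evariance (W.psiIF l₁ l₂) (Measure.pi fun _ : Fin n => P) ≤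
      ENNReal.ofReal (75000 * (max |C₁| |C₂| * K) ^ 4 * varRate d n l₁ l₂) := by
  have hv := varRate_nonneg d n l₁ l₂
  have i1 := integrable_vStat₁_obs hR hC n
  have i2 := integrable_vStat₂_obs hR hC n hl₂
  have i2' := integrable_vStat₂_obs hR hC n hl₁
  have i3 := integrable_vStat₃_obs hR hC n hl₁ hl₂
  rw [ProbabilityTheory.evariance_congr (psiIF_ae_eq (W := W) hR n l₁ l₂)]
  refine (evariance_sub_le (i1.sub i2) (i2'.sub i3)).trans ?_
  refine (mul_le_mul_right (add_le_add (evariance_sub_le i1 i2) (evariance_sub_le i2' i3))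
    2).trans ?_
  refine (mul_le_mul_right (add_le_add
    (mul_le_mul_right (add_le_add (evariance_vStat₁_obs_le hR hC hK.1 hn)
      (evariance_vStat₂_obs_le hR hC hK hl₂ hn)) 2)
    (mul_le_mul_right (add_le_add (evariance_vStat₂_obs_le hR hC hK hl₁ hn)
      (evariance_vStat₃_obs_le hR hC hK hl₁ hl₂ hn)) 2)) 2).trans ?_
  rw [← ENNReal.ofReal_add (by positivity) (by positivity),
    ← ENNReal.ofReal_add (by positivity) (by positivity), ← ENNReal.ofReal_ofNat,
    ← ENNReal.ofReal_mul (by norm_num), ← ENNReal.ofReal_mul (by norm_num),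
    ← ENNReal.ofReal_add (by positivity) (by positivity), ← ENNReal.ofReal_mul (by norm_num)]
  refine ENNReal.ofReal_le_ofReal ?_
  have hL : 0 ≤ (max |C₁| |C₂| * K) ^ 4 := by positivity
  nlinarith [mul_le_mul_of_nonneg_left (one_div_le_varRate d n l₁ l₂) hL, mul_nonneg hL hv,
    mul_le_mul_of_nonneg_left (one_div_add_sq_div_le_varRate d (n := n)
      (show resolution d l₁ ≤ kMax d l₁ l₂ from le_max_left _ _)) hL,
    mul_le_mul_of_nonneg_left (one_div_add_sq_div_le_varRate d (n := n)
      (show resolution d l₂ ≤ kMax d l₁ l₂ from le_max_right _ _)) hL]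

end Regression

/-! ### Worst-case variance -/

section Model

variable {α β M C₁ C₂ : ℝ}

/-- A variance bound that holds for every law with regression functions carries over to the
supremum over the model. -/
theorem asympLE_supVar (hC : C₁ ≤ C₂) {T : ∀ n : ℕ, (Fin n → Obs d) → ℝ} {C : ℝ} (hC0 : 0 ≤ C)
    {f g : ℕ → ℝ} (hfg : ∀ n, f n ≤ g n) (hf : ∀ n, 0 ≤ f n)
    (h : ∀ n : ℕ, 0 < n → ∀ (P : Measure (Obs d)) (p b : (Fin d → ℝ) → ℝ),
      IsRegression C₁ C₂ P p b → ProbabilityTheory.evariance (T n) (Measure.pi fun _ : Fin n => P) ≤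
        ENNReal.ofReal (C * f n)) :
    AsympLE (fun n => supVar (n := n) (W.model d α β M C₁ C₂) (T n)) g := by
  refine ⟨C + 1, by linarith, 1, fun n hn => iSup₂_le fun P hP => ?_⟩
  obtain ⟨p, -, b, -, hR⟩ := exists_isRegression hC hP
  refine (h n hn P p b hR).trans (ENNReal.ofReal_le_ofReal ?_)
  nlinarith [hfg n, hf n]

end Model

end CDVBasis

/-! ### Bias up to the terms with coinciding indices -/

theorem kMin_le_kMax (d l₁ l₂ : ℕ) : kMin d l₁ l₂ ≤ kMax d l₁ l₂ := min_le_max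

theorem one_le_kMax (d l₁ l₂ : ℕ) : 1 ≤ kMax d l₁ l₂ := by
  rw [kMax_eq]; exact one_le_resolution _ _

theorem kMin_nonneg (d l₁ l₂ : ℕ) : 0 ≤ kMin d l₁ l₂ := by
  rw [kMin_eq]; exact zero_le_one.trans (one_le_resolution _ _)

/-- The terms of the triple sum with coinciding indices, relative to the sample size. -/
theorem abs_coincidence_le {n Q e₁ e₂ e₃ e₄ G k k' : ℝ} (hn : 1 ≤ n) (hG : 0 ≤ G) (hk' : 1 ≤ k')
    (hkn : k ≤ n) (hQ : |Q| ≤ G) (h₁ : |e₁| ≤ G * k') (h₂ : |e₂| ≤ G * k')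
    (h₃ : |e₃| ≤ G * k') (h₄ : |e₄| ≤ G * (k * k')) :
    |1 / n ^ 2 * ((3 * n - 2) * Q - (n - 1) * (e₁ + e₂ + e₃) - e₄)| ≤ 7 * G * (k' / n) := by
  have hn0 : 0 < n := by linarith
  rw [abs_mul, abs_of_pos (by positivity), one_div_mul_eq_div, div_le_iff₀ (by positivity)]
  have e : 7 * G * (k' / n) * n ^ 2 = 7 * (G * k') * n := by field_simp
  rw [e]
  have hGk : 0 ≤ G * k' := mul_nonneg hG (by linarith)
  have hQ' : |Q| ≤ G * k' := hQ.trans (le_mul_of_one_le_right hG hk')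
  have h₄' : |e₄| ≤ n * (G * k') := h₄.trans (by nlinarith [mul_le_mul_of_nonneg_right hkn hGk])
  have a₁ : |(3 * n - 2) * Q| ≤ 3 * n * (G * k') := by
    rw [abs_mul, abs_of_nonneg (by linarith)]
    exact mul_le_mul (by linarith) hQ' (abs_nonneg _) (by linarith)
  have a₂ : |(n - 1) * (e₁ + e₂ + e₃)| ≤ n * (3 * (G * k')) := by
    rw [abs_mul, abs_of_nonneg (by linarith)]
    refine mul_le_mul (by linarith) ?_ (abs_nonneg _) (by linarith)
    exact (abs_add_three _ _ _).trans (by linarith)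
  have := abs_sub ((3 * n - 2) * Q - (n - 1) * (e₁ + e₂ + e₃)) e₄
  have := abs_sub ((3 * n - 2) * Q) ((n - 1) * (e₁ + e₂ + e₃))
  linarith

namespace CDVBasis

variable {S : ℕ} {W : CDVBasis S} {d : ℕ} {C₁ C₂ : ℝ}

section Regression

variable {P : Measure (Obs d)} {p b : (Fin d → ℝ) → ℝ} {K : ℝ}

/-- The bias of the integral-based estimator is the approximation error at the coarser level, up to
the diagonal terms. -/
theorem abs_bias_psiINT_sub_le (hR : IsRegression C₁ C₂ P p b) (hC : C₁ ≤ C₂)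
    (hK : W.IsKernelBound d K) {n l₁ l₂ : ℕ} (hl₁ : W.J₀ ≤ l₁) (hl₂ : W.J₀ ≤ l₂) (hn : 0 < n) :
    |(∫ D, (W.psiINT l₁ l₂ D - psi P) ∂(Measure.pi fun _ : Fin n => P)) -
      ((∫ x in Icc (0 : Fin d → ℝ) 1, p x * b x) - W.projInner (min l₁ l₂) p b)| ≤
      2 * (max |C₁| |C₂| * K) ^ 2 * (kMin d l₁ l₂ / n) := by
  have hn' : (0 : ℝ) < n := by exact_mod_cast hn
  obtain ⟨h₁, h₂, -⟩ := bias_term_bounds hR hC hK.1 hK.2 (le_min hl₁ hl₂) hl₁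
  rw [bias_psiINT hR hC hl₁ hl₂ hn, add_sub_cancel_left, abs_mul, abs_of_pos (by positivity),
    kMin_eq, one_div_mul_eq_div, ← mul_div_assoc]
  refine div_le_div_of_nonneg_right ((abs_sub _ _).trans ?_) hn'.le
  have := le_mul_of_one_le_right (sq_nonneg (max |C₁| |C₂| * K)) (one_le_resolution d (min l₁ l₂))
  linarith

/-- The bias of the Monte Carlo estimator is the approximation error at the coarser level, up to the
terms with coinciding indices. -/
theorem abs_bias_psiMC_sub_le (hR : IsRegression C₁ C₂ P p b) (hC : C₁ ≤ C₂)
    (hK : W.IsKernelBound d K) {n l₁ l₂ : ℕ} (hl₁ : W.J₀ ≤ l₁) (hl₂ : W.J₀ ≤ l₂) (hn : 0 < n)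
    (hkn : kMin d l₁ l₂ ≤ n) :
    |(∫ D, (W.psiMC l₁ l₂ D - psi P) ∂(Measure.pi fun _ : Fin n => P)) -
      ((∫ x in Icc (0 : Fin d → ℝ) 1, p x * b x) - W.projInner (min l₁ l₂) p b)| ≤
      7 * (max |C₁| |C₂| * K) ^ 2 * (kMax d l₁ l₂ / n) := by
  have hn' : (1 : ℝ) ≤ n := by exact_mod_cast hn
  obtain ⟨hQ, hdg, -⟩ := bias_term_bounds hR hC hK.1 hK.2 (le_min hl₁ hl₂) hl₁
  obtain ⟨-, -, he₁, -, he₄⟩ := bias_term_bounds hR hC hK.1 hK.2 hl₁ hl₂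
  obtain ⟨-, -, -, he₂, -⟩ := bias_term_bounds hR hC hK.1 hK.2 hl₂ hl₁
  have hG := sq_nonneg (max |C₁| |C₂| * K)
  rw [← kMin_mul_kMax] at he₄
  rw [← kMin_eq] at hdg
  have key := abs_coincidence_le hn' hG (one_le_kMax d l₁ l₂) hkn hQ
    (he₁.trans (mul_le_mul_of_nonneg_left (le_max_left _ _) hG))
    (he₂.trans (mul_le_mul_of_nonneg_left (le_max_right _ _) hG))
    (hdg.trans (mul_le_mul_of_nonneg_left (kMin_le_kMax _ _ _) hG)) he₄
  rw [bias_psiMC hR hC hl₁ hl₂ hn]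
  refine (le_of_eq ?_).trans key
  congr 1
  field_simp
  ring

theorem projInner_add_projInner (l₁ l₂ : ℕ) (p b : (Fin d → ℝ) → ℝ) :
    W.projInner l₁ p b + W.projInner l₂ p b =
      W.projInner (min l₁ l₂) p b + W.projInner (max l₁ l₂) p b := by
  rcases le_total l₁ l₂ with h | h
  · rw [min_eq_left h, max_eq_right h]
  · rw [min_eq_right h, max_eq_left h, add_comm]

/-- The bias of the bias-corrected estimator is the approximation error at the finer level, up to the
terms with coinciding indices. -/
theorem abs_bias_psiIF_sub_le (hR : IsRegression C₁ C₂ P p b) (hC : C₁ ≤ C₂)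
    (hK : W.IsKernelBound d K) {n l₁ l₂ : ℕ} (hl₁ : W.J₀ ≤ l₁) (hl₂ : W.J₀ ≤ l₂) (hn : 0 < n)
    (hkn : kMin d l₁ l₂ ≤ n) :
    |(∫ D, (W.psiIF l₁ l₂ D - psi P) ∂(Measure.pi fun _ : Fin n => P)) -
      ((∫ x in Icc (0 : Fin d → ℝ) 1, p x * b x) - W.projInner (max l₁ l₂) p b)| ≤
      11 * (max |C₁| |C₂| * K) ^ 2 * (kMax d l₁ l₂ / n) := by
  have hn' : (1 : ℝ) ≤ n := by exact_mod_cast hn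
  obtain ⟨hQ, hdg, -⟩ := bias_term_bounds hR hC hK.1 hK.2 (le_min hl₁ hl₂) hl₁
  obtain ⟨hQ₁, hd₁, he₁, -, he₄⟩ := bias_term_bounds hR hC hK.1 hK.2 hl₁ hl₂
  obtain ⟨hQ₂, hd₂, -, he₂, -⟩ := bias_term_bounds hR hC hK.1 hK.2 hl₂ hl₁
  have hG := sq_nonneg (max |C₁| |C₂| * K)
  have hm₁ := mul_le_mul_of_nonneg_left (show resolution d l₁ ≤ kMax d l₁ l₂ from le_max_left _ _) hG
  have hm₂ := mul_le_mul_of_nonneg_left (show resolution d l₂ ≤ kMax d l₁ l₂ from le_max_right _ _) hG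
  have hk1 := one_le_kMax d l₁ l₂
  rw [← kMin_mul_kMax] at he₄
  rw [← kMin_eq] at hdg
  have key := abs_coincidence_le hn' hG hk1 hkn hQ (he₁.trans hm₁) (he₂.trans hm₂)
    (hdg.trans (mul_le_mul_of_nonneg_left (kMin_le_kMax _ _ _) hG)) he₄
  have hQQ := projInner_add_projInner (W := W) l₁ l₂ p b
  rw [bias_psiIF hR hC hl₁ hl₂ hn]
  set G := (max |C₁| |C₂| * K) ^ 2
  set X := 1 / (n : ℝ) ^ 2 * ((3 * n - 2) * W.projInner (min l₁ l₂) p b -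
    (n - 1) * (W.crossMean p b l₁ l₂ + W.crossMean b p l₂ l₁ + W.diagMean C₁ C₂ P (min l₁ l₂)) -
      W.diagMean₂ C₁ C₂ P l₁ l₂) with hX
  have e : (∫ x in Icc (0 : Fin d → ℝ) 1, p x * b x) -
      ((1 - 1 / n) * W.projInner l₁ p b + 1 / n * W.diagMean C₁ C₂ P l₁) -
      ((1 - 1 / n) * W.projInner l₂ p b + 1 / n * W.diagMean C₁ C₂ P l₂) +
      1 / (n : ℝ) ^ 2 * ((n - 1) * (n - 2) * W.projInner (min l₁ l₂) p b +
        (n - 1) * (W.crossMean p b l₁ l₂ + W.crossMean b p l₂ l₁ +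
          W.diagMean C₁ C₂ P (min l₁ l₂)) + W.diagMean₂ C₁ C₂ P l₁ l₂) -
      ((∫ x in Icc (0 : Fin d → ℝ) 1, p x * b x) - W.projInner (max l₁ l₂) p b) =
      1 / n * (W.projInner l₁ p b + W.projInner l₂ p b -
        (W.diagMean C₁ C₂ P l₁ + W.diagMean C₁ C₂ P l₂)) - X := by
    rw [eq_sub_of_add_eq' hQQ.symm, hX]
    field_simp
    ring
  have h4 : |1 / n * (W.projInner l₁ p b + W.projInner l₂ p b -
        (W.diagMean C₁ C₂ P l₁ + W.diagMean C₁ C₂ P l₂))| ≤ 4 * G * (kMax d l₁ l₂ / n) := by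
    rw [abs_mul, abs_of_pos (by positivity), one_div_mul_eq_div, ← mul_div_assoc]
    refine div_le_div_of_nonneg_right ((abs_sub _ _).trans ?_) (by linarith)
    have := le_mul_of_one_le_right hG hk1
    have := abs_add_le (W.projInner l₁ p b) (W.projInner l₂ p b)
    have := abs_add_le (W.diagMean C₁ C₂ P l₁) (W.diagMean C₁ C₂ P l₂)
    linarith
  rw [e]
  exact (abs_sub _ _).trans (by linarith)

end Regression

/-! ### Bias under the test laws -/

section ConstantRegression

variable {c θ : ℝ}

theorem crossMean_const (hS : 0 < S) {l l' : ℕ} (hl : W.J₀ ≤ l) (hl' : W.J₀ ≤ l') (c : ℝ) :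
    W.crossMean (fun _ : Fin d → ℝ => c) (fun _ => c) l l' = c ^ 2 * resolution d l := by
  rw [crossMean, setIntegral_congr_fun measurableSet_Icc
    (g := fun x : Fin d → ℝ => c ^ 2 * W.kernel l x x) fun x hx => by
      simp only; rw [proj_const hS hl' c hx]; ring]
  rw [integral_const_mul, integral_kernel_self hl]

theorem diagMean_const (h₁ : c + θ ∈ Icc C₁ C₂) (h₂ : c - θ ∈ Icc C₁ C₂) {l : ℕ}
    (hl : W.J₀ ≤ l) :
    W.diagMean C₁ C₂ (testLaw (d := d) (fun _ => c) (fun _ => c) θ) l =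
      (c ^ 2 + θ ^ 2) * resolution d l := by
  refine (integral_AY_testLaw (g := fun x => W.kernel l x x) continuous_const continuous_const
    (fun _ => h₁) (fun _ => h₂) (fun _ => h₁) (fun _ => h₂) (continuousOn_kernel_self hl)).trans ?_
  rw [integral_const_mul, integral_kernel_self hl, sq c]

theorem diagMean₂_const (h₁ : c + θ ∈ Icc C₁ C₂) (h₂ : c - θ ∈ Icc C₁ C₂) {l₁ l₂ : ℕ}
    (hl₁ : W.J₀ ≤ l₁) (hl₂ : W.J₀ ≤ l₂) :
    W.diagMean₂ C₁ C₂ (testLaw (d := d) (fun _ => c) (fun _ => c) θ) l₁ l₂ =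
      (c ^ 2 + θ ^ 2) * ∫ x in Icc (0 : Fin d → ℝ) 1, W.kernel l₁ x x * W.kernel l₂ x x := by
  have h := integral_AY_testLaw (g := fun x : Fin d → ℝ => W.kernel l₁ x x * W.kernel l₂ x x)
    (p := fun _ => c) (b := fun _ => c) continuous_const continuous_const
    (fun _ => h₁) (fun _ => h₂) (fun _ => h₁) (fun _ => h₂)
    ((continuousOn_kernel_self hl₁).mul (continuousOn_kernel_self hl₂))
  rw [integral_const_mul, ← sq c] at h
  rw [← h, diagMean₂]
  refine integral_congr_ae (Eventually.of_forall fun o => ?_)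
  simp only [truncA, truncY, obsKernel]
  ring

end ConstantRegression

end CDVBasis

/-! ### Worst-case bias -/

theorem le_supBias {d n : ℕ} {Q : Set (Measure (Obs d))} {T : (Fin n → Obs d) → ℝ}
    {P : Measure (Obs d)} (hP : P ∈ Q) {t : ℝ}
    (ht : t ≤ |∫ D, (T D - psi P) ∂(Measure.pi fun _ : Fin n => P)|) :
    ENNReal.ofReal t ≤ supBias Q T :=
  (ENNReal.ofReal_le_ofReal ht).trans
    (le_iSup₂ (f := fun (P : Measure (Obs d)) (_ : P ∈ Q) =>
      ENNReal.ofReal |∫ D, (T D - psi P) ∂(Measure.pi fun _ : Fin n => P)|) P hP)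

/-- If the biases at two laws are far apart, then one of them is large. -/
theorem le_supBias_of_sub {d n : ℕ} {Q : Set (Measure (Obs d))} {T : (Fin n → Obs d) → ℝ}
    {P P' : Measure (Obs d)} (hP : P ∈ Q) (hP' : P' ∈ Q) {t : ℝ}
    (ht : 2 * t ≤ (∫ D, (T D - psi P) ∂(Measure.pi fun _ : Fin n => P)) -
      ∫ D, (T D - psi P') ∂(Measure.pi fun _ : Fin n => P')) :
    ENNReal.ofReal t ≤ supBias Q T := by
  by_cases h : t ≤ |∫ D, (T D - psi P) ∂(Measure.pi fun _ : Fin n => P)|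
  · exact le_supBias hP h
  · refine le_supBias hP' ?_
    have h1 := le_abs_self (∫ D, (T D - psi P) ∂(Measure.pi fun _ : Fin n => P))
    have h2 := neg_abs_le (∫ D, (T D - psi P') ∂(Measure.pi fun _ : Fin n => P'))
    linarith

/-- A sequence that dominates `y` and dominates `x` up to a multiple of `y` dominates both. -/
theorem asympGE_max {a : ℕ → ℝ≥0∞} {x y : ℕ → ℝ} {c₁ c₂ E : ℝ} (hc₁ : 0 < c₁) (hc₂ : 0 < c₂)
    (hE : 0 ≤ E) (hx : ∀ n, 0 ≤ x n) (hy : ∀ n, 0 ≤ y n) (n₀ : ℕ)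
    (h₁ : ∀ n ≥ n₀, ENNReal.ofReal (c₁ * y n) ≤ a n)
    (h₂ : ∀ n ≥ n₀, ENNReal.ofReal (c₂ * x n - E * y n) ≤ a n) :
    AsympGE a fun n => max (x n) (y n) := by
  have hEc : 0 < E + c₁ := by linarith
  -- the multiples `E` and `c₁` of the two lower bounds add up to `c₁ * c₂ * x n`
  refine ⟨min c₁ (c₁ * c₂ / (E + c₁)), lt_min hc₁ (by positivity), n₀, fun n hn => ?_⟩
  have h : ENNReal.ofReal (max (c₁ * y n) (c₂ * x n - E * y n)) ≤ a n := by
    rcases max_choice (c₁ * y n) (c₂ * x n - E * y n) with h | h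
    · rw [h]; exact h₁ n hn
    · rw [h]; exact h₂ n hn
  refine (ENNReal.ofReal_le_ofReal ?_).trans h
  set t := max (c₁ * y n) (c₂ * x n - E * y n)
  have t₁ : c₁ * y n ≤ t := le_max_left _ _
  have t₂ : c₂ * x n - E * y n ≤ t := le_max_right _ _
  rcases max_choice (x n) (y n) with h | h <;> simp only [h]
  · refine (mul_le_mul_of_nonneg_right (min_le_right _ _) (hx n)).trans ?_
    rw [div_mul_eq_mul_div, div_le_iff₀ hEc]
    nlinarith [mul_le_mul_of_nonneg_left t₁ hE, mul_le_mul_of_nonneg_left t₂ hc₁.le]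
  · exact (mul_le_mul_of_nonneg_right (min_le_left _ _) (hy n)).trans t₁

namespace CDVBasis

variable {S : ℕ} {W : CDVBasis S} {d : ℕ} {α β M C₁ C₂ : ℝ}

/-- The test laws belong to the model: a non-zero constant for both regression functions, with
conditional covariance `θ ^ 2`, and the same constant perturbed by wavelets of one level. -/
theorem exists_test_laws (hd : 0 < d) (hS : 0 < S) (hα : 0 < α) (hβ : 0 < β) (hM : 0 < M)
    (hc : ∃ c ∈ Set.Ioo C₁ C₂, W.holderNorm (d := d) α (fun _ => c) < ENNReal.ofReal M ∧
      W.holderNorm (d := d) β (fun _ => c) < ENNReal.ofReal M) :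
    ∃ c δ ε : ℝ, c ≠ 0 ∧ 0 < δ ∧ 0 < ε ∧
      (∀ θ ∈ Icc 0 δ, (c + θ ∈ Icc C₁ C₂ ∧ c - θ ∈ Icc C₁ C₂) ∧
        testLaw (d := d) (fun _ => c) (fun _ => c) θ ∈ W.model d α β M C₁ C₂ ∧
        IsRegression C₁ C₂ (testLaw (d := d) (fun _ => c) (fun _ => c) θ)
          (fun _ => c) (fun _ => c)) ∧
      ∀ l, W.J₀ ≤ l →
        testLaw (d := d) (fun x => c + W.bump α ε l x) (fun x => c + W.bump β ε l x) 0 ∈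
          W.model d α β M C₁ C₂ ∧
        IsRegression C₁ C₂
          (testLaw (d := d) (fun x => c + W.bump α ε l x) (fun x => c + W.bump β ε l x) 0)
          (fun x => c + W.bump α ε l x) (fun x => c + W.bump β ε l x) := by
  obtain ⟨c, ⟨hc₁, hc₂⟩, hc0, hcα, hcβ⟩ := exists_ne_zero_const (W := W) hS hM hc
  obtain ⟨C, hC1, hCb⟩ := exists_bump_bound W d
  have hC : C₁ ≤ C₂ := by linarith
  set δ := min (c - C₁) (C₂ - c) with hδ
  have hδ0 : 0 < δ := lt_min (by linarith) (by linarith)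
  have hδ₁ : δ ≤ c - C₁ := min_le_left _ _
  have hδ₂ : δ ≤ C₂ - c := min_le_right _ _
  -- as the norms of the constant are strictly below `M`, there is room for a perturbation
  have room : ∀ {N : ℝ≥0∞}, N < ENNReal.ofReal M →
      ∃ e : ℝ, 0 < e ∧ ∀ e' ≤ e, N + ENNReal.ofReal e' ≤ ENNReal.ofReal M := by
    intro N hN
    have hN' := ENNReal.ofReal_toReal hN.ne_top
    rw [← hN', ENNReal.ofReal_lt_ofReal_iff hM] at hN
    refine ⟨M - N.toReal, by linarith, fun e' he' => ?_⟩
    rcases le_total 0 e' with h | h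
    · rw [← hN', ← ENNReal.ofReal_add ENNReal.toReal_nonneg h]
      exact ENNReal.ofReal_le_ofReal (by linarith)
    · rw [ENNReal.ofReal_of_nonpos h, add_zero, ← hN']
      exact ENNReal.ofReal_le_ofReal hN.le
  obtain ⟨e₁, he₁, hM₁⟩ := room hcα
  obtain ⟨e₂, he₂, hM₂⟩ := room hcβ
  have hCpos : 0 < C := by linarith
  -- the bumps have to respect the interval `[C₁, C₂]` and both Hölder balls
  set ε := min (δ / C) (min e₁ e₂) with hε
  have hε0 : 0 < ε := lt_min (by positivity) (lt_min he₁ he₂)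
  have hεC : ε * C ≤ δ := by
    rw [← le_div_iff₀ hCpos]; exact min_le_left _ _
  have mem : ∀ t, |t| ≤ δ → c + t ∈ Icc C₁ C₂ := fun t ht =>
    ⟨by linarith [(abs_le.1 ht).1], by linarith [(abs_le.1 ht).2]⟩
  refine ⟨c, δ, ε, hc0, hδ0, hε0, fun θ hθ => ?_, fun l hl => ?_⟩
  · have m₁ := mem θ (abs_le.2 ⟨by linarith [hθ.1], hθ.2⟩)
    have m₂ : c - θ ∈ Icc C₁ C₂ :=
      mem (-θ) (abs_le.2 ⟨by linarith [hθ.2], by linarith [hθ.1]⟩)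
    exact ⟨⟨m₁, m₂⟩, testLaw_mem_model continuous_const continuous_const hC (fun _ => m₁)
      (fun _ => m₂) (fun _ => m₁) (fun _ => m₂) hcα.le hcβ.le⟩
  · have m : ∀ s, 0 < s → ∀ x : Fin d → ℝ, c + W.bump s ε l x ∈ Icc C₁ C₂ := fun s hs x =>
      mem _ ((hCb s ε hs hε0.le l hl x).trans hεC)
    exact testLaw_mem_model (continuous_const.add (continuous_bump hl α ε))
      (continuous_const.add (continuous_bump hl β ε)) hC
      (fun x => by simpa using m α hα x) (fun x => by simpa using m α hα x)
      (fun x => by simpa using m β hβ x) (fun x => by simpa using m β hβ x)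
      ((holderNorm_const_add_bump_le hd hS hl c α hε0.le).trans
        (hM₁ _ ((min_le_right _ _).trans (min_le_left _ _))))
      ((holderNorm_const_add_bump_le hd hS hl c β hε0.le).trans
        (hM₂ _ ((min_le_right _ _).trans (min_le_right _ _))))

/-- The bias has the order of the approximation error at level `lam n` plus `y n` once it agrees
with the approximation error up to `O(y n)` and is at least of order `y n` in the worst case. -/
theorem asympEQ_supBias (hd : 0 < d) (hS : 0 < S) (hα : 0 < α) (hβ : 0 < β) (hM : 0 < M)
    (hC : C₁ ≤ C₂) {c ε : ℝ} (hε : 0 < ε)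
    (hbump : ∀ l, W.J₀ ≤ l →
        testLaw (d := d) (fun x => c + W.bump α ε l x) (fun x => c + W.bump β ε l x) 0 ∈
          W.model d α β M C₁ C₂ ∧
        IsRegression C₁ C₂
          (testLaw (d := d) (fun x => c + W.bump α ε l x) (fun x => c + W.bump β ε l x) 0)
          (fun x => c + W.bump α ε l x) (fun x => c + W.bump β ε l x))
    {T : ∀ n : ℕ, (Fin n → Obs d) → ℝ} {lam : ℕ → ℕ} (hlam : ∀ n, W.J₀ ≤ lam n) {y : ℕ → ℝ}
    (hy : ∀ n, 0 ≤ y n) {E c₁ : ℝ} (hE : 0 ≤ E) (hc₁ : 0 < c₁) (n₀ : ℕ)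
    (happrox : ∀ n ≥ n₀, ∀ (P : Measure (Obs d)) (p b : (Fin d → ℝ) → ℝ),
      IsRegression C₁ C₂ P p b →
      |(∫ D, (T n D - psi P) ∂(Measure.pi fun _ : Fin n => P)) -
        ((∫ x in Icc (0 : Fin d → ℝ) 1, p x * b x) - W.projInner (lam n) p b)| ≤ E * y n)
    (hlow : ∀ n ≥ n₀, ENNReal.ofReal (c₁ * y n) ≤
      supBias (n := n) (W.model d α β M C₁ C₂) (T n)) :
    AsympEQ (fun n => supBias (n := n) (W.model d α β M C₁ C₂) (T n))
      (fun n => max (resolution d (lam n) ^ (-(α + β) / (d : ℝ))) (y n)) := by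
  simp_rw [resolution_rpow hd]
  set ρ := (2 : ℝ) ^ (-(α + β)) with hρ
  have hρ0 : 0 < ρ := by positivity
  have hρ1 : ρ < 1 := Real.rpow_lt_one_of_one_lt_of_neg (by norm_num) (by linarith)
  have hD : 0 < 2 ^ d * M ^ 2 / (1 - ρ) := div_pos (by positivity) (by linarith)
  constructor
  · refine ⟨2 ^ d * M ^ 2 / (1 - ρ) + E, by linarith, n₀, fun n hn => iSup₂_le fun P hP => ?_⟩
    obtain ⟨p, hp, b, hb, hR⟩ := exists_isRegression hC hP
    refine ENNReal.ofReal_le_ofReal ?_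
    have h1 := happrox n hn P p b hR
    have h2 := abs_integral_sub_projInner_le hS hα hβ hM.le hp hb (hlam n)
    have h3 := abs_sub_abs_le_abs_sub (∫ D, (T n D - psi P) ∂(Measure.pi fun _ : Fin n => P))
      ((∫ x in Icc (0 : Fin d → ℝ) 1, p x * b x) - W.projInner (lam n) p b)
    have h4 := mul_le_mul_of_nonneg_left (le_max_left (ρ ^ lam n) (y n)) hD.le
    have h5 := mul_le_mul_of_nonneg_left (le_max_right (ρ ^ lam n) (y n)) hE
    linarith
  · refine asympGE_max hc₁ (sq_pos_of_pos hε) hE (fun n => by positivity) hy n₀ hlow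
      fun n hn => ?_
    -- bumps of level `lam n` are invisible to the projection of that level
    obtain ⟨hmem, hR⟩ := hbump (lam n) (hlam n)
    refine le_supBias hmem ?_
    have h1 := happrox n hn _ _ _ hR
    rw [integral_const_add_bump_mul hd hS (hlam n), projInner_const_add_bump hd hS (hlam n),
      add_sub_cancel_left] at h1
    have h2 := le_abs_self
      (∫ D, (T n D - psi (testLaw (d := d) (fun x => c + W.bump α ε (lam n) x)
        (fun x => c + W.bump β ε (lam n) x) 0)) ∂(Measure.pi fun _ : Fin n =>
          testLaw (fun x => c + W.bump α ε (lam n) x) (fun x => c + W.bump β ε (lam n) x) 0))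
    linarith [(abs_le.1 h1).1]

section LowerBound

variable {c δ K : ℝ} {n l₁ l₂ : ℕ}

/-- The conditional covariance enters the bias of the integral-based estimator with weight
`- k_min / n`. -/
theorem le_supBias_psiINT (hC : C₁ ≤ C₂) (hδ : 0 ≤ δ)
    (hconst : ∀ θ ∈ Icc 0 δ, (c + θ ∈ Icc C₁ C₂ ∧ c - θ ∈ Icc C₁ C₂) ∧
      testLaw (d := d) (fun _ => c) (fun _ => c) θ ∈ W.model d α β M C₁ C₂ ∧
      IsRegression C₁ C₂ (testLaw (d := d) (fun _ => c) (fun _ => c) θ) (fun _ => c) (fun _ => c))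
    (hl₁ : W.J₀ ≤ l₁) (hl₂ : W.J₀ ≤ l₂) (hn : 0 < n) :
    ENNReal.ofReal (δ ^ 2 / 2 * (kMin d l₁ l₂ / n)) ≤
      supBias (n := n) (W.model d α β M C₁ C₂) (W.psiINT l₁ l₂) := by
  obtain ⟨m₀, hP₀, hR₀⟩ := hconst 0 ⟨le_rfl, hδ⟩
  obtain ⟨m₁, hP₁, hR₁⟩ := hconst δ ⟨hδ, le_rfl⟩
  refine le_supBias_of_sub hP₀ hP₁ (le_of_eq ?_)
  have hl := le_min hl₁ hl₂
  rw [bias_psiINT hR₀ hC hl₁ hl₂ hn, bias_psiINT hR₁ hC hl₁ hl₂ hn, diagMean_const m₀.1 m₀.2 hl,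
    diagMean_const m₁.1 m₁.2 hl, kMin_eq]
  ring

/-- With conditional covariance zero, all terms with coinciding indices have the same sign. -/
theorem le_supBias_psiMC (hd : 0 < d) (hS : 0 < S) (hC : C₁ ≤ C₂) (hδ : 0 ≤ δ)
    (hconst : ∀ θ ∈ Icc 0 δ, (c + θ ∈ Icc C₁ C₂ ∧ c - θ ∈ Icc C₁ C₂) ∧
      testLaw (d := d) (fun _ => c) (fun _ => c) θ ∈ W.model d α β M C₁ C₂ ∧
      IsRegression C₁ C₂ (testLaw (d := d) (fun _ => c) (fun _ => c) θ) (fun _ => c) (fun _ => c))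
    (hl₁ : W.J₀ ≤ l₁) (hl₂ : W.J₀ ≤ l₂) (hn : 2 ≤ n) :
    ENNReal.ofReal (c ^ 2 / 2 * (kMax d l₁ l₂ / n)) ≤
      supBias (n := n) (W.model d α β M C₁ C₂) (W.psiMC l₁ l₂) := by
  obtain ⟨m₀, hP₀, hR₀⟩ := hconst 0 ⟨le_rfl, hδ⟩
  refine le_supBias hP₀ (le_trans ?_ (neg_le_abs _))
  have hn' : (2 : ℝ) ≤ n := by exact_mod_cast hn
  have hl := le_min hl₁ hl₂
  rw [bias_psiMC hR₀ hC hl₁ hl₂ (by omega), diagMean_const m₀.1 m₀.2 hl,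
    diagMean₂_const m₀.1 m₀.2 hl₁ hl₂, crossMean_const hS hl₁ hl₂, crossMean_const hS hl₂ hl₁,
    projInner_const hS hl, ← kMin_eq]
  have hI : 0 ≤ ∫ x in Icc (0 : Fin d → ℝ) 1, W.kernel l₁ x x * W.kernel l₂ x x :=
    integral_nonneg fun x => mul_nonneg (W.kernel_self_nonneg _ _) (W.kernel_self_nonneg _ _)
  -- the terms with coinciding indices must outweigh the `3 n - 2` missing off-diagonal ones; this
  -- uses that levels start at one
  have hk2 : 2 ≤ kMin d l₁ l₂ := by
    rw [kMin_eq, resolution]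
    exact le_self_pow₀ (by norm_num)
      (Nat.mul_pos (by have := W.one_le_J₀; omega) hd).ne'
  have hsum : resolution d l₁ + resolution d l₂ = kMin d l₁ l₂ + kMax d l₁ l₂ :=
    (min_add_max _ _).symm
  have hkk := kMin_le_kMax d l₁ l₂
  set I := ∫ x in Icc (0 : Fin d → ℝ) 1, W.kernel l₁ x x * W.kernel l₂ x x
  set k := kMin d l₁ l₂
  set k' := kMax d l₁ l₂
  simp only [integral_const, probReal_univ, one_smul]
  have e : -(c * c - 1 / (n : ℝ) ^ 2 * ((n - 1) * (n - 2) * c ^ 2 +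
      (n - 1) * (c ^ 2 * resolution d l₁ + c ^ 2 * resolution d l₂ + (c ^ 2 + 0 ^ 2) * k) +
      (c ^ 2 + 0 ^ 2) * I)) =
      c ^ 2 * (((n - 1) * (2 * k + k') + I - (3 * n - 2)) / n ^ 2) := by
    rw [show resolution d l₁ = k + k' - resolution d l₂ by linarith]
    field_simp
    ring
  rw [e, div_mul_eq_mul_div, mul_div_assoc]
  refine mul_le_mul_of_nonneg_left ?_ (sq_nonneg c)
  rw [div_div, div_le_div_iff₀ (by positivity) (by positivity)]
  have h1 : (n : ℝ) * k' ≤ 2 * ((n - 1) * (2 * k + k') + I - (3 * n - 2)) := by nlinarith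
  nlinarith

/-- The conditional covariance enters the bias of the bias-corrected estimator with a weight of
order `- k_max / n`, as long as `k_min` is small compared to `n`. -/
theorem le_supBias_psiIF (hC : C₁ ≤ C₂) (hδ : 0 ≤ δ) (hK : W.IsKernelBound d K)
    (hconst : ∀ θ ∈ Icc 0 δ, (c + θ ∈ Icc C₁ C₂ ∧ c - θ ∈ Icc C₁ C₂) ∧
      testLaw (d := d) (fun _ => c) (fun _ => c) θ ∈ W.model d α β M C₁ C₂ ∧
      IsRegression C₁ C₂ (testLaw (d := d) (fun _ => c) (fun _ => c) θ) (fun _ => c) (fun _ => c))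
    (hl₁ : W.J₀ ≤ l₁) (hl₂ : W.J₀ ≤ l₂) (hn : 0 < n) (hkn : 2 * K ^ 2 * kMin d l₁ l₂ ≤ n) :
    ENNReal.ofReal (δ ^ 2 / 4 * (kMax d l₁ l₂ / n)) ≤
      supBias (n := n) (W.model d α β M C₁ C₂) (W.psiIF l₁ l₂) := by
  obtain ⟨m₀, hP₀, hR₀⟩ := hconst 0 ⟨le_rfl, hδ⟩
  obtain ⟨m₁, hP₁, hR₁⟩ := hconst δ ⟨hδ, le_rfl⟩
  refine le_supBias_of_sub hP₀ hP₁ ?_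
  have hn' : (0 : ℝ) < n := by exact_mod_cast hn
  have hl := le_min hl₁ hl₂
  -- the terms with all indices equal are a fraction `K ^ 2 * k_min / n ≤ 1 / 2` of `k_max / n`
  have hI : ∫ x in Icc (0 : Fin d → ℝ) 1, W.kernel l₁ x x * W.kernel l₂ x x ≤
      K ^ 2 * (kMin d l₁ l₂ * kMax d l₁ l₂) := by
    refine (le_abs_self _).trans (abs_setIntegral_cube_le ?_)
    filter_upwards [ae_restrict_mem measurableSet_Icc] with x hx
    have h1 := (hK.2 l₁ hl₁ x hx).1 x hx
    have h2 := (hK.2 l₂ hl₂ x hx).1 x hx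
    rw [abs_mul, kMin_mul_kMax]
    refine (mul_le_mul h1 h2 (abs_nonneg _) ((abs_nonneg _).trans h1)).trans (le_of_eq (by ring))
  have hsum : resolution d l₁ + resolution d l₂ = kMin d l₁ l₂ + kMax d l₁ l₂ :=
    (min_add_max _ _).symm
  have hk := kMin_nonneg d l₁ l₂
  have hk' := one_le_kMax d l₁ l₂
  rw [bias_psiIF hR₀ hC hl₁ hl₂ hn, bias_psiIF hR₁ hC hl₁ hl₂ hn]
  simp only [diagMean_const m₀.1 m₀.2 hl, diagMean_const m₀.1 m₀.2 hl₁,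
    diagMean_const m₀.1 m₀.2 hl₂, diagMean_const m₁.1 m₁.2 hl, diagMean_const m₁.1 m₁.2 hl₁,
    diagMean_const m₁.1 m₁.2 hl₂, diagMean₂_const m₀.1 m₀.2 hl₁ hl₂,
    diagMean₂_const m₁.1 m₁.2 hl₁ hl₂, ← kMin_eq]
  set I := ∫ x in Icc (0 : Fin d → ℝ) 1, W.kernel l₁ x x * W.kernel l₂ x x
  set k := kMin d l₁ l₂
  set k' := kMax d l₁ l₂
  have h1 : δ ^ 2 * ((k' / 2) / n) ≤ δ ^ 2 * ((n * k' + k - I) / n ^ 2) := by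
    refine mul_le_mul_of_nonneg_left ?_ (sq_nonneg δ)
    rw [div_le_div_iff₀ hn' (by positivity)]
    have h2 : 2 * I ≤ n * k' := by
      nlinarith [mul_le_mul_of_nonneg_right hkn (zero_le_one.trans hk')]
    nlinarith [mul_nonneg (show 0 ≤ n * k' / 2 + k - I by linarith) hn'.le]
  refine le_trans (le_of_eq (by ring)) (h1.trans (le_of_eq ?_))
  rw [show resolution d l₁ = k + k' - resolution d l₂ by linarith]
  field_simp
  ring

end LowerBound

/-- A resolution that is small compared to the sample size is eventually below any fraction of
it. -/
theorem exists_forall_kMin_le {l₁ l₂ : ℕ → ℕ}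
    (h : MuchLess (fun n => resolution d (l₁ n)) fun n => (n : ℝ)) {r : ℝ} (hr : 0 < r) :
    ∃ n₀, ∀ n ≥ n₀, r * kMin d (l₁ n) (l₂ n) ≤ n := by
  have := (h.eventually_le_const (show (0 : ℝ) < 1 / r by positivity)).and (eventually_gt_atTop 0)
  obtain ⟨n₀, hn₀⟩ := eventually_atTop.1 this
  refine ⟨n₀, fun n hn => ?_⟩
  obtain ⟨h1, h2⟩ := hn₀ n hn
  have hn' : (0 : ℝ) < n := by exact_mod_cast h2
  rw [div_le_div_iff₀ hn' hr, one_mul] at h1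
  rw [mul_comm]
  exact (mul_le_mul_of_nonneg_right (min_le_left _ _) hr.le).trans h1

end CDVBasis

open CDVBasis in
theorem theorem4 {d S : ℕ} (hd : 0 < d) (W : CDVBasis S) {α β M C₁ C₂ : ℝ}
    (hα : 0 < α) (hβ : 0 < β) (hM : 0 < M) (hSα : α < S) (hSβ : β < S)
    (hc : ∃ c ∈ Set.Ioo C₁ C₂,
      W.holderNorm (d := d) α (fun _ => c) < ENNReal.ofReal M ∧
      W.holderNorm (d := d) β (fun _ => c) < ENNReal.ofReal M)
    (l₁ l₂ : ℕ → ℕ) (hl₁ : ∀ n, W.J₀ ≤ l₁ n) (hl₂ : ∀ n, W.J₀ ≤ l₂ n) :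
    -- integral-based plug-in estimator
    (AsympEQ
        (fun n => supBias (n := n) (W.model d α β M C₁ C₂) (W.psiINT (l₁ n) (l₂ n)))
        (fun n => max (kMin d (l₁ n) (l₂ n) ^ (-(α + β) / (d : ℝ)))
          (kMin d (l₁ n) (l₂ n) / n)) ∧
      AsympLE
        (fun n => supVar (n := n) (W.model d α β M C₁ C₂) (W.psiINT (l₁ n) (l₂ n)))
        (fun n => 1 / (n : ℝ) + kMin d (l₁ n) (l₂ n) ^ 2 / (n : ℝ) ^ 2)) ∧
    -- Monte Carlo-based plug-in estimator
    ((MuchLess (fun n => resolution d (l₁ n)) (fun n => (n : ℝ)) →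
        MuchLess (fun n => resolution d (l₂ n)) (fun n => (n : ℝ)) →
        AsympEQ
          (fun n => supBias (n := n) (W.model d α β M C₁ C₂) (W.psiMC (l₁ n) (l₂ n)))
          (fun n => max (kMin d (l₁ n) (l₂ n) ^ (-(α + β) / (d : ℝ)))
            (kMax d (l₁ n) (l₂ n) / n))) ∧
      AsympLE
        (fun n => supVar (n := n) (W.model d α β M C₁ C₂) (W.psiMC (l₁ n) (l₂ n)))
        (fun n => 1 / (n : ℝ) + kMin d (l₁ n) (l₂ n) ^ 2 / (n : ℝ) ^ 2
          + kMax d (l₁ n) (l₂ n) / (n : ℝ) ^ 2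
          + kMin d (l₁ n) (l₂ n) * kMax d (l₁ n) (l₂ n) / (n : ℝ) ^ 3
          + kMax d (l₁ n) (l₂ n) ^ 2 / (n : ℝ) ^ 3
          + kMin d (l₁ n) (l₂ n) ^ 2 * kMax d (l₁ n) (l₂ n) / (n : ℝ) ^ 4
          + kMin d (l₁ n) (l₂ n) ^ 2 * kMax d (l₁ n) (l₂ n) ^ 2 / (n : ℝ) ^ 5)) ∧
    -- first-order bias-corrected estimator
    ((MuchLess (fun n => resolution d (l₁ n)) (fun n => (n : ℝ)) →
        MuchLess (fun n => resolution d (l₂ n)) (fun n => (n : ℝ)) →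
        AsympEQ
          (fun n => supBias (n := n) (W.model d α β M C₁ C₂) (W.psiIF (l₁ n) (l₂ n)))
          (fun n => max (kMax d (l₁ n) (l₂ n) ^ (-(α + β) / (d : ℝ)))
            (kMax d (l₁ n) (l₂ n) / n))) ∧
      AsympLE
        (fun n => supVar (n := n) (W.model d α β M C₁ C₂) (W.psiIF (l₁ n) (l₂ n)))
        (fun n => 1 / (n : ℝ) + kMin d (l₁ n) (l₂ n) ^ 2 / (n : ℝ) ^ 2
          + kMax d (l₁ n) (l₂ n) / (n : ℝ) ^ 2
          + kMax d (l₁ n) (l₂ n) ^ 2 / (n : ℝ) ^ 3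
          + kMin d (l₁ n) (l₂ n) ^ 2 * kMax d (l₁ n) (l₂ n) / (n : ℝ) ^ 4
          + kMin d (l₁ n) (l₂ n) ^ 2 * kMax d (l₁ n) (l₂ n) ^ 2 / (n : ℝ) ^ 5)) := by
  have hS : 0 < S := by exact_mod_cast hα.trans hSα
  have hC : C₁ ≤ C₂ := by obtain ⟨c, hc, -⟩ := hc; exact (hc.1.trans hc.2).le
  obtain ⟨K, hK⟩ : ∃ K, W.IsKernelBound d K := W.exists_kernel_bound d
  obtain ⟨c, δ, ε, hc0, hδ, hε, hconst, hbump⟩ := exists_test_laws hd hS hα hβ hM hc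
  have hmin : ∀ n, W.J₀ ≤ min (l₁ n) (l₂ n) := fun n => le_min (hl₁ n) (hl₂ n)
  have hmax : ∀ n, W.J₀ ≤ max (l₁ n) (l₂ n) := fun n => (hl₁ n).trans (le_max_left _ _)
  have hk : ∀ n, 0 ≤ kMin d (l₁ n) (l₂ n) := fun n => kMin_nonneg _ _ _
  have hk' : ∀ n, 0 ≤ kMax d (l₁ n) (l₂ n) := fun n => zero_le_one.trans (one_le_kMax _ _ _)
  have hG : 0 ≤ (max |C₁| |C₂| * K) ^ 2 := sq_nonneg _
  have hL : 0 ≤ (max |C₁| |C₂| * K) ^ 4 := by positivity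
  have hK0 : 0 < K := by linarith [hK.1]
  refine ⟨⟨?_, ?_⟩, ⟨fun h₁ _ => ?_, ?_⟩, fun h₁ _ => ?_, ?_⟩
  · have := asympEQ_supBias hd hS hα hβ hM hC hε hbump hmin
      (T := fun n => W.psiINT (n := n) (l₁ n) (l₂ n)) (y := fun n => kMin d (l₁ n) (l₂ n) / n)
      (fun n => div_nonneg (hk n) n.cast_nonneg) (mul_nonneg zero_le_two hG)
      (show 0 < δ ^ 2 / 2 by positivity) 1
      (fun n hn P p b hR => abs_bias_psiINT_sub_le hR hC hK (hl₁ n) (hl₂ n) hn)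
      (fun n hn => le_supBias_psiINT hC hδ.le hconst (hl₁ n) (hl₂ n) hn)
    simpa only [kMin_eq] using this
  · exact asympLE_supVar hC (C := 258 * (max |C₁| |C₂| * K) ^ 4) (by positivity)
      (fun n => le_rfl) (fun n => by positivity)
      fun n hn P p b hR => evariance_psiINT_le hR hC hK (hl₁ n) (hl₂ n) hn
  · obtain ⟨n₀, hn₀⟩ := exists_forall_kMin_le (l₂ := l₂) h₁ one_pos
    have := asympEQ_supBias hd hS hα hβ hM hC hε hbump hmin
      (T := fun n => W.psiMC (n := n) (l₁ n) (l₂ n)) (y := fun n => kMax d (l₁ n) (l₂ n) / n)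
      (fun n => div_nonneg (hk' n) n.cast_nonneg) (mul_nonneg (by norm_num) hG)
      (show 0 < c ^ 2 / 2 by positivity) (max 2 n₀)
      (fun n hn P p b hR => abs_bias_psiMC_sub_le hR hC hK (hl₁ n) (hl₂ n)
        (by have := (le_max_left _ _).trans hn; omega)
        (by simpa using hn₀ n ((le_max_right _ _).trans hn)))
      (fun n hn => le_supBias_psiMC hd hS hC hδ.le hconst (hl₁ n) (hl₂ n)
        ((le_max_left _ _).trans hn))
    simpa only [kMin_eq] using this
  · refine asympLE_supVar hC (C := 75000 * (max |C₁| |C₂| * K) ^ 4) (by positivity)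
      (fun n => ?_) (fun n => varRate_nonneg d n (l₁ n) (l₂ n))
      fun n hn P p b hR => evariance_psiMC_le hR hC hK (hl₁ n) (hl₂ n) hn
    have := hk n
    have := hk' n
    have e₁ : 0 ≤ kMin d (l₁ n) (l₂ n) ^ 2 / (n : ℝ) ^ 2 := by positivity
    have e₂ : 0 ≤ kMax d (l₁ n) (l₂ n) / (n : ℝ) ^ 2 := by positivity
    have e₃ : 0 ≤ kMin d (l₁ n) (l₂ n) * kMax d (l₁ n) (l₂ n) / (n : ℝ) ^ 3 := by positivity
    have e₄ : 0 ≤ kMin d (l₁ n) (l₂ n) ^ 2 * kMax d (l₁ n) (l₂ n) / (n : ℝ) ^ 4 := by positivity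
    rw [varRate]
    linarith
  · obtain ⟨n₀, hn₀⟩ := exists_forall_kMin_le (l₂ := l₂) h₁
      (show 0 < 2 * K ^ 2 by positivity)
    have hle : ∀ n ≥ n₀, kMin d (l₁ n) (l₂ n) ≤ n := fun n hn =>
      (le_mul_of_one_le_left (hk n) (by nlinarith [hK.1])).trans (hn₀ n hn)
    have := asympEQ_supBias hd hS hα hβ hM hC hε hbump hmax
      (T := fun n => W.psiIF (n := n) (l₁ n) (l₂ n)) (y := fun n => kMax d (l₁ n) (l₂ n) / n)
      (fun n => div_nonneg (hk' n) n.cast_nonneg) (mul_nonneg (by norm_num) hG)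
      (show 0 < δ ^ 2 / 4 by positivity) (max 1 n₀)
      (fun n hn P p b hR => abs_bias_psiIF_sub_le hR hC hK (hl₁ n) (hl₂ n)
        ((le_max_left _ _).trans hn) (hle n ((le_max_right _ _).trans hn)))
      (fun n hn => le_supBias_psiIF hC hδ.le hK hconst (hl₁ n) (hl₂ n)
        ((le_max_left _ _).trans hn) (hn₀ n ((le_max_right _ _).trans hn)))
    simpa only [kMax_eq] using this
  · refine asympLE_supVar hC (C := 75000 * (max |C₁| |C₂| * K) ^ 4) (by positivity)
      (fun n => ?_) (fun n => varRate_nonneg d n (l₁ n) (l₂ n))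
      fun n hn P p b hR => evariance_psiIF_le hR hC hK (hl₁ n) (hl₂ n) hn
    have := hk n
    have := hk' n
    have e₁ : 0 ≤ kMin d (l₁ n) (l₂ n) ^ 2 / (n : ℝ) ^ 2 := by positivity
    have e₂ : 0 ≤ kMax d (l₁ n) (l₂ n) / (n : ℝ) ^ 2 := by positivity
    have e₄ : 0 ≤ kMin d (l₁ n) (l₂ n) ^ 2 * kMax d (l₁ n) (l₂ n) / (n : ℝ) ^ 4 := by positivity
    rw [varRate]
    linarith
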